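/- Let $d\ge 1$, let $\mu,\nu$ be probability measures on $\mathbb R^d$ that are absolutely continuous with respect to Lebesgue measure and have compact support, let $f$ be the density of $\nu$, and fix $\lambda>0$. For $\varepsilon>0$ put $c_\varepsilon(x,y)=\sum_{i=1}^d\varepsilon^{i-1}(x_i-y_i)^2$ and consider the soft-constrained Kantorovich problem $$\min_\gamma\Big\{\lambda\,\mathcal D_{\mathrm{KL}}\big((\pi_Y)_\sharp\gamma\,\|\,\nu\big)+\int_{\mathbb R^d\times\mathbb R^d}c_\varepsilon(x,y)\,d\gamma(x,y)\;:\;\gamma\in\mathcal P(\mathbb R^d\times\mathbb R^d),\ (\pi_X)_\sharp\gamma=\mu\Big\},$$ where $\pi_X(x,y)=x$, $\pi_Y(x,y)=y$. A Knothe–Rosenblatt (KR) map from $\mu$ to a probability measure $\rho$ on $\mathbb R^d$ is a measurable lower-triangular map $T(x)=(T_1(x_1),T_2(x_1,x_2),\dots,T_d(x_1,\dots,x_d))$ with $T_\sharp\mu=\rho$ such that for every $i$ and $\mu$-almost every $x$ the function $t\mapsto T_i(x_1,\dots,x_{i-1},t)$ is nondecreasing and pushes the conditional law of the $i$-th coordinate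 under $\mu$, given that the preceding coordinates equal $(x_1,\dots,x_{i-1})$, to the conditional law of the $i$-th coordinate under $\rho$, given that the preceding coordinates equal $(T_1(x_1),\dots,T_{i-1}(x_1,\dots,x_{i-1}))$. The associated KR plan is $(\mathrm{id}\times T)_\sharp\mu$. Then for every $\varepsilon>0$ the problem has exactly one minimizer $\gamma_{\varepsilon,\lambda}$, and there is an absolutely continuous probability measure $\nu_\lambda$ on $\mathbb R^d$ and a KR map $T_{\mathrm{KR},\lambda}$ from $\mu$ to $\nu_\lambda$, with KR plan $\gamma_{\mathrm{KR},\lambda}=(\mathrm{id}\times T_{\mathrm{KR},\lambda})_\sharp\mu$, such that $$\gamma_{\varepsilon,\lambda}\rightharpoonup\gamma_{\mathrm{KR},\lambda}\quad\text{narrowly as }\varepsilon\to0^+ .$$ Moreover, there is a continuous function $D:\mathbb R\to(0,\infty)$ such that the density $g_\lambda$ of $\nu_\lambda$ satisfies $$g_\lambda(y)=\frac1{D(x_1)}\exp\Big(-\frac{|x_1-y_1|^2}{\lambda}\Big)f(y)\qquad\text{for }\gamma_{\mathrm{KR},\lambda}\text{-a.e. }(x,y),$$ and, for every $s\in\mathbb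 R$, $g_\lambda(y)\ge \frac1{D(s)}\exp\big(-\frac{|s-y_1|^2}{\lambda}\big)f(y)$ for Lebesgue-a.e. $y\in\mathbb R^d$. -/

import Mathlib

open MeasureTheory Filter Topology

noncomputable section

/-- The weighted quadratic cost `c_ε(x, y) = ∑ᵢ ε^(i-1) (xᵢ - yᵢ)²` on `ℝ^d`
(the coordinates are indexed from `0` here, so the exponent is the index). -/
def weightedCost {d : ℕ} (ε : ℝ) (x y : Fin d → ℝ) : ℝ :=
  ∑ i : Fin d, ε ^ (i : ℕ) * (x i - y i) ^ 2

/-- The functional `γ ↦ lam * KL((π_Y)_# γ ‖ ν) + ∫ c_ε(x, y) dγ(x, y)`, with values in `[0, ∞]`. -/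
def softObjective {d : ℕ} (ε lam : ℝ) (ν : ProbabilityMeasure (Fin d → ℝ))
    (γ : ProbabilityMeasure ((Fin d → ℝ) × (Fin d → ℝ))) : ENNReal :=
  ENNReal.ofReal lam *
      InformationTheory.klDiv ((γ : Measure ((Fin d → ℝ) × (Fin d → ℝ))).map Prod.snd)
        (ν : Measure (Fin d → ℝ)) +
    ∫⁻ p, ENNReal.ofReal (weightedCost ε p.1 p.2) ∂(γ : Measure ((Fin d → ℝ) × (Fin d → ℝ)))

/-- `γ` has first marginal `μ`. -/
def HasFirstMarginal {d : ℕ} (μ : ProbabilityMeasure (Fin d → ℝ))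
    (γ : ProbabilityMeasure ((Fin d → ℝ) × (Fin d → ℝ))) : Prop :=
  (γ : Measure ((Fin d → ℝ) × (Fin d → ℝ))).map Prod.fst = (μ : Measure (Fin d → ℝ))

/-- `γ` is a minimizer of the soft-constrained Kantorovich problem `K_{ε,lam}(μ, ν)`: only the first
marginal is prescribed, the second one is penalized by the Kullback-Leibler divergence to `ν`. -/
def IsSoftMinimizer {d : ℕ} (ε lam : ℝ) (μ ν : ProbabilityMeasure (Fin d → ℝ))
    (γ : ProbabilityMeasure ((Fin d → ℝ) × (Fin d → ℝ))) : Prop :=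
  HasFirstMarginal μ γ ∧
    ∀ γ' : ProbabilityMeasure ((Fin d → ℝ) × (Fin d → ℝ)), HasFirstMarginal μ γ' →
      softObjective ε lam ν γ ≤ softObjective ε lam ν γ'

/-- The coordinates of `x` that precede the `i`-th one. -/
def prevCoords {d : ℕ} (i : Fin d) (x : Fin d → ℝ) : Set.Iio i → ℝ := fun j => x j

/-- The conditional law under `μ` of the `i`-th coordinate given the preceding ones
(for the first coordinate: the first marginal of `μ`). -/
def condCoord {d : ℕ} (μ : ProbabilityMeasure (Fin d → ℝ)) (i : Fin d) :
    ProbabilityTheory.Kernel (Set.Iio i → ℝ) ℝ :=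
  ProbabilityTheory.condDistrib (fun x : Fin d → ℝ => x i) (prevCoords i)
    (μ : Measure (Fin d → ℝ))

/-- `T` is a Knothe-Rosenblatt map from `μ` to `ν`: it is lower triangular,
`T x = (T₁(x₁), T₂(x₁, x₂), …)`, pushes `μ` to `ν`, and its `i`-th component, as a function of `xᵢ`
alone, is the monotone rearrangement of the conditional law of `xᵢ` under `μ` given
the preceding coordinates of `x` onto the conditional law of `yᵢ` under `ν` given that the preceding
coordinates of `y` are those of `T x`. -/
structure IsKnotheRosenblattMap {d : ℕ} (μ ν : ProbabilityMeasure (Fin d → ℝ))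
    (T : (Fin d → ℝ) → (Fin d → ℝ)) : Prop where
  measurable : Measurable T
  map_eq : (μ : Measure (Fin d → ℝ)).map T = (ν : Measure (Fin d → ℝ))
  triangular : ∀ (i : Fin d) (x x' : Fin d → ℝ), (∀ j ≤ i, x j = x' j) → T x i = T x' i
  monotone_slice : ∀ i : Fin d, ∀ᵐ x ∂(μ : Measure (Fin d → ℝ)),
    Monotone (fun t : ℝ => T (Function.update x i t) i)
  map_slice : ∀ i : Fin d, ∀ᵐ x ∂(μ : Measure (Fin d → ℝ)),
    (condCoord μ i (prevCoords i x)).map (fun t : ℝ => T (Function.update x i t) i) =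
      condCoord ν i (prevCoords i (T x))

/-- `γ` is the plan `(id × T)_# μ` induced by `T`. -/
def IsInducedPlan {d : ℕ} (μ : ProbabilityMeasure (Fin d → ℝ)) (T : (Fin d → ℝ) → (Fin d → ℝ))
    (γ : ProbabilityMeasure ((Fin d → ℝ) × (Fin d → ℝ))) : Prop :=
  (γ : Measure ((Fin d → ℝ) × (Fin d → ℝ))) = (μ : Measure (Fin d → ℝ)).map (fun x => (x, T x))

/-- The Lebesgue density of an (absolutely continuous) probability measure on `ℝ^d`. -/
def lebDensity {d : ℕ} (μ : ProbabilityMeasure (Fin d → ℝ)) (y : Fin d → ℝ) : ℝ :=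
  ((μ : Measure (Fin d → ℝ)).rnDeriv volume y).toReal

end

/-!
The argument rests on a dual potential. Maximizing the concave functional
`g ↦ ∫ minVal c g dμ - lam * log ∫ e^(g / lam) dν` over continuous `g` gives an optimal potential,
and the first-order condition says that the map `S`, which sends `x` to the minimizer of
`c(x, ·) + g`, transports `μ` to the tilted measure `e^(g / lam) ν / Z`
(`exists_quadCost_potential`; absolute continuity of `μ` makes the minimizer unique almost
everywhere). Relative to the tilted target the objective is, up to a constant, `lam` times a
relative entropy plus `∫ (c + g - m) dγ` with `m = minVal c g`. Both terms are nonnegative, and both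
vanish for the plan induced by `S` and for no other plan: this is `existsUnique_isSoftMinimizer`.

For `ε = 0` only the first coordinate enters the cost, and the same duality in dimension one
produces a potential `b` with transform `m`. The limit target is `N`, the tilting of `ν` by
`b(y₀) / lam`, where `y₀` is the first coordinate. The first component `T₀` of the Knothe-Rosenblatt
map from `μ` to `N` is optimal for this problem, because a monotone map is the most correlated one
among those with a given law (`IsFirstPotential.ae_krMap_eq`). Hence
`b(T₀ x) = m(x₀) - (x₀ - T₀ x)²` almost surely, while `b(t) ≥ m(s) - (s - t)²` for all `s` and all
`t` in an interval that carries the first coordinates. These two relations are the density formula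
and the density bound, with `D(s) = Z e^(-m(s) / lam)`.

It remains to show that the minimizers `γ_ε` converge to the Knothe-Rosenblatt plan. Comparison with
that plan shows that their second marginals converge to `N` in relative entropy, at rate `O(ε)`
(`IsMinimizingFamily.tendsto_klDiv`). By Gibbs' variational principle they then converge setwise,
that is, against all bounded measurable functions (`bddTendsto_of_klDiv`). This is what makes
conditional laws and quantile functions manageable, although they are merely measurable.

The coordinates are treated one after the other. Suppose that under `γ_ε` the coordinates of `y`
before the `k`-th are close in measure to those of the Knothe-Rosenblatt map of `x`. The competitor
`compPlan` keeps the first `k` coordinates of `γ_ε` and samples the others with conditional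
quantile functions at common uniform levels. By the data processing inequality it has no larger
entropy; the costs of the first `k` coordinates are unchanged, and the coordinates after the `k`-th
cost `O(ε^(k + 1))`. So optimality of `γ_ε` bounds its `k`-th cost by that of the competitor
(`IsMinimizingFamily.integral_sq_sub_le_compPlan`), and the latter converges to the
Knothe-Rosenblatt cost. Expressed by the slack in Young's inequality for the monotone slices of the
Knothe-Rosenblatt map, this says that the mean of the nonnegative function `monoSlack` tends to zero
(`IsMinimizingFamily.tendsto_integral_monoSlack`). The slack is bounded below, away from the graph,
by a gap which is almost surely positive (`ae_slackGap_pos`), and therefore the `k`-th coordinates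
become close in measure as well (`IsMinimizingFamily.tendsto_measureReal_coord`). Plans that
concentrate near the graph of a map converge narrowly to the induced plan
(`tendsto_of_tendsto_measureReal_dist`).
-/

open MeasureTheory Filter Topology

noncomputable section

/-! ### Setwise convergence of measures -/

/-- Convergence of the measures `α i` to `β` against every bounded measurable function. -/
def BddTendsto {I Z : Type*} [MeasurableSpace Z] (l : Filter I) (α : I → Measure Z)
    (β : Measure Z) : Prop :=
  ∀ f : Z → ℝ, Measurable f → ∀ M : ℝ, (∀ z, |f z| ≤ M) →
    Tendsto (fun i => ∫ z, f z ∂α i) l (𝓝 (∫ z, f z ∂β))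

theorem BddTendsto.map {I Z Z' : Type*} [MeasurableSpace Z] [MeasurableSpace Z'] {l : Filter I}
    {α : I → Measure Z} {β : Measure Z} (h : BddTendsto l α β) {Φ : Z → Z'} (hΦ : Measurable Φ) :
    BddTendsto l (fun i => (α i).map Φ) (β.map Φ) := by
  intro f hf M hM
  have := h (f ∘ Φ) (hf.comp hΦ) M (fun z => hM _)
  simpa [integral_map hΦ.aemeasurable hf.aestronglyMeasurable] using this

theorem integrable_of_abs_le {Z : Type*} [MeasurableSpace Z] {μ : Measure Z} [IsFiniteMeasure μ]
    {f : Z → ℝ} (hf : Measurable f) {M : ℝ} (hM : ∀ z, |f z| ≤ M) : Integrable f μ :=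
  Integrable.of_bound hf.aestronglyMeasurable M (Eventually.of_forall hM)

theorem integrable_of_ae_abs_le {Z : Type*} [MeasurableSpace Z] {μ : Measure Z} [IsFiniteMeasure μ]
    {f : Z → ℝ} (hf : Measurable f) {M : ℝ} (hM : ∀ᵐ z ∂μ, |f z| ≤ M) : Integrable f μ :=
  Integrable.of_bound hf.aestronglyMeasurable M hM

theorem BddTendsto.prod {I Z Z' : Type*} [MeasurableSpace Z] [MeasurableSpace Z'] {l : Filter I}
    {α : I → Measure Z} {β : Measure Z} (h : BddTendsto l α β) [∀ i, IsFiniteMeasure (α i)]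
    [IsFiniteMeasure β] (σ : Measure Z') [IsFiniteMeasure σ] :
    BddTendsto l (fun i => (α i).prod σ) (β.prod σ) := by
  intro f hf M hM
  have e : ∀ τ : Measure Z, IsFiniteMeasure τ →
      ∫ z, f z ∂(τ.prod σ) = ∫ z, (∫ w, f (z, w) ∂σ) ∂τ := fun τ _ =>
    integral_prod f (integrable_of_abs_le hf hM)
  simp_rw [e _ inferInstance]
  refine h _ (hf.stronglyMeasurable.integral_prod_right' (ν := σ)).measurable
    (M * σ.real Set.univ) ?_
  intro z
  have := norm_integral_le_of_norm_le_const (μ := σ) (f := fun w => f (z, w)) (C := M)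
    (Eventually.of_forall fun w => hM _)
  simpa using this

/-- A version of the defining convergence for functions that are bounded only on a set carrying
all the measures. -/
theorem BddTendsto.tendsto_integral_of_ae {I Z : Type*} [MeasurableSpace Z] {l : Filter I}
    {α : I → Measure Z} {β : Measure Z} (h : BddTendsto l α β) {s : Set Z} (hs : MeasurableSet s)
    (hα : ∀ᶠ i in l, ∀ᵐ z ∂α i, z ∈ s) (hβ : ∀ᵐ z ∂β, z ∈ s) {f : Z → ℝ} (hf : Measurable f)
    {M : ℝ} (hM : ∀ z ∈ s, |f z| ≤ M) :
    Tendsto (fun i => ∫ z, f z ∂α i) l (𝓝 (∫ z, f z ∂β)) := by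
  have key : ∀ τ : Measure Z, (∀ᵐ z ∂τ, z ∈ s) → ∫ z, s.indicator f z ∂τ = ∫ z, f z ∂τ := by
    intro τ hτ
    refine integral_congr_ae ?_
    filter_upwards [hτ] with z hz using Set.indicator_of_mem hz f
  have h1 := h (s.indicator f) (hf.indicator hs) (max M 0) (fun z => by
    by_cases hz : z ∈ s
    · rw [Set.indicator_of_mem hz]; exact (hM z hz).trans (le_max_left _ _)
    · rw [Set.indicator_of_notMem hz]; simp)
  rw [key β hβ] at h1
  refine h1.congr' ?_
  filter_upwards [hα] with i hi using key _ hi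

/-- If `A` and `B` become close in measure, the law of `A` converges setwise to `β` and `B` has
law `β`, then `V ∘ A` and `V ∘ B` become close in `L¹` for every bounded measurable `V`, however
discontinuous: `V` is approximated in `L¹(β)` by a continuous function with compact support. -/
theorem tendsto_integral_abs_sub_of_close {I Ω Z : Type*} [MeasurableSpace Ω] [MetricSpace Z]
    [ProperSpace Z] [SecondCountableTopology Z] [MeasurableSpace Z] [BorelSpace Z]
    {l : Filter I} {P : I → Measure Ω} [∀ i, IsFiniteMeasure (P i)] {A B : Ω → Z}
    (hA : Measurable A) (hB : Measurable B) {β : Measure Z} [IsFiniteMeasure β]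
    (h1 : BddTendsto l (fun i => (P i).map A) β) (h2 : ∀ᶠ i in l, (P i).map B = β)
    (h3 : ∀ r > 0, Tendsto (fun i => (P i).real {ω | r ≤ dist (A ω) (B ω)}) l (𝓝 0))
    {V : Z → ℝ} (hV : Measurable V) {M : ℝ} (hM : ∀ z, |V z| ≤ M) :
    Tendsto (fun i => ∫ ω, |V (A ω) - V (B ω)| ∂P i) l (𝓝 0) := by
  have hc : 0 ≤ β.real Set.univ := measureReal_nonneg
  rw [Metric.tendsto_nhds]
  intro η hη
  -- the approximation costs `2 * δ` and `δ`, the uniform continuity `δ` times the total mass, and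
  -- the exceptional set `δ`
  set δ : ℝ := η / (6 + β.real Set.univ) with hδ
  have hδ0 : 0 < δ := by positivity
  obtain ⟨g, hgc, hgI, hg, hgint⟩ :=
    (integrable_of_abs_le (μ := β) hV hM).exists_hasCompactSupport_integral_sub_le hδ0
  obtain ⟨M', hM'⟩ : ∃ M', ∀ z, |g z| ≤ M' := by
    obtain ⟨C, hC⟩ := hgc.exists_bound_of_continuous hg
    exact ⟨C, hC⟩
  obtain ⟨r, hr, hgr⟩ := Metric.uniformContinuous_iff.1
    (hgc.uniformContinuous_of_continuous hg) δ hδ0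
  have hD : Measurable fun z => |V z - g z| := (hV.sub hg.measurable).abs
  have hDb : ∀ z, |(|V z - g z|)| ≤ M + M' := fun z => by
    rw [abs_abs]; exact (abs_sub _ _).trans (add_le_add (hM z) (hM' z))
  have t1 := h1 _ hD _ hDb
  have t2 := (h3 r hr).const_mul (2 * M')
  rw [mul_zero] at t2
  have e1 : ∀ᶠ i in l, ∫ z, |V z - g z| ∂((P i).map A) < 2 * δ :=
    t1.eventually (gt_mem_nhds (lt_of_le_of_lt hgI (by linarith)))
  have e2 : ∀ᶠ i in l, 2 * M' * (P i).real {ω | r ≤ dist (A ω) (B ω)} < δ :=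
    t2.eventually (gt_mem_nhds hδ0)
  filter_upwards [e1, e2, h2] with i hi1 hi2 hi3
  have hset : MeasurableSet {ω | r ≤ dist (A ω) (B ω)} :=
    measurableSet_le measurable_const (hA.dist hB)
  have hPc : (P i).real Set.univ = β.real Set.univ := by
    rw [← hi3, map_measureReal_apply hB MeasurableSet.univ, Set.preimage_univ]
  have iA : Integrable (fun ω => |V (A ω) - g (A ω)|) (P i) :=
    integrable_of_abs_le (hD.comp hA) (fun ω => hDb _)
  have iB : Integrable (fun ω => |V (B ω) - g (B ω)|) (P i) :=
    integrable_of_abs_le (hD.comp hB) (fun ω => hDb _)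
  have iI : Integrable ({ω | r ≤ dist (A ω) (B ω)}.indicator fun _ => 2 * M') (P i) :=
    (integrable_const _).indicator hset
  have hle : ∫ ω, |V (A ω) - V (B ω)| ∂P i ≤ ∫ ω, (|V (A ω) - g (A ω)| +
      (δ + {ω | r ≤ dist (A ω) (B ω)}.indicator (fun _ => 2 * M') ω) +
      |V (B ω) - g (B ω)|) ∂P i := by
    refine integral_mono_of_nonneg (Eventually.of_forall fun ω => abs_nonneg _)
      ((iA.add ((integrable_const δ).add iI)).add iB) (Eventually.of_forall fun ω => ?_)
    have hmid : |g (A ω) - g (B ω)| ≤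
        δ + {ω | r ≤ dist (A ω) (B ω)}.indicator (fun _ => 2 * M') ω := by
      by_cases hω : r ≤ dist (A ω) (B ω)
      · rw [Set.indicator_of_mem (show ω ∈ {ω | r ≤ dist (A ω) (B ω)} from hω)]
        have := (abs_sub (g (A ω)) (g (B ω))).trans (add_le_add (hM' _) (hM' _))
        linarith
      · rw [Set.indicator_of_notMem (show ω ∉ {ω | r ≤ dist (A ω) (B ω)} from hω)]
        have := hgr (not_le.1 hω)
        rw [Real.dist_eq] at this
        linarith
    have h3 : |V (A ω) - V (B ω)| ≤ |V (A ω) - g (A ω)| + |g (A ω) - g (B ω)| +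
        |V (B ω) - g (B ω)| := by
      have e : V (A ω) - V (B ω) = (V (A ω) - g (A ω)) + (g (A ω) - g (B ω)) -
        (V (B ω) - g (B ω)) := by ring
      rw [e]
      exact (abs_sub _ _).trans (add_le_add_left (abs_add_le _ _) _)
    linarith
  rw [integral_add (iA.fun_add ((integrable_const δ).fun_add iI)) iB,
    integral_add iA ((integrable_const δ).fun_add iI), integral_add (integrable_const δ) iI,
    integral_const, integral_indicator_const _ hset, hPc] at hle
  have eA : ∫ ω, |V (A ω) - g (A ω)| ∂P i = ∫ z, |V z - g z| ∂((P i).map A) :=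
    (integral_map hA.aemeasurable hD.aestronglyMeasurable).symm
  have eB : ∫ ω, |V (B ω) - g (B ω)| ∂P i = ∫ z, |V z - g z| ∂β := by
    rw [← hi3]
    exact (integral_map hB.aemeasurable hD.aestronglyMeasurable).symm
  rw [eA, eB] at hle
  have hgI' : ∫ z, |V z - g z| ∂β ≤ δ := hgI
  simp only [smul_eq_mul] at hle
  rw [Real.dist_eq, sub_zero, abs_of_nonneg (integral_nonneg fun ω => abs_nonneg _)]
  have hηδ : δ * (6 + β.real Set.univ) = η := by rw [hδ]; field_simp
  nlinarith

/-- Markov's inequality in the form used for convergence in measure. -/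
theorem tendsto_measureReal_le_abs {I Ω : Type*} [MeasurableSpace Ω] {l : Filter I}
    {P : I → Measure Ω} [∀ i, IsFiniteMeasure (P i)] {f : Ω → ℝ} (hf : Measurable f) {M : ℝ}
    (hM : ∀ᶠ i in l, ∀ᵐ ω ∂P i, |f ω| ≤ M) (h : Tendsto (fun i => ∫ ω, |f ω| ∂P i) l (𝓝 0))
    {r : ℝ} (hr : 0 < r) :
    Tendsto (fun i => (P i).real {ω | r ≤ |f ω|}) l (𝓝 0) := by
  have h' := h.const_mul r⁻¹
  rw [mul_zero] at h'
  refine squeeze_zero' (Eventually.of_forall fun i => measureReal_nonneg) ?_ h'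
  filter_upwards [hM] with i hi
  have := mul_meas_ge_le_integral_of_nonneg (μ := P i) (f := fun ω => |f ω|)
    (Eventually.of_forall fun ω => abs_nonneg _)
    (integrable_of_ae_abs_le hf.abs (by simpa using hi)) r
  rw [inv_mul_eq_div, le_div_iff₀ hr, mul_comm]
  exact this

/-! ### Gibbs' variational principle -/

theorem integrable_exp_of_abs_le {Z : Type*} [MeasurableSpace Z] {ν : Measure Z}
    [IsFiniteMeasure ν] {f : Z → ℝ} (hf : Measurable f) {M : ℝ} (hM : ∀ z, |f z| ≤ M) :
    Integrable (fun z => Real.exp (f z)) ν :=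
  integrable_of_abs_le hf.exp (M := Real.exp M) fun z => by
    rw [abs_of_pos (Real.exp_pos _)]
    exact Real.exp_le_exp.2 ((le_abs_self _).trans (hM z))

theorem isProbabilityMeasure_tilted_of_abs_le {Z : Type*} [MeasurableSpace Z] {ν : Measure Z}
    [IsProbabilityMeasure ν] {f : Z → ℝ} (hf : Measurable f) {M : ℝ} (hM : ∀ z, |f z| ≤ M) :
    IsProbabilityMeasure (ν.tilted f) :=
  isProbabilityMeasure_tilted (integrable_exp_of_abs_le hf hM)

open InformationTheory in
theorem klDiv_tilted_ne_top {Z : Type*} [MeasurableSpace Z] {ρ ν : Measure Z}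
    [IsProbabilityMeasure ρ] [IsProbabilityMeasure ν] {f : Z → ℝ} (hf : Measurable f) {M : ℝ}
    (hM : ∀ z, |f z| ≤ M) (h : klDiv ρ ν ≠ ⊤) : klDiv ρ (ν.tilted f) ≠ ⊤ := by
  obtain ⟨h1, h2⟩ := klDiv_ne_top_iff.1 h
  have hexp := integrable_exp_of_abs_le (ν := ν) hf hM
  exact klDiv_ne_top (h1.trans (absolutelyContinuous_tilted hexp))
    (integrable_llr_tilted_right h1 (integrable_of_abs_le hf hM) h2 hexp)

open InformationTheory in
/-- Tilting the reference measure changes the Kullback-Leibler divergence by an affine term. -/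
theorem toReal_klDiv_tilted {Z : Type*} [MeasurableSpace Z] {ρ ν : Measure Z}
    [IsProbabilityMeasure ρ] [IsProbabilityMeasure ν] {f : Z → ℝ} (hf : Measurable f) {M : ℝ}
    (hM : ∀ z, |f z| ≤ M) (h : klDiv ρ ν ≠ ⊤) :
    (klDiv ρ ν).toReal = (klDiv ρ (ν.tilted f)).toReal + ∫ z, f z ∂ρ -
      Real.log (∫ z, Real.exp (f z) ∂ν) := by
  obtain ⟨h1, h2⟩ := klDiv_ne_top_iff.1 h
  have hexp := integrable_exp_of_abs_le (ν := ν) hf hM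
  have := isProbabilityMeasure_tilted_of_abs_le (ν := ν) hf hM
  rw [toReal_klDiv_of_measure_eq h1 (by simp),
    toReal_klDiv_of_measure_eq (h1.trans (absolutelyContinuous_tilted hexp)) (by simp),
    integral_llr_tilted_right h1 (integrable_of_abs_le hf hM) hexp h2]
  ring

open InformationTheory in
/-- The Donsker-Varadhan inequality for bounded functions. -/
theorem integral_sub_log_integral_exp_le_klDiv {Z : Type*} [MeasurableSpace Z] {ρ ν : Measure Z}
    [IsProbabilityMeasure ρ] [IsProbabilityMeasure ν] {f : Z → ℝ} (hf : Measurable f) {M : ℝ}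
    (hM : ∀ z, |f z| ≤ M) (h : klDiv ρ ν ≠ ⊤) :
    ∫ z, f z ∂ρ - Real.log (∫ z, Real.exp (f z) ∂ν) ≤ (klDiv ρ ν).toReal := by
  rw [toReal_klDiv_tilted hf hM h]
  have : 0 ≤ (klDiv ρ (ν.tilted f)).toReal := ENNReal.toReal_nonneg
  linarith

/-- A quadratic upper bound for the cumulant generating function of a bounded function near the
origin. -/
theorem log_integral_exp_le {Z : Type*} [MeasurableSpace Z] {ν : Measure Z}
    [IsProbabilityMeasure ν] {f : Z → ℝ} (hf : Measurable f) {M s : ℝ}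
    (hM : ∀ z, |f z| ≤ M) (hs : 0 ≤ s) (hsM : s * M ≤ 1) :
    Real.log (∫ z, Real.exp (s * f z) ∂ν) ≤ s * ∫ z, f z ∂ν + (s * M) ^ 2 := by
  have hb : ∀ z, |s * f z| ≤ s * M := fun z => by
    rw [abs_mul, abs_of_nonneg hs]; exact mul_le_mul_of_nonneg_left (hM z) hs
  have hI := integrable_exp_of_abs_le (ν := ν) (hf.const_mul s) hb
  have hfI := integrable_of_abs_le (μ := ν) (hf.const_mul s) hb
  have hpos : 0 < ∫ z, Real.exp (s * f z) ∂ν := integral_exp_pos hI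
  refine (Real.log_le_sub_one_of_pos hpos).trans ?_
  have : ∫ z, Real.exp (s * f z) ∂ν ≤ ∫ z, (1 + s * f z + (s * M) ^ 2) ∂ν := by
    refine integral_mono hI (((integrable_const _).add hfI).add (integrable_const _)) fun z => ?_
    have h1 : |s * f z| ≤ 1 := (hb z).trans hsM
    have h2 := abs_le.1 (Real.abs_exp_sub_one_sub_id_le h1)
    have h3 : (s * f z) ^ 2 ≤ (s * M) ^ 2 := sq_le_sq' (abs_le.1 (hb z)).1 (abs_le.1 (hb z)).2
    simp only
    linarith [h2.2]
  rw [integral_add ((integrable_const _).fun_add hfI) (integrable_const _),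
    integral_add (integrable_const _) hfI, integral_const_mul] at this
  simp at this
  linarith

open InformationTheory in
/-- Convergence in relative entropy implies setwise convergence. -/
theorem bddTendsto_of_klDiv {I Z : Type*} [MeasurableSpace Z] {l : Filter I}
    {ρ : I → Measure Z} {ν : Measure Z} [∀ i, IsProbabilityMeasure (ρ i)] [IsProbabilityMeasure ν]
    (hfin : ∀ᶠ i in l, klDiv (ρ i) ν ≠ ⊤)
    (h : Tendsto (fun i => (klDiv (ρ i) ν).toReal) l (𝓝 0)) : BddTendsto l ρ ν := by
  have upper : ∀ f : Z → ℝ, Measurable f → ∀ M : ℝ, (∀ z, |f z| ≤ M) → ∀ η > 0,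
      ∀ᶠ i in l, ∫ z, f z ∂ρ i < ∫ z, f z ∂ν + η := by
    intro f hf M hM η hη
    -- apply the variational principle to `s * f`, with `s` so small that the quadratic error in
    -- `log_integral_exp_le` is at most `s * η / 2`
    set s : ℝ := min (1 / (|M| + 1)) (η / (2 * (|M| + 1) ^ 2)) with hs
    have hs0 : 0 < s := by positivity
    have hM1 : ∀ z, |f z| ≤ |M| + 1 := fun z => (hM z).trans ((le_abs_self M).trans (by linarith))
    have hsM : s * (|M| + 1) ≤ 1 := by
      calc s * (|M| + 1) ≤ 1 / (|M| + 1) * (|M| + 1) := by gcongr; exact min_le_left _ _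
        _ = 1 := by field_simp
    have hsη : s * (|M| + 1) ^ 2 ≤ η / 2 := by
      calc s * (|M| + 1) ^ 2 ≤ η / (2 * (|M| + 1) ^ 2) * (|M| + 1) ^ 2 := by
            gcongr; exact min_le_right _ _
        _ = η / 2 := by field_simp
    filter_upwards [hfin, h.eventually (gt_mem_nhds (show (0 : ℝ) < s * (η / 2) by positivity))]
      with i hi1 hi2
    have h1 := integral_sub_log_integral_exp_le_klDiv (ρ := ρ i) (ν := ν) (hf.const_mul s)
      (M := s * (|M| + 1)) (fun z => by
        rw [abs_mul, abs_of_pos hs0]; exact mul_le_mul_of_nonneg_left (hM1 z) hs0.le) hi1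
    have h2 := log_integral_exp_le (ν := ν) hf hM1 hs0.le hsM
    rw [integral_const_mul] at h1
    have h3 : s * ∫ z, f z ∂ρ i < s * (∫ z, f z ∂ν + η) := by nlinarith
    exact lt_of_mul_lt_mul_left h3 hs0.le
  intro f hf M hM
  rw [Metric.tendsto_nhds]
  intro η hη
  filter_upwards [upper f hf M hM η hη, upper (fun z => -f z) hf.neg M (by simpa using hM) η hη]
    with i h1 h2
  simp only [integral_neg] at h2
  rw [Real.dist_eq, abs_lt]
  constructor <;> linarith

/-! ### Dual potentials for the soft-constrained problem -/

/-- The infimal value `min_y (c(x, y) + g(y))`. -/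
def minVal {X Y : Type*} (c : X → Y → ℝ) (g : Y → ℝ) (x : X) : ℝ := ⨅ y, (c x y + g y)

section minVal

variable {X Y : Type*} {c : X → Y → ℝ}

theorem exists_eq_minVal [TopologicalSpace Y] [CompactSpace Y] [Nonempty Y]
    (hc : ∀ x, Continuous (c x)) {g : Y → ℝ} (hg : Continuous g) (x : X) :
    ∃ y, c x y + g y = minVal c g x := by
  obtain ⟨y, -, hy⟩ := isCompact_univ.exists_isMinOn (Set.univ_nonempty (α := Y))
    ((hc x).add hg).continuousOn
  exact ⟨y, le_antisymm (le_ciInf fun z => hy (Set.mem_univ z))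
    (ciInf_le (isCompact_range ((hc x).add hg)).bddBelow y)⟩

theorem minVal_le [TopologicalSpace Y] [CompactSpace Y] (hc : ∀ x, Continuous (c x))
    {g : Y → ℝ} (hg : Continuous g) (x : X) (y : Y) :
    minVal c g x ≤ c x y + g y := by
  exact ciInf_le (isCompact_range ((hc x).add hg)).bddBelow y

theorem le_minVal [Nonempty Y] {g : Y → ℝ} {x : X} {a : ℝ} (h : ∀ y, a ≤ c x y + g y) :
    a ≤ minVal c g x :=
  le_ciInf h

theorem minVal_le_minVal_add [TopologicalSpace Y] [CompactSpace Y] [Nonempty Y]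
    (hc : ∀ x, Continuous (c x)) {g h : Y → ℝ} (hg : Continuous g)
    {r : ℝ} (hgh : ∀ y, g y ≤ h y + r) (x : X) : minVal c g x ≤ minVal c h x + r := by
  rw [← sub_le_iff_le_add]
  refine le_minVal fun y => ?_
  have := minVal_le hc hg x y
  have := hgh y
  linarith

theorem abs_minVal_le [TopologicalSpace Y] [CompactSpace Y] [Nonempty Y]
    (hc : ∀ x, Continuous (c x)) {g : Y → ℝ} (hg : Continuous g) {B G : ℝ}
    {x : X} (hB : ∀ y, |c x y| ≤ B) (hG : ∀ y, |g y| ≤ G) : |minVal c g x| ≤ B + G := by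
  obtain ⟨y, hy⟩ := exists_eq_minVal hc hg x
  rw [← hy]
  exact (abs_add_le _ _).trans (add_le_add (hB y) (hG y))

end minVal

theorem ContinuousMap.abs_apply_le {Y : Type*} [TopologicalSpace Y] [CompactSpace Y] (g : C(Y, ℝ))
    (y : Y) : |g y| ≤ ‖g‖ := g.norm_coe_le_norm y

theorem integrable_exp_div {Y : Type*} [MetricSpace Y] [CompactSpace Y] [MeasurableSpace Y]
    [BorelSpace Y] {ν : Measure Y} [IsProbabilityMeasure ν] (g : C(Y, ℝ)) (lam : ℝ) :
    Integrable (fun y => Real.exp (g y / lam)) ν :=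
  Continuous.integrable_of_hasCompactSupport (by fun_prop) (HasCompactSupport.of_compactSpace _)

/-- The normalized Lipschitz potentials form a compact set, by the Arzelà-Ascoli theorem. -/
theorem isCompact_lipschitz_potentials {Y : Type*} [MetricSpace Y] (K : NNReal) (y₀ : Y) :
    IsCompact {g : C(Y, ℝ) | LipschitzWith K g ∧ g y₀ = 0} := by
  refine ArzelaAscoli.isCompact_of_equicontinuous _ ?_ ?_
  · have e : ContinuousMap.toFun '' {g : C(Y, ℝ) | LipschitzWith K g ∧ g y₀ = 0} =
        {f : Y → ℝ | (∀ y z, |f y - f z| ≤ K * dist y z) ∧ f y₀ = 0} := by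
      ext f
      constructor
      · rintro ⟨g, ⟨h1, h2⟩, rfl⟩
        exact ⟨fun y z => h1.dist_le_mul y z, h2⟩
      · rintro ⟨h1, h2⟩
        have : LipschitzWith K f := LipschitzWith.of_dist_le_mul h1
        exact ⟨⟨f, this.continuous⟩, ⟨this, h2⟩, rfl⟩
    rw [e]
    refine IsCompact.of_isClosed_subset
      (isCompact_univ_pi (s := fun y => Set.Icc (-(K * dist y y₀)) (K * dist y y₀))
        fun y => isCompact_Icc) ?_ ?_
    · have e : {f : Y → ℝ | (∀ y z, |f y - f z| ≤ K * dist y z) ∧ f y₀ = 0} =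
          (⋂ y, ⋂ z, {f : Y → ℝ | |f y - f z| ≤ K * dist y z}) ∩ {f | f y₀ = 0} := by
        ext f; simp
      rw [e]
      exact (isClosed_iInter fun y => isClosed_iInter fun z =>
        isClosed_le (by fun_prop) continuous_const).inter
        (isClosed_eq (continuous_apply _) continuous_const)
    · rintro f ⟨h1, h2⟩ y -
      have := h1 y y₀
      rw [h2, sub_zero] at this
      exact abs_le.1 this
  · exact (LipschitzWith.uniformEquicontinuous _ K fun g => g.2.1).equicontinuous

/-- The one-sided derivative of the minimal value in the direction `h` is the value of `h` at the
unique minimizer. -/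
theorem tendsto_minVal_slope {X Y : Type*} [TopologicalSpace Y] [CompactSpace Y] [Nonempty Y]
    {c : X → Y → ℝ} (hc : ∀ x, Continuous (c x)) (g h : C(Y, ℝ)) {x : X}
    {y₀ : Y} (hy₀ : ∀ y, c x y + g y = minVal c g x → y = y₀) {t : ℕ → ℝ} (ht : ∀ n, 0 < t n)
    (ht0 : Tendsto t atTop (𝓝 0)) :
    Tendsto (fun n => (minVal c (g + t n • h) x - minVal c g x) / t n) atTop (𝓝 (h y₀)) := by
  have hcont : ∀ s : ℝ, Continuous (⇑g + s • ⇑h) := fun s => (g + s • h).continuous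
  have hmin : c x y₀ + g y₀ = minVal c g x := by
    obtain ⟨y, hy⟩ := exists_eq_minVal hc g.continuous x
    rwa [← hy₀ y hy]
  have hup : ∀ n, (minVal c (g + t n • h) x - minVal c g x) / t n ≤ h y₀ := by
    intro n
    have := minVal_le hc (hcont (t n)) x y₀
    rw [div_le_iff₀ (ht n)]
    simp at this
    linarith
  rw [Metric.tendsto_atTop]
  intro η hη
  -- away from `{h > h y₀ - η}` the function `c x + g` stays above its minimum
  obtain ⟨κ, hκ, hgap⟩ : ∃ κ > 0, ∀ y, h y ≤ h y₀ - η → minVal c g x + κ ≤ c x y + g y := by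
    have hcl : IsClosed {y | h y ≤ h y₀ - η} := isClosed_le h.continuous continuous_const
    rcases Set.eq_empty_or_nonempty {y | h y ≤ h y₀ - η} with he | hne
    · exact ⟨1, one_pos, fun y hy => absurd (show y ∈ {y | h y ≤ h y₀ - η} from hy) (by simp [he])⟩
    · obtain ⟨y₁, hy₁, hmin₁⟩ := hcl.isCompact.exists_isMinOn hne
        ((hc x).add g.continuous).continuousOn
      have hle := minVal_le hc g.continuous x y₁
      have hne' : minVal c g x ≠ c x y₁ + g y₁ := fun he => by
        have := hy₀ y₁ he.symm
        rw [this] at hy₁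
        have : h y₀ ≤ h y₀ - η := hy₁
        linarith
      refine ⟨c x y₁ + g y₁ - minVal c g x, sub_pos.2 (lt_of_le_of_ne hle hne'), fun y hy => ?_⟩
      have : c x y₁ + g y₁ ≤ c x y + g y := hmin₁ hy
      linarith
  have hev : ∀ᶠ n in atTop, t n * (2 * ‖h‖) < κ := by
    have := ht0.mul_const (2 * ‖h‖)
    rw [zero_mul] at this
    exact this.eventually (gt_mem_nhds hκ)
  obtain ⟨n₀, hn₀⟩ := eventually_atTop.1 hev
  refine ⟨n₀, fun n hn => ?_⟩
  obtain ⟨y, hy⟩ := exists_eq_minVal hc (hcont (t n)) x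
  simp only [Pi.add_apply, Pi.smul_apply, smul_eq_mul] at hy
  have hyη : h y₀ - η < h y := by
    by_contra hcon
    have h1 := hgap y (not_lt.1 hcon)
    have h2 := hup n
    rw [div_le_iff₀ (ht n)] at h2
    have h3 := (abs_le.1 (h.abs_apply_le y)).1
    have h4 := (abs_le.1 (h.abs_apply_le y₀)).2
    have h5 := hn₀ n hn
    have h6 := ht n
    nlinarith
  have hlow : h y ≤ (minVal c (g + t n • h) x - minVal c g x) / t n := by
    rw [le_div_iff₀ (ht n)]
    have := minVal_le hc g.continuous x y
    linarith
  rw [Real.dist_eq, abs_lt]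
  have := hup n
  constructor <;> linarith

section dual

variable {X Y : Type*} [MeasurableSpace X] [MetricSpace Y]

/-- The dual functional of the soft-constrained problem, evaluated at a potential on the target. -/
def dualFunctional [MeasurableSpace Y] (μ : Measure X) (ν : Measure Y) (c : X → Y → ℝ) (lam : ℝ)
    (g : C(Y, ℝ)) : ℝ :=
  ∫ x, minVal c g x ∂μ - lam * Real.log (∫ y, Real.exp (g y / lam) ∂ν)

theorem integrable_minVal [CompactSpace Y] [Nonempty Y] {μ : Measure X}
    [IsProbabilityMeasure μ] {c : X → Y → ℝ}
    (hc : ∀ x, Continuous (c x)) (hmeas : ∀ g : C(Y, ℝ), AEMeasurable (minVal c g) μ) {B : ℝ}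
    (hB : ∀ᵐ x ∂μ, ∀ y, |c x y| ≤ B) (g : C(Y, ℝ)) : Integrable (minVal c g) μ := by
  refine Integrable.of_bound (hmeas g).aestronglyMeasurable (B + ‖g‖) ?_
  filter_upwards [hB] with x hx
  exact abs_minVal_le hc g.continuous hx g.abs_apply_le

theorem integral_minVal_le [CompactSpace Y] [Nonempty Y] {μ : Measure X}
    [IsProbabilityMeasure μ] {c : X → Y → ℝ}
    (hc : ∀ x, Continuous (c x)) (hmeas : ∀ g : C(Y, ℝ), AEMeasurable (minVal c g) μ) {B : ℝ}
    (hB : ∀ᵐ x ∂μ, ∀ y, |c x y| ≤ B) {g h : C(Y, ℝ)} {r : ℝ} (hgh : ∀ y, g y ≤ h y + r) :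
    ∫ x, minVal c g x ∂μ ≤ ∫ x, minVal c h x ∂μ + r := by
  have h1 := integrable_minVal hc hmeas hB h
  calc ∫ x, minVal c g x ∂μ ≤ ∫ x, (minVal c h x + r) ∂μ :=
        integral_mono (integrable_minVal hc hmeas hB g) (h1.add (integrable_const r))
          (minVal_le_minVal_add hc g.continuous hgh)
    _ = _ := by rw [integral_add h1 (integrable_const r)]; simp

theorem lam_log_integral_exp_le [CompactSpace Y] [MeasurableSpace Y] [BorelSpace Y]
    {ν : Measure Y} [IsProbabilityMeasure ν] {lam : ℝ} (hlam : 0 < lam)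
    {g h : C(Y, ℝ)} {r : ℝ} (hgh : ∀ y, g y ≤ h y + r) :
    lam * Real.log (∫ y, Real.exp (g y / lam) ∂ν) ≤
      lam * Real.log (∫ y, Real.exp (h y / lam) ∂ν) + r := by
  have h1 : ∫ y, Real.exp (g y / lam) ∂ν ≤
      Real.exp (r / lam) * ∫ y, Real.exp (h y / lam) ∂ν := by
    rw [← integral_const_mul]
    refine integral_mono (integrable_exp_div g lam) ((integrable_exp_div h lam).const_mul _)
      fun y => ?_
    simp only
    rw [← Real.exp_add, ← add_div]
    exact Real.exp_le_exp.2 (div_le_div_of_nonneg_right (by linarith [hgh y]) hlam.le)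
  have p1 := integral_exp_pos (integrable_exp_div (ν := ν) g lam)
  have p2 := integral_exp_pos (integrable_exp_div (ν := ν) h lam)
  have h2 := Real.log_le_log p1 h1
  rw [Real.log_mul (Real.exp_pos _).ne' p2.ne', Real.log_exp] at h2
  calc _ ≤ lam * (r / lam + Real.log (∫ y, Real.exp (h y / lam) ∂ν)) := by gcongr
    _ = _ := by field_simp; ring

theorem continuous_dualFunctional [CompactSpace Y] [Nonempty Y]
    [MeasurableSpace Y] [BorelSpace Y] {μ : Measure X} [IsProbabilityMeasure μ] {ν : Measure Y}
    [IsProbabilityMeasure ν] {c : X → Y → ℝ}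
    (hc : ∀ x, Continuous (c x)) (hmeas : ∀ g : C(Y, ℝ), AEMeasurable (minVal c g) μ) {B : ℝ}
    (hB : ∀ᵐ x ∂μ, ∀ y, |c x y| ≤ B) {lam : ℝ} (hlam : 0 < lam) :
    Continuous (dualFunctional μ ν c lam) := by
  have key : ∀ g h : C(Y, ℝ), dualFunctional μ ν c lam g - dualFunctional μ ν c lam h ≤
      2 * dist g h := by
    intro g h
    have d : ∀ g h : C(Y, ℝ), ∀ y, g y ≤ h y + dist g h := fun g h y => by
      have := (le_abs_self _).trans (ContinuousMap.dist_apply_le_dist (f := g) (g := h) y)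
      linarith
    have h1 := integral_minVal_le hc hmeas hB (d g h)
    have h2 := lam_log_integral_exp_le (ν := ν) hlam (d h g)
    rw [dist_comm h g] at h2
    unfold dualFunctional
    linarith
  refine LipschitzWith.continuous (K := 2) (LipschitzWith.of_dist_le_mul fun g h => ?_)
  rw [Real.dist_eq, abs_le]
  have h1 := key g h
  have h2 := key h g
  rw [dist_comm h g] at h2
  simp only [NNReal.coe_ofNat]
  constructor <;> linarith

theorem dualFunctional_add_const [CompactSpace Y] [Nonempty Y]
    [MeasurableSpace Y] [BorelSpace Y] {μ : Measure X} [IsProbabilityMeasure μ] {ν : Measure Y}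
    [IsProbabilityMeasure ν] {c : X → Y → ℝ}
    (hc : ∀ x, Continuous (c x)) (hmeas : ∀ g : C(Y, ℝ), AEMeasurable (minVal c g) μ) {B : ℝ}
    (hB : ∀ᵐ x ∂μ, ∀ y, |c x y| ≤ B) {lam : ℝ} (hlam : 0 < lam) {g h : C(Y, ℝ)} {r : ℝ}
    (hgh : ∀ y, h y = g y + r) : dualFunctional μ ν c lam h = dualFunctional μ ν c lam g := by
  have a1 := integral_minVal_le hc hmeas hB (g := h) (h := g) (r := r) fun y => (hgh y).le
  have a2 := integral_minVal_le hc hmeas hB (g := g) (h := h) (r := -r) fun y => by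
    rw [hgh y]; linarith
  have b1 := lam_log_integral_exp_le (ν := ν) hlam (g := h) (h := g) (r := r) fun y => (hgh y).le
  have b2 := lam_log_integral_exp_le (ν := ν) hlam (g := g) (h := h) (r := -r) fun y => by
    rw [hgh y]; linarith
  unfold dualFunctional
  linarith

/-- Replacing a potential by its Lipschitz envelope lowers it without changing the minimal
values, hence does not decrease the dual functional. -/
theorem exists_lipschitz_dualFunctional_ge [CompactSpace Y] [Nonempty Y]
    [MeasurableSpace Y] [BorelSpace Y] {μ : Measure X} [IsProbabilityMeasure μ] {ν : Measure Y}
    [IsProbabilityMeasure ν] {c : X → Y → ℝ}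
    (hc : ∀ x, Continuous (c x)) (hmeas : ∀ g : C(Y, ℝ), AEMeasurable (minVal c g) μ) {B : ℝ}
    (hB : ∀ᵐ x ∂μ, ∀ y, |c x y| ≤ B) {K : NNReal} (hK : ∀ᵐ x ∂μ, LipschitzWith K (c x))
    {lam : ℝ} (hlam : 0 < lam) (g : C(Y, ℝ)) :
    ∃ h : C(Y, ℝ), LipschitzWith K h ∧ dualFunctional μ ν c lam g ≤ dualFunctional μ ν c lam h := by
  have hd : ∀ z : Y, Continuous fun y : Y => (K : ℝ) * dist z y := fun z => by fun_prop
  set f : Y → ℝ := minVal (fun z y => (K : ℝ) * dist z y) g with hf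
  have hfL : LipschitzWith K f := by
    have key : ∀ y z, f y - f z ≤ K * dist y z := by
      intro y z
      obtain ⟨w, hw⟩ := exists_eq_minVal hd g.continuous z
      have h1 : f y ≤ K * dist y w + g w := minVal_le hd g.continuous y w
      have h2 : (K : ℝ) * dist y w ≤ K * (dist y z + dist z w) := by
        gcongr; exact dist_triangle _ _ _
      have h3 : f z = K * dist z w + g w := hw.symm
      linarith
    refine LipschitzWith.of_dist_le_mul fun y z => ?_
    rw [Real.dist_eq, abs_le]
    have h1 := key y z
    have h2 := key z y
    rw [dist_comm z y] at h2
    constructor <;> linarith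
  have hfg : ∀ y, f y ≤ g y := fun y => by
    have := minVal_le hd g.continuous y y
    simpa using this
  refine ⟨⟨f, hfL.continuous⟩, hfL, ?_⟩
  have h1 : ∫ x, minVal c g x ∂μ ≤ ∫ x, minVal c f x ∂μ := by
    refine integral_mono_ae (integrable_minVal hc hmeas hB g)
      (integrable_minVal hc hmeas hB ⟨f, hfL.continuous⟩) ?_
    filter_upwards [hK] with x hx
    refine le_minVal fun y => ?_
    obtain ⟨w, hw⟩ := exists_eq_minVal hd g.continuous y
    have h2 : f y = K * dist y w + g w := hw.symm
    have h3 := minVal_le hc g.continuous x w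
    have h4 := (abs_le.1 (hx.dist_le_mul y w)).1
    linarith
  have h2 := lam_log_integral_exp_le (ν := ν) hlam (g := ⟨f, hfL.continuous⟩) (h := g) (r := 0)
    (fun y => by simpa using hfg y)
  unfold dualFunctional
  simp only [ContinuousMap.coe_mk] at h2 ⊢
  linarith

/-- A maximizer exists because the supremum may be taken over the compact set of Lipschitz
potentials vanishing at a base point: the functional is invariant under adding constants. -/
theorem exists_isMax_dualFunctional [CompactSpace Y] [Nonempty Y]
    [MeasurableSpace Y] [BorelSpace Y] {μ : Measure X} [IsProbabilityMeasure μ] {ν : Measure Y}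
    [IsProbabilityMeasure ν] {c : X → Y → ℝ}
    (hc : ∀ x, Continuous (c x)) (hmeas : ∀ g : C(Y, ℝ), AEMeasurable (minVal c g) μ) {B : ℝ}
    (hB : ∀ᵐ x ∂μ, ∀ y, |c x y| ≤ B) {K : NNReal} (hK : ∀ᵐ x ∂μ, LipschitzWith K (c x))
    {lam : ℝ} (hlam : 0 < lam) :
    ∃ g : C(Y, ℝ), ∀ h, dualFunctional μ ν c lam h ≤ dualFunctional μ ν c lam g := by
  obtain ⟨y₀⟩ := ‹Nonempty Y›
  obtain ⟨g, -, hg⟩ := (isCompact_lipschitz_potentials K y₀).exists_isMaxOn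
    ⟨0, LipschitzWith.const' (0 : ℝ), rfl⟩
    (continuous_dualFunctional (ν := ν) hc hmeas hB hlam).continuousOn
  refine ⟨g, fun h => ?_⟩
  obtain ⟨h₁, hL, hle⟩ := exists_lipschitz_dualFunctional_ge (ν := ν) hc hmeas hB hK hlam h
  have hL' : LipschitzWith K (h₁ - ContinuousMap.const Y (h₁ y₀)) := by
    refine LipschitzWith.of_dist_le_mul fun y z => ?_
    simpa [Real.dist_eq] using hL.dist_le_mul y z
  have hmem : h₁ - ContinuousMap.const Y (h₁ y₀) ∈
      {g : C(Y, ℝ) | LipschitzWith K g ∧ g y₀ = 0} := ⟨hL', by simp⟩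
  exact hle.trans ((dualFunctional_add_const hc hmeas hB hlam (r := h₁ y₀) fun y => by
    simp).trans_le (hg hmem))

/-- First-order condition at a maximizer of the dual functional: if the minimizers of
`c(x, ·) + g` are almost surely unique, they transport `μ` to the tilted measure `e^(g/lam) ν / Z`.
-/
theorem exists_potential_map_eq_tilted [CompactSpace Y] [Nonempty Y]
    [MeasurableSpace Y] [BorelSpace Y] {μ : Measure X} [IsProbabilityMeasure μ] {ν : Measure Y}
    [IsProbabilityMeasure ν] {c : X → Y → ℝ}
    (hc : ∀ x, Continuous (c x)) (hmeas : ∀ g : C(Y, ℝ), AEMeasurable (minVal c g) μ) {B : ℝ}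
    (hB : ∀ᵐ x ∂μ, ∀ y, |c x y| ≤ B) {K : NNReal} (hK : ∀ᵐ x ∂μ, LipschitzWith K (c x))
    {lam : ℝ} (hlam : 0 < lam) :
    ∃ g : C(Y, ℝ), ∀ S : X → Y, AEMeasurable S μ →
      (∀ᵐ x ∂μ, ∀ y, c x y + g y = minVal c g x → y = S x) →
      μ.map S = ν.tilted fun y => g y / lam := by
  obtain ⟨g, hg⟩ := exists_isMax_dualFunctional (ν := ν) hc hmeas hB hK hlam
  refine ⟨g, fun S hS huniq => ?_⟩
  have hgm : Measurable fun y => g y / lam := g.continuous.measurable.div_const _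
  have hgb : ∀ y, |g y / lam| ≤ ‖g‖ / lam := fun y => by
    rw [abs_div, abs_of_pos hlam]; gcongr; exact g.abs_apply_le y
  have hprob : IsProbabilityMeasure (ν.tilted fun y => g y / lam) :=
    isProbabilityMeasure_tilted_of_abs_le hgm hgb
  have hprob' : IsProbabilityMeasure (μ.map S) := Measure.isProbabilityMeasure_map hS
  set N := ν.tilted fun y => g y / lam with hN
  have key : ∀ h : C(Y, ℝ), ∫ x, h (S x) ∂μ ≤ ∫ y, h y ∂N := by
    intro h
    set A : ℝ := ‖h‖ / lam + 1 with hA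
    have hA0 : 0 < A := by positivity
    have hAb : ∀ y, |h y / lam| ≤ A := fun y => by
      rw [abs_div, abs_of_pos hlam, hA]
      have : |h y| / lam ≤ ‖h‖ / lam := by gcongr; exact h.abs_apply_le y
      linarith
    set t : ℕ → ℝ := fun n => A⁻¹ * (1 / ((n : ℝ) + 1)) with ht
    have ht0 : ∀ n, 0 < t n := fun n => by positivity
    have htA : ∀ n, t n * A ≤ 1 := fun n => by
      rw [ht]
      simp only
      rw [mul_right_comm, inv_mul_cancel₀ hA0.ne', one_mul, div_le_one (by positivity)]
      have : (0 : ℝ) ≤ n := n.cast_nonneg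
      linarith
    have htlim : Tendsto t atTop (𝓝 0) := by
      have := (tendsto_one_div_add_atTop_nhds_zero_nat (𝕜 := ℝ)).const_mul A⁻¹
      rwa [mul_zero] at this
    have hint : ∀ k : C(Y, ℝ), Integrable (minVal c k) μ := integrable_minVal hc hmeas hB
    have hlim : Tendsto (fun n => ∫ x, (minVal c (g + t n • h) x - minVal c g x) / t n ∂μ) atTop
        (𝓝 (∫ x, h (S x) ∂μ)) := by
      refine tendsto_integral_of_dominated_convergence (fun _ => ‖h‖) (fun n => ?_)
        (integrable_const _) (fun n => ?_) ?_
      · exact (((hint (g + t n • h)).sub (hint g)).div_const _).aestronglyMeasurable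
      · refine Eventually.of_forall fun x => ?_
        rw [Real.norm_eq_abs, abs_div, abs_of_pos (ht0 n), div_le_iff₀ (ht0 n), abs_le]
        have h1 := minVal_le_minVal_add hc (g := ⇑(g + t n • h)) (h := g) (r := ‖h‖ * t n)
          (g + t n • h).continuous (fun y => by
            have := (abs_le.1 (h.abs_apply_le y)).2
            have := mul_le_mul_of_nonneg_left this (ht0 n).le
            simp; linarith) x
        have h2 := minVal_le_minVal_add hc (g := g) (h := ⇑(g + t n • h)) (r := ‖h‖ * t n)
          g.continuous (fun y => by
            have := (abs_le.1 (h.abs_apply_le y)).1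
            have := mul_le_mul_of_nonneg_left this (ht0 n).le
            simp; linarith) x
        simp only [ContinuousMap.coe_add, ContinuousMap.coe_smul] at h1 h2
        constructor <;> linarith
      · filter_upwards [huniq] with x hx
        exact tendsto_minVal_slope hc g h hx ht0 htlim
    -- optimality of `g` bounds the difference quotients by those of the entropic term
    have hbound : ∀ n, ∫ x, (minVal c (g + t n • h) x - minVal c g x) / t n ∂μ ≤
        ∫ y, h y ∂N + lam * A ^ 2 * t n := by
      intro n
      rw [integral_div, div_le_iff₀ (ht0 n)]
      have e0 : ∫ x, (minVal c (g + t n • h) x - minVal c g x) ∂μ =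
          ∫ x, minVal c ⇑(g + t n • h) x ∂μ - ∫ x, minVal c g x ∂μ :=
        integral_sub (hint (g + t n • h)) (hint g)
      have h1 := hg (g + t n • h)
      unfold dualFunctional at h1
      have e1 : ∫ y, Real.exp (t n * (h y / lam)) ∂N =
          (∫ y, Real.exp ((g + t n • h) y / lam) ∂ν) / ∫ y, Real.exp (g y / lam) ∂ν := by
        rw [hN, integral_exp_tilted]
        congr 2
        ext y
        simp only [Pi.add_apply, ContinuousMap.add_apply, ContinuousMap.smul_apply, smul_eq_mul]
        congr 1
        ring
      have p1 := integral_exp_pos (integrable_exp_div (ν := ν) g lam)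
      have p2 := integral_exp_pos (integrable_exp_div (ν := ν) (g + t n • h) lam)
      have h2 := log_integral_exp_le (ν := N) (f := fun y => h y / lam)
        (h.continuous.measurable.div_const _) hAb (ht0 n).le (htA n)
      rw [e1, Real.log_div p2.ne' p1.ne', integral_div] at h2
      have h3 := mul_le_mul_of_nonneg_left h2 hlam.le
      have e2 : lam * (t n * ((∫ y, h y ∂N) / lam) + (t n * A) ^ 2) =
          (∫ y, h y ∂N + lam * A ^ 2 * t n) * t n := by field_simp
      rw [e2] at h3
      have e3 : ∫ x, (minVal c (⇑g + t n • ⇑h) x - minVal c g x) ∂μ =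
        ∫ x, minVal c ⇑(g + t n • h) x ∂μ - ∫ x, minVal c g x ∂μ := e0
      rw [e3]
      linarith
    have hlim2 : Tendsto (fun n => ∫ y, h y ∂N + lam * A ^ 2 * t n) atTop (𝓝 (∫ y, h y ∂N)) := by
      simpa using (htlim.const_mul (lam * A ^ 2)).const_add (∫ y, h y ∂N)
    exact le_of_tendsto_of_tendsto' hlim hlim2 hbound
  -- the inequality for `h` and for `-h` gives equality
  refine ext_of_forall_integral_eq_of_IsFiniteMeasure fun f => ?_
  have hf : ∫ y, f y ∂(μ.map S) = ∫ x, f (S x) ∂μ :=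
    integral_map hS f.continuous.aestronglyMeasurable
  rw [hf]
  refine le_antisymm (key f.toContinuousMap) ?_
  have := key (-f.toContinuousMap)
  simp only [ContinuousMap.neg_apply, integral_neg] at this
  exact neg_le_neg_iff.1 this

end dual

/-! ### Potentials for weighted quadratic costs -/

/-- The quadratic cost on `ℝ^ι` with weights `a`. -/
def quadCost {ι : Type*} [Fintype ι] (a : ι → ℝ) (x y : ι → ℝ) : ℝ := ∑ i, a i * (x i - y i) ^ 2

theorem continuous_quadCost {ι : Type*} [Fintype ι] (a : ι → ℝ) :
    Continuous fun p : (ι → ℝ) × (ι → ℝ) => quadCost a p.1 p.2 := by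
  unfold quadCost; fun_prop

theorem mem_cube_iff {ι : Type*} [Fintype ι] {R : ℝ} (hR : 0 ≤ R) {x : ι → ℝ} :
    x ∈ Metric.closedBall (0 : ι → ℝ) R ↔ ∀ i, |x i| ≤ R := by
  rw [mem_closedBall_zero_iff, pi_norm_le_iff_of_nonneg hR]
  rfl

/-- The coordinatewise projection onto the cube `[-R, R]^ι`. -/
def cubeProj {ι : Type*} [Fintype ι] {R : ℝ} (hR : 0 ≤ R) (x : ι → ℝ) :
    Metric.closedBall (0 : ι → ℝ) R :=
  ⟨fun i => max (-R) (min R (x i)), (mem_cube_iff hR).2 fun i => abs_le.2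
    ⟨le_max_left _ _, max_le (by linarith) (min_le_left _ _)⟩⟩

theorem continuous_cubeProj {ι : Type*} [Fintype ι] {R : ℝ} (hR : 0 ≤ R) :
    Continuous (cubeProj (ι := ι) hR) := by
  unfold cubeProj
  exact Continuous.subtype_mk (by fun_prop) _

theorem cubeProj_coe {ι : Type*} [Fintype ι] {R : ℝ} (hR : 0 ≤ R) {x : ι → ℝ}
    (hx : x ∈ Metric.closedBall (0 : ι → ℝ) R) : (cubeProj hR x : ι → ℝ) = x := by
  have := (mem_cube_iff hR).1 hx
  ext i
  have h := abs_le.1 (this i)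
  simp [cubeProj, h.1, h.2]

theorem tilted_map_comp {Z Z' : Type*} [MeasurableSpace Z] [MeasurableSpace Z'] (ν : Measure Z)
    {π : Z → Z'} (hπ : Measurable π) {f : Z' → ℝ} (hf : Measurable f) :
    (ν.tilted (f ∘ π)).map π = (ν.map π).tilted f := by
  ext s hs
  rw [Measure.map_apply hπ hs, tilted_apply' _ _ (hπ hs), tilted_apply' _ _ hs,
    setLIntegral_map hs (by fun_prop) hπ, integral_map hπ.aemeasurable (by fun_prop)]
  rfl

theorem quadCost_sub_quadCost_le {ι : Type*} [Fintype ι] {a : ι → ℝ} (ha : ∀ i, 0 ≤ a i) {R : ℝ}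
    (hR : 0 ≤ R) {x x' y : ι → ℝ} (hy : y ∈ Metric.closedBall (0 : ι → ℝ) R) :
    (quadCost a x y - ∑ i, a i * x i ^ 2) - (quadCost a x' y - ∑ i, a i * x' i ^ 2) ≤
      (∑ i, a i * (2 * R)) * dist x x' := by
  unfold quadCost
  rw [← Finset.sum_sub_distrib, ← Finset.sum_sub_distrib, ← Finset.sum_sub_distrib, Finset.sum_mul]
  refine Finset.sum_le_sum fun i _ => ?_
  have h1 : |x i - x' i| ≤ dist x x' := by
    rw [← Real.dist_eq]; exact dist_le_pi_dist x x' i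
  have h2 := (mem_cube_iff hR).1 hy i
  have h3 : -(y i * (x i - x' i)) ≤ R * dist x x' := by
    refine (neg_le_abs _).trans ?_
    rw [abs_mul]
    exact mul_le_mul h2 h1 (abs_nonneg _) hR
  have := mul_le_mul_of_nonneg_left h3 (ha i)
  nlinarith

section

variable {ι : Type*} [Fintype ι] {a : ι → ℝ} {R : ℝ}

/-- The weighted quadratic cost as a function on `ℝ^ι × [-R, R]^ι`. -/
def cubeCost (a : ι → ℝ) (R : ℝ) (x : ι → ℝ) (y : Metric.closedBall (0 : ι → ℝ) R) : ℝ :=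
  quadCost a x y

theorem continuous_cubeCost (x : ι → ℝ) : Continuous (cubeCost a R x) := by
  exact (continuous_quadCost a).comp (continuous_const.prodMk continuous_subtype_val)

theorem lipschitzWith_minVal_sub (ha : ∀ i, 0 ≤ a i) (hR : 0 ≤ R)
    (g : C(Metric.closedBall (0 : ι → ℝ) R, ℝ)) :
    LipschitzWith (∑ i, a i * (2 * R)).toNNReal
      fun x => minVal (cubeCost a R) g x - ∑ i, a i * x i ^ 2 := by
  have : Nonempty (Metric.closedBall (0 : ι → ℝ) R) := ⟨cubeProj hR 0⟩
  have hs : 0 ≤ ∑ i, a i * (2 * R) := Finset.sum_nonneg fun i _ => mul_nonneg (ha i) (by linarith)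
  have key : ∀ x x' : ι → ℝ, (minVal (cubeCost a R) g x - ∑ i, a i * x i ^ 2) -
      (minVal (cubeCost a R) g x' - ∑ i, a i * x' i ^ 2) ≤ (∑ i, a i * (2 * R)) * dist x x' := by
    intro x x'
    obtain ⟨y, hy⟩ := exists_eq_minVal (c := cubeCost a R) continuous_cubeCost g.continuous x'
    have h1 := minVal_le (c := cubeCost a R) continuous_cubeCost g.continuous x y
    have h2 := quadCost_sub_quadCost_le ha hR (x := x) (x' := x') y.2
    change cubeCost a R x y - _ - (cubeCost a R x' y - _) ≤ _ at h2
    linarith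
  refine LipschitzWith.of_dist_le_mul fun x x' => ?_
  rw [Real.coe_toNNReal _ hs, Real.dist_eq, abs_le]
  have h1 := key x x'
  have h2 := key x' x
  rw [dist_comm x' x] at h2
  constructor <;> linarith

theorem continuous_minVal_cubeCost (ha : ∀ i, 0 ≤ a i) (hR : 0 ≤ R)
    (g : C(Metric.closedBall (0 : ι → ℝ) R, ℝ)) : Continuous (minVal (cubeCost a R) g) := by
  have h1 := (lipschitzWith_minVal_sub ha hR g).continuous
  have h2 : Continuous fun x : ι → ℝ => ∑ i, a i * x i ^ 2 := by fun_prop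
  exact (h1.add h2).congr fun x => by simp

/-- At a point of differentiability of the minimal value, its gradient determines the minimizer. -/
theorem eq_of_eq_minVal_of_differentiableAt [DecidableEq ι] (ha : ∀ i, 0 < a i)
    {g : C(Metric.closedBall (0 : ι → ℝ) R, ℝ)} {x : ι → ℝ}
    (hx : DifferentiableAt ℝ (minVal (cubeCost a R) g) x) {y : Metric.closedBall (0 : ι → ℝ) R}
    (hy : cubeCost a R x y + g y = minVal (cubeCost a R) g x) (i : ι) :
    (y : ι → ℝ) i = x i - fderiv ℝ (minVal (cubeCost a R) g) x (Pi.single i 1) / (2 * a i) := by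
  set m := minVal (cubeCost a R) g with hm
  have hline : HasDerivAt (fun t : ℝ => x + t • (Pi.single i 1 : ι → ℝ)) (Pi.single i 1) 0 := by
    simpa using ((hasDerivAt_id (0 : ℝ)).smul_const (Pi.single i 1 : ι → ℝ)).const_add x
  have h1 : HasDerivAt (fun t : ℝ => m (x + t • (Pi.single i 1 : ι → ℝ)))
      (fderiv ℝ m x (Pi.single i 1)) 0 := by
    have hx0 : HasFDerivAt m (fderiv ℝ m x) (x + (0 : ℝ) • (Pi.single i 1 : ι → ℝ)) := by
      simpa using hx.hasFDerivAt
    exact hx0.comp_hasDerivAt 0 hline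
  have hcost : ∀ t : ℝ, cubeCost a R (x + t • (Pi.single i 1 : ι → ℝ)) y =
      cubeCost a R x y + a i * (2 * (x i - (y : ι → ℝ) i) * t + t ^ 2) := by
    intro t
    unfold cubeCost quadCost
    rw [← sub_eq_iff_eq_add', ← Finset.sum_sub_distrib, Finset.sum_eq_single i]
    · simp; ring
    · intro j _ hj
      simp [Pi.single_eq_of_ne hj]
    · simp
  have h2 : HasDerivAt (fun t : ℝ => a i * (2 * (x i - (y : ι → ℝ) i) * t + t ^ 2))
      (a i * (2 * (x i - (y : ι → ℝ) i))) 0 := by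
    have := (((hasDerivAt_id (0 : ℝ)).const_mul (2 * (x i - (y : ι → ℝ) i))).add
      ((hasDerivAt_id (0 : ℝ)).pow 2)).const_mul (a i)
    simpa using this
  have h3 := h1.sub h2
  have hmax : IsLocalMax (fun t : ℝ => m (x + t • (Pi.single i 1 : ι → ℝ)) -
      a i * (2 * (x i - (y : ι → ℝ) i) * t + t ^ 2)) 0 := by
    refine Eventually.of_forall fun t => ?_
    have := minVal_le (c := cubeCost a R) continuous_cubeCost g.continuous
      (x + t • (Pi.single i 1 : ι → ℝ)) y
    rw [hcost t] at this
    simp only [zero_smul, add_zero, mul_zero]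
    rw [← hy]
    simp only [hm]
    nlinarith
  have h4 := hmax.hasDerivAt_eq_zero h3
  have hai := ha i
  field_simp
  linarith

/-- Dual potentials, minimal value and optimal map of the soft-constrained problem for a weighted
quadratic cost. The slack `quadCost a x y + g y - m x` is nonnegative, and for almost every `x` it
vanishes at `S x` only. -/
theorem exists_quadCost_potential (ha : ∀ i, 0 < a i) (hR : 0 ≤ R) {μ ν : Measure (ι → ℝ)}
    [IsProbabilityMeasure μ] [IsProbabilityMeasure ν] (hμ : μ ≪ volume)
    (hμR : ∀ᵐ x ∂μ, x ∈ Metric.closedBall (0 : ι → ℝ) R)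
    (hνR : ∀ᵐ x ∂ν, x ∈ Metric.closedBall (0 : ι → ℝ) R) {lam : ℝ} (hlam : 0 < lam) :
    ∃ (g m : (ι → ℝ) → ℝ) (S : (ι → ℝ) → ι → ℝ), Continuous g ∧ (∃ M, ∀ y, |g y| ≤ M) ∧
      Continuous m ∧ Measurable S ∧ (∀ x, S x ∈ Metric.closedBall (0 : ι → ℝ) R) ∧
      (∀ x, ∀ y ∈ Metric.closedBall (0 : ι → ℝ) R, m x ≤ quadCost a x y + g y) ∧
      (∀ᵐ x ∂μ, quadCost a x (S x) + g (S x) = m x) ∧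
      (∀ᵐ x ∂μ, ∀ y ∈ Metric.closedBall (0 : ι → ℝ) R, quadCost a x y + g y = m x → y = S x) ∧
      μ.map S = ν.tilted fun y => g y / lam := by
  classical
  have ha' : ∀ i, 0 ≤ a i := fun i => (ha i).le
  have : Nonempty (Metric.closedBall (0 : ι → ℝ) R) := ⟨cubeProj hR 0⟩
  set Y := Metric.closedBall (0 : ι → ℝ) R with hY
  have : CompactSpace Y := isCompact_iff_compactSpace.1 (isCompact_closedBall _ _)
  have hπ : Measurable (cubeProj (ι := ι) hR) := (continuous_cubeProj hR).measurable
  have hs : 0 ≤ ∑ i, a i * (2 * R) := Finset.sum_nonneg fun i _ => mul_nonneg (ha' i) (by linarith)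
  have hcc := continuous_cubeCost (a := a) (R := R)
  have hν' : IsProbabilityMeasure (ν.map (cubeProj (ι := ι) hR)) :=
    Measure.isProbabilityMeasure_map hπ.aemeasurable
  have hmc : ∀ g : C(Y, ℝ), Continuous (minVal (cubeCost a R) g) :=
    continuous_minVal_cubeCost ha' hR
  have hB : ∀ᵐ x ∂μ, ∀ y : Y, |cubeCost a R x y| ≤ ∑ i, a i * (2 * R) ^ 2 := by
    filter_upwards [hμR] with x hx y
    unfold cubeCost quadCost
    rw [abs_of_nonneg (Finset.sum_nonneg fun i _ => mul_nonneg (ha' i) (sq_nonneg _))]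
    refine Finset.sum_le_sum fun i _ => mul_le_mul_of_nonneg_left (sq_le_sq' ?_ ?_) (ha' i)
    all_goals
      have h1 := abs_le.1 ((mem_cube_iff hR).1 hx i)
      have h2 := abs_le.1 ((mem_cube_iff hR).1 y.2 i)
      linarith
  have hK : ∀ᵐ x ∂μ, LipschitzWith (∑ i, a i * (4 * R)).toNNReal (cubeCost a R x) := by
    filter_upwards [hμR] with x hx
    have key : ∀ y z : Y, cubeCost a R x y - cubeCost a R x z ≤
        (∑ i, a i * (4 * R)) * dist y z := by
      intro y z
      unfold cubeCost quadCost
      rw [← Finset.sum_sub_distrib, Finset.sum_mul]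
      refine Finset.sum_le_sum fun i _ => ?_
      have h0 := abs_le.1 ((mem_cube_iff hR).1 hx i)
      have h1 := abs_le.1 ((mem_cube_iff hR).1 y.2 i)
      have h2 := abs_le.1 ((mem_cube_iff hR).1 z.2 i)
      have h3 : |(y : ι → ℝ) i - (z : ι → ℝ) i| ≤ dist y z := by
        rw [← Real.dist_eq]; exact dist_le_pi_dist (y : ι → ℝ) (z : ι → ℝ) i
      have h4 : (x i - (y : ι → ℝ) i) ^ 2 - (x i - (z : ι → ℝ) i) ^ 2 ≤ 4 * R * dist y z := by
        have e : (x i - (y : ι → ℝ) i) ^ 2 - (x i - (z : ι → ℝ) i) ^ 2 =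
          ((y : ι → ℝ) i - (z : ι → ℝ) i) * ((y : ι → ℝ) i + (z : ι → ℝ) i - 2 * x i) := by ring
        rw [e]
        refine (le_abs_self _).trans ?_
        rw [abs_mul, mul_comm]
        refine mul_le_mul (abs_le.2 ⟨?_, ?_⟩) h3 (abs_nonneg _) (by linarith) <;> linarith
      calc _ = a i * ((x i - (y : ι → ℝ) i) ^ 2 - (x i - (z : ι → ℝ) i) ^ 2) := by ring
        _ ≤ a i * (4 * R * dist y z) := mul_le_mul_of_nonneg_left h4 (ha' i)
        _ = _ := by ring
    refine LipschitzWith.of_dist_le_mul fun y z => ?_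
    rw [Real.coe_toNNReal _ (Finset.sum_nonneg fun i _ => mul_nonneg (ha' i) (by linarith)),
      Real.dist_eq, abs_le]
    have h1 := key y z
    have h2 := key z y
    rw [dist_comm z y] at h2
    constructor <;> linarith
  obtain ⟨g₀, hg₀⟩ := exists_potential_map_eq_tilted (μ := μ)
    (ν := ν.map (cubeProj (ι := ι) hR)) hcc (fun g => (hmc g).measurable.aemeasurable) hB hK hlam
  set m := minVal (cubeCost a R) g₀ with hm
  set S₀ : (ι → ℝ) → Y := fun x =>
    cubeProj hR fun i => x i - fderiv ℝ m x (Pi.single i 1) / (2 * a i) with hS₀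
  have hS₀m : Measurable S₀ := by
    refine hπ.comp (measurable_pi_lambda _ fun i => ?_)
    exact (measurable_pi_apply i).sub ((measurable_fderiv_apply_const ℝ m _).div_const _)
  have hdiff : ∀ᵐ x ∂μ, DifferentiableAt ℝ m x := by
    refine hμ.ae_le ?_
    filter_upwards [(lipschitzWith_minVal_sub ha' hR g₀).ae_differentiableAt (μ := volume)]
      with x hx
    have h2 : DifferentiableAt ℝ (fun x : ι → ℝ => ∑ i, a i * x i ^ 2) x := by fun_prop
    refine (hx.add h2).congr_of_eventuallyEq (Eventually.of_forall fun z => ?_)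
    simp [hm]
  have huniq : ∀ᵐ x ∂μ, ∀ y, cubeCost a R x y + g₀ y = m x → y = S₀ x := by
    filter_upwards [hdiff] with x hx y hy
    have h := eq_of_eq_minVal_of_differentiableAt ha hx hy
    apply Subtype.ext
    rw [hS₀]
    simp only
    rw [← funext h]
    exact (cubeProj_coe hR y.2).symm
  have hmap := hg₀ S₀ hS₀m.aemeasurable huniq
  obtain ⟨M, hM⟩ : ∃ M, ∀ y : Y, |g₀ y| ≤ M := ⟨‖g₀‖, g₀.abs_apply_le⟩
  have hgc : Continuous fun y => g₀ (cubeProj hR y) := g₀.continuous.comp (continuous_cubeProj hR)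
  have hval : ∀ y ∈ Y, ∃ y' : Y, (y' : ι → ℝ) = y ∧ cubeProj hR y = y' := fun y hy =>
    ⟨⟨y, hy⟩, rfl, Subtype.ext (cubeProj_coe hR hy)⟩
  refine ⟨fun y => g₀ (cubeProj hR y), m, fun x => S₀ x, hgc, ⟨M, fun y => hM _⟩, hmc g₀,
    measurable_subtype_coe.comp hS₀m, fun x => (S₀ x).2, fun x y hy => ?_, ?_, ?_, ?_⟩
  · obtain ⟨y', rfl, h2⟩ := hval y hy
    simp only [h2]
    exact minVal_le (c := cubeCost a R) hcc g₀.continuous x y'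
  · filter_upwards [huniq] with x hx
    obtain ⟨y, hy⟩ := exists_eq_minVal (c := cubeCost a R) hcc g₀.continuous x
    have e : cubeProj hR (y : ι → ℝ) = y := Subtype.ext (cubeProj_coe hR y.2)
    simp only [← hx y hy, e]
    exact hy
  · filter_upwards [huniq] with x hx y hy hxy
    obtain ⟨y', rfl, h2⟩ := hval y hy
    simp only [h2] at hxy
    rw [hx y' hxy]
  · have hg₀m : Measurable fun y : Y => g₀ y / lam := g₀.continuous.measurable.div_const _
    have e1 : μ.map (fun x => (S₀ x : ι → ℝ)) = (μ.map S₀).map Subtype.val :=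
      (Measure.map_map measurable_subtype_coe hS₀m).symm
    rw [e1, hmap, ← tilted_map_comp ν hπ hg₀m, Measure.map_map measurable_subtype_coe hπ]
    have hid : (Subtype.val ∘ cubeProj (ι := ι) hR) =ᵐ[ν.tilted ((fun y : Y => g₀ y / lam) ∘
        cubeProj hR)] id := by
      refine (tilted_absolutelyContinuous ν _).ae_le ?_
      filter_upwards [hνR] with y hy
      exact cubeProj_coe hR hy
    rw [Measure.map_congr hid, Measure.map_id]
    rfl

end

/-! ### Conditional distribution functions and quantiles -/

/-- The uniform distribution on `[0, 1]`. -/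
def unif : Measure ℝ := volume.restrict (Set.Icc 0 1)

instance : IsProbabilityMeasure unif := ⟨by simp [unif]⟩

theorem unif_Iic {a : ℝ} (h1 : a ≤ 1) : unif (Set.Iic a) = ENNReal.ofReal a := by
  rw [unif, Measure.restrict_apply measurableSet_Iic]
  have : Set.Iic a ∩ Set.Icc 0 1 = Set.Icc 0 a := by
    ext t
    simp only [Set.mem_inter_iff, Set.mem_Iic, Set.mem_Icc]
    constructor
    · rintro ⟨h1, h2, h3⟩; exact ⟨h2, h1⟩
    · rintro ⟨h2, h3⟩; exact ⟨h3, h2, h3.trans h1⟩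
  rw [this]; simp

theorem ae_unif_mem : ∀ᵐ u ∂unif, u ∈ Set.Icc (0 : ℝ) 1 :=
  ae_restrict_mem measurableSet_Icc

section quantile

open ProbabilityTheory

variable {P : Type*} [MeasurableSpace P]

/-- The distribution function of the law `κ p`. -/
def kerCDF (κ : Kernel P ℝ) (p : P) (t : ℝ) : ℝ := cdf (κ p) t

/-- The quantile function of the law `κ p`, for laws carried by `[-R, R]`. The infimum is taken
over a set that contains `R` and lies in `[-R, R]`, so that the value is in `[-R, R]` and monotone
in `u` for all `p` and `u`. -/
def kerQuantile (R : ℝ) (κ : Kernel P ℝ) (p : P) (u : ℝ) : ℝ :=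
  sInf (insert R {t | t ∈ Set.Icc (-R) R ∧ u ≤ kerCDF κ p t})

theorem measurable_kerCDF (κ : Kernel P ℝ) [IsMarkovKernel κ] :
    Measurable fun q : P × ℝ => kerCDF κ q.1 q.2 := by
  have h : Measurable fun q : P × ℝ => (κ.comap Prod.fst measurable_fst) q
      (Prod.mk q ⁻¹' {r : (P × ℝ) × ℝ | r.2 ≤ r.1.2}) :=
    Kernel.measurable_kernel_prodMk_left
      (measurableSet_le measurable_snd (measurable_snd.comp measurable_fst))
  convert h.ennreal_toReal using 2 with q
  rw [kerCDF, cdf_eq_real]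
  rfl

theorem kerQuantile_mem {R : ℝ} (hR : 0 ≤ R) (κ : Kernel P ℝ) (p : P) (u : ℝ) :
    kerQuantile R κ p u ∈ Set.Icc (-R) R := by
  have hb : ∀ t ∈ insert R {t | t ∈ Set.Icc (-R) R ∧ u ≤ kerCDF κ p t}, -R ≤ t := by
    rintro t (rfl | ht)
    · linarith
    · exact ht.1.1
  exact ⟨le_csInf ⟨R, Set.mem_insert _ _⟩ hb, csInf_le ⟨-R, hb⟩ (Set.mem_insert _ _)⟩

theorem abs_kerQuantile_le {R : ℝ} (hR : 0 ≤ R) (κ : Kernel P ℝ) (p : P) (u : ℝ) :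
    |kerQuantile R κ p u| ≤ R := abs_le.2 (kerQuantile_mem hR κ p u)

theorem kerQuantile_mono {R : ℝ} (hR : 0 ≤ R) (κ : Kernel P ℝ) (p : P) :
    Monotone (kerQuantile R κ p) := by
  intro u v huv
  refine csInf_le_csInf ⟨-R, ?_⟩ ⟨R, Set.mem_insert _ _⟩
    (Set.insert_subset_insert fun t ht => ⟨ht.1, huv.trans ht.2⟩)
  rintro t (rfl | ht)
  · linarith
  · exact ht.1.1

theorem kerQuantile_le_iff {R : ℝ} (κ : Kernel P ℝ) (p : P) {u t : ℝ}
    (ht : -R ≤ t) (htR : t < R) : kerQuantile R κ p u ≤ t ↔ u ≤ kerCDF κ p t := by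
  constructor
  · intro h
    have hright : ContinuousWithinAt (cdf (κ p)) (Set.Ioi t) t :=
      ((cdf (κ p)).right_continuous t).mono Set.Ioi_subset_Ici_self
    refine ge_of_tendsto hright ?_
    filter_upwards [Ioo_mem_nhdsGT htR] with s hs
    obtain ⟨t', ht', hlt⟩ := exists_lt_of_csInf_lt ⟨R, Set.mem_insert _ _⟩ (h.trans_lt hs.1)
    rcases ht' with rfl | ht'
    · exact absurd hlt (not_lt.2 hs.2.le)
    · exact ht'.2.trans (monotone_cdf (κ p) hlt.le)
  · intro h
    refine csInf_le ⟨-R, ?_⟩ (Set.mem_insert_of_mem _ ⟨⟨ht, htR.le⟩, h⟩)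
    rintro s (rfl | hs)
    · linarith
    · exact hs.1.1

theorem measurable_kerQuantile {R : ℝ} (hR : 0 ≤ R) (κ : Kernel P ℝ) [IsMarkovKernel κ] :
    Measurable fun q : P × ℝ => kerQuantile R κ q.1 q.2 := by
  refine measurable_of_Iic fun t => ?_
  by_cases h1 : t < -R
  · convert MeasurableSet.empty
    ext q
    simp only [Set.mem_preimage, Set.mem_Iic, Set.mem_empty_iff_false, iff_false, not_le]
    exact h1.trans_le (kerQuantile_mem hR κ q.1 q.2).1
  by_cases h2 : t < R
  · have : (fun q : P × ℝ => kerQuantile R κ q.1 q.2) ⁻¹' Set.Iic t =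
        {q : P × ℝ | q.2 ≤ kerCDF κ q.1 t} := by
      ext q
      exact kerQuantile_le_iff κ q.1 (not_lt.1 h1) h2
    rw [this]
    exact measurableSet_le measurable_snd
      ((measurable_kerCDF κ).comp (measurable_fst.prodMk measurable_const))
  · convert MeasurableSet.univ
    ext q
    simp only [Set.mem_preimage, Set.mem_Iic, Set.mem_univ, iff_true]
    exact (kerQuantile_mem hR κ q.1 q.2).2.trans (not_lt.1 h2)

variable {κ : Kernel P ℝ} [IsMarkovKernel κ] {R : ℝ} {p : P}

theorem kerCDF_eq_one (hs : ∀ᵐ t ∂κ p, t ∈ Set.Icc (-R) R) {t : ℝ} (ht : R ≤ t) :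
    kerCDF κ p t = 1 := by
  have h : Set.Iic t ∈ ae (κ p) := by filter_upwards [hs] with s hs using hs.2.trans ht
  rw [kerCDF, cdf_eq_real, measureReal_def, (mem_ae_iff_prob_eq_one measurableSet_Iic).1 h,
    ENNReal.toReal_one]

theorem kerCDF_eq_zero (hs : ∀ᵐ t ∂κ p, t ∈ Set.Icc (-R) R) {t : ℝ} (ht : t < -R) :
    kerCDF κ p t = 0 := by
  rw [kerCDF, cdf_eq_real, measureReal_eq_zero_iff]
  refine measure_mono_null (fun s hs' => ?_) hs
  simp only [Set.mem_compl_iff, Set.mem_ofPred_eq, Set.mem_Icc, not_and, not_le]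
  intro h
  exact absurd (h.trans (Set.mem_Iic.1 hs')) (not_le.2 ht)

/-- The quantile function pushes the uniform distribution to `κ p`. -/
theorem unif_map_kerQuantile (hR : 0 ≤ R) (hs : ∀ᵐ t ∂κ p, t ∈ Set.Icc (-R) R) :
    unif.map (kerQuantile R κ p) = κ p := by
  have hm : Measurable (kerQuantile R κ p) :=
    (measurable_kerQuantile hR κ).comp (measurable_const.prodMk measurable_id)
  have := Measure.isProbabilityMeasure_map (μ := unif) hm.aemeasurable
  refine Measure.ext_of_Iic _ _ fun t => ?_
  rw [Measure.map_apply hm measurableSet_Iic]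
  have hκ : κ p (Set.Iic t) = ENNReal.ofReal (kerCDF κ p t) := by
    rw [kerCDF, cdf_eq_real, ofReal_measureReal]
  rw [hκ]
  by_cases h1 : t < -R
  · rw [kerCDF_eq_zero hs h1]
    have : kerQuantile R κ p ⁻¹' Set.Iic t = ∅ := by
      ext u
      simp only [Set.mem_preimage, Set.mem_Iic, Set.mem_empty_iff_false, iff_false, not_le]
      exact h1.trans_le (kerQuantile_mem hR κ p u).1
    simp [this]
  by_cases h2 : t < R
  · have : kerQuantile R κ p ⁻¹' Set.Iic t = Set.Iic (kerCDF κ p t) := by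
      ext u
      exact kerQuantile_le_iff κ p (not_lt.1 h1) h2
    rw [this, unif_Iic (a := kerCDF κ p t) (cdf_le_one _ _)]
  · rw [kerCDF_eq_one hs (not_lt.1 h2)]
    have : kerQuantile R κ p ⁻¹' Set.Iic t = Set.univ := by
      ext u
      simp only [Set.mem_preimage, Set.mem_Iic, Set.mem_univ, iff_true]
      exact (kerQuantile_mem hR κ p u).2.trans (not_lt.1 h2)
    simp [this]

/-- For an atomless law the distribution function inverts the quantile function. -/
theorem kerCDF_kerQuantile (hR : 0 ≤ R) (hs : ∀ᵐ t ∂κ p, t ∈ Set.Icc (-R) R)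
    (ha : ∀ t, κ p {t} = 0) {u : ℝ} (hu : u ∈ Set.Icc (0 : ℝ) 1) :
    kerCDF κ p (kerQuantile R κ p u) = u := by
  set q := kerQuantile R κ p u with hq
  have hqR := kerQuantile_mem hR κ p u
  rw [← hq] at hqR
  refine le_antisymm ?_ ?_
  · have hsing : (κ p) {q} = 0 := ha q
    have hleft : Function.leftLim (cdf (κ p)) q ≤ u := by
      refine le_of_tendsto (Monotone.tendsto_leftLim (monotone_cdf (κ p)) q) ?_
      filter_upwards [self_mem_nhdsWithin] with s hs'
      by_cases h1 : s < -R
      · exact (kerCDF_eq_zero hs h1).trans_le hu.1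
      · by_contra hcon
        have := (kerQuantile_le_iff κ p (not_lt.1 h1) (lt_of_lt_of_le hs' hqR.2)).2
          (not_le.1 hcon).le
        exact absurd this (not_le.2 hs')
    rw [← measure_cdf (κ p), StieltjesFunction.measure_singleton, ENNReal.ofReal_eq_zero] at hsing
    have : cdf (κ p) q ≤ u := by linarith
    exact this
  · rcases hqR.2.lt_or_eq with h | h
    · exact (kerQuantile_le_iff κ p hqR.1 h).1 le_rfl
    · rw [kerCDF_eq_one hs h.ge]; exact hu.2

theorem measurable_kerCDF_apply (κ : Kernel P ℝ) [IsMarkovKernel κ] (p : P) :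
    Measurable (kerCDF κ p) :=
  (measurable_kerCDF κ).comp (measurable_const.prodMk measurable_id)

theorem measurable_kerQuantile_apply (hR : 0 ≤ R) (κ : Kernel P ℝ) [IsMarkovKernel κ] (p : P) :
    Measurable (kerQuantile R κ p) :=
  (measurable_kerQuantile hR κ).comp (measurable_const.prodMk measurable_id)

/-- The distribution function of an atomless law pushes it to the uniform distribution. -/
theorem map_kerCDF (hR : 0 ≤ R) (hs : ∀ᵐ t ∂κ p, t ∈ Set.Icc (-R) R) (ha : ∀ t, κ p {t} = 0) :
    (κ p).map (kerCDF κ p) = unif := by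
  have hm : Measurable (kerCDF κ p) := measurable_kerCDF_apply κ p
  have hq : Measurable (kerQuantile R κ p) := measurable_kerQuantile_apply hR κ p
  conv_lhs => rw [← unif_map_kerQuantile hR hs]
  rw [Measure.map_map hm hq]
  have : (kerCDF κ p ∘ kerQuantile R κ p) =ᵐ[unif] id := by
    filter_upwards [ae_unif_mem] with u hu using kerCDF_kerQuantile hR hs ha hu
  rw [Measure.map_congr this, Measure.map_id]

theorem ae_kerQuantile_kerCDF (hR : 0 ≤ R) (hs : ∀ᵐ t ∂κ p, t ∈ Set.Icc (-R) R)
    (ha : ∀ t, κ p {t} = 0) : ∀ᵐ t ∂κ p, kerQuantile R κ p (kerCDF κ p t) = t := by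
  have hm : Measurable (kerCDF κ p) := measurable_kerCDF_apply κ p
  have hq : Measurable (kerQuantile R κ p) := measurable_kerQuantile_apply hR κ p
  rw [← unif_map_kerQuantile hR hs, ae_map_iff hq.aemeasurable
    (p := fun t => kerQuantile R κ p (kerCDF κ p t) = t)
    (measurableSet_eq_fun (hq.comp hm) measurable_id)]
  filter_upwards [ae_unif_mem] with u hu
  rw [kerCDF_kerQuantile hR hs ha hu]

/-- Sampling the second coordinate through the quantile function. -/
theorem map_prod_unif_kerQuantile {ρ : Measure P} [IsProbabilityMeasure ρ] (hR : 0 ≤ R)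
    (hs : ∀ᵐ p ∂ρ, ∀ᵐ t ∂κ p, t ∈ Set.Icc (-R) R) :
    (ρ.prod unif).map (fun q : P × ℝ => (q.1, kerQuantile R κ q.1 q.2)) = ρ.compProd κ := by
  have hm : Measurable fun q : P × ℝ => (q.1, kerQuantile R κ q.1 q.2) :=
    measurable_fst.prodMk (measurable_kerQuantile hR κ)
  ext s hs'
  rw [Measure.map_apply hm hs', Measure.prod_apply (hm hs'), Measure.compProd_apply hs']
  refine lintegral_congr_ae ?_
  filter_upwards [hs] with p hp
  rw [← unif_map_kerQuantile hR hp, Measure.map_apply (measurable_kerQuantile_apply hR κ p)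
    (measurable_prodMk_left hs')]
  rfl

/-- The distribution function turns the second coordinate into an independent uniform variable. -/
theorem map_compProd_kerCDF {ρ : Measure P} [IsProbabilityMeasure ρ] (hR : 0 ≤ R)
    (hs : ∀ᵐ p ∂ρ, ∀ᵐ t ∂κ p, t ∈ Set.Icc (-R) R) (ha : ∀ᵐ p ∂ρ, ∀ t, κ p {t} = 0) :
    (ρ.compProd κ).map (fun q : P × ℝ => (q.1, kerCDF κ q.1 q.2)) = ρ.prod unif := by
  have hm : Measurable fun q : P × ℝ => (q.1, kerCDF κ q.1 q.2) :=
    measurable_fst.prodMk (measurable_kerCDF κ)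
  ext s hs'
  rw [Measure.map_apply hm hs', Measure.prod_apply hs', Measure.compProd_apply (hm hs')]
  refine lintegral_congr_ae ?_
  filter_upwards [hs, ha] with p hp hpa
  rw [← map_kerCDF hR hp hpa, Measure.map_apply (measurable_kerCDF_apply κ p)
    (measurable_prodMk_left hs')]
  rfl

end quantile

open ProbabilityTheory in
instance {d : ℕ} (μ : ProbabilityMeasure (Fin d → ℝ)) (i : Fin d) :
    IsMarkovKernel (condCoord μ i) := by
  unfold condCoord; infer_instance

/-- `μ` is absolutely continuous and carried by the cube `[-R, R]^d`, which is the closed ball of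
the sup norm. -/
structure IsCubeAC {d : ℕ} (R : ℝ) (μ : ProbabilityMeasure (Fin d → ℝ)) : Prop where
  ac : (μ : Measure (Fin d → ℝ)) ≪ volume
  mem : ∀ᵐ x ∂(μ : Measure (Fin d → ℝ)), x ∈ Metric.closedBall (0 : Fin d → ℝ) R

theorem quasiMeasurePreserving_id_prodMap {X Y Z : Type*} [MeasurableSpace X] [MeasurableSpace Y]
    [MeasurableSpace Z] {α : Measure X} {β : Measure Y} {γ : Measure Z} [SFinite β] [SFinite γ]
    {f : Y → Z} (hf : Measure.QuasiMeasurePreserving f β γ) :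
    Measure.QuasiMeasurePreserving (Prod.map id f) (α.prod β) (α.prod γ) := by
  refine ⟨measurable_id.prodMap hf.measurable, Measure.AbsolutelyContinuous.mk fun s hs h0 => ?_⟩
  have hm : MeasurableSet (Prod.map (id : X → X) f ⁻¹' s) :=
    (measurable_id.prodMap hf.measurable) hs
  rw [Measure.map_apply (measurable_id.prodMap hf.measurable) hs]
  refine Measure.measure_prod_null_of_ae_null hm ?_
  filter_upwards [Measure.measure_ae_null_of_prod_null h0] with x hx
  exact hf.preimage_null hx

section

variable {d : ℕ}

theorem measurable_coord (i : Fin d) : Measurable fun x : Fin d → ℝ => x i :=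
  measurable_pi_apply i

theorem measurable_prevCoords (i : Fin d) : Measurable (prevCoords (d := d) i) :=
  measurable_pi_lambda _ fun _ => measurable_pi_apply _

theorem compProd_condCoord (μ : ProbabilityMeasure (Fin d → ℝ)) (i : Fin d) :
    ((μ : Measure (Fin d → ℝ)).map (prevCoords i)).compProd (condCoord μ i) =
      (μ : Measure (Fin d → ℝ)).map fun x => (prevCoords i x, x i) :=
  ProbabilityTheory.compProd_map_condDistrib (measurable_pi_apply i).aemeasurable

theorem condCoord_mem_Icc {R : ℝ} (hR : 0 ≤ R) {μ : ProbabilityMeasure (Fin d → ℝ)}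
    (hμ : IsCubeAC R μ) (i : Fin d) :
    ∀ᵐ p ∂(μ : Measure (Fin d → ℝ)).map (prevCoords i),
      ∀ᵐ t ∂condCoord μ i p, t ∈ Set.Icc (-R) R := by
  have hm := (measurable_prevCoords i).prodMk (measurable_pi_apply (X := fun _ : Fin d => ℝ) i)
  have h : ∀ᵐ q ∂((μ : Measure (Fin d → ℝ)).map (prevCoords i)).compProd (condCoord μ i),
      q.2 ∈ Set.Icc (-R) R := by
    rw [compProd_condCoord, ae_map_iff hm.aemeasurable (measurable_snd measurableSet_Icc)]
    filter_upwards [hμ.mem] with x hx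
    exact abs_le.1 ((mem_cube_iff hR).1 hx i)
  exact Measure.ae_ae_of_ae_compProd h

/-- The conditional laws of an absolutely continuous measure have no atoms. -/
theorem condCoord_singleton {R : ℝ} {μ : ProbabilityMeasure (Fin d → ℝ)}
    (hμ : IsCubeAC R μ) (i : Fin d) :
    ∀ᵐ p ∂(μ : Measure (Fin d → ℝ)).map (prevCoords i), ∀ t, condCoord μ i p {t} = 0 := by
  classical
  have hq : Measure.QuasiMeasurePreserving
      (fun x : Fin d → ℝ => (prevCoords i x, x i)) volume
      ((volume : Measure (Set.Iio i → ℝ)).prod (volume : Measure ℝ)) := by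
    have h1 : Measure.QuasiMeasurePreserving
        (MeasurableEquiv.piEquivPiSubtypeProd (fun _ : Fin d => ℝ) (fun j => j ∈ Set.Iio i))
        volume ((volume : Measure ({j // j ∈ Set.Iio i} → ℝ)).prod
          (volume : Measure ({j // j ∉ Set.Iio i} → ℝ))) := by
      rw [← Measure.volume_eq_prod]
      convert (volume_preserving_piEquivPiSubtypeProd (fun _ : Fin d => ℝ)
        (fun j => j ∈ Set.Iio i)).quasiMeasurePreserving
      rfl
    have h2 : Measure.QuasiMeasurePreserving (Function.eval (⟨i, by simp⟩ : {j // j ∉ Set.Iio i}))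
        (volume : Measure ({j // j ∉ Set.Iio i} → ℝ)) (volume : Measure ℝ) :=
      Measure.quasiMeasurePreserving_eval (fun _ => volume) _
    exact (quasiMeasurePreserving_id_prodMap h2).comp h1
  have hac : ((μ : Measure (Fin d → ℝ)).map (prevCoords i)).compProd (condCoord μ i) ≪
      (volume : Measure (Set.Iio i → ℝ)).compProd
        (ProbabilityTheory.Kernel.const _ (volume : Measure ℝ).toFinite) := by
    rw [compProd_condCoord, Measure.compProd_const]
    refine (hμ.ac.map hq.measurable).trans (hq.absolutelyContinuous.trans ?_)
    exact Measure.AbsolutelyContinuous.rfl.prod (absolutelyContinuous_toFinite _)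
  filter_upwards [hac.kernel_of_compProd] with p hp t
  refine hp ?_
  rw [ProbabilityTheory.Kernel.const_apply]
  exact toFinite_absolutelyContinuous _ (measure_singleton t)

/-! ### Sequential sampling of coordinates -/

/-- Conditional distribution function of the `i`-th coordinate of `μ`. -/
def cdfCoord (μ : ProbabilityMeasure (Fin d → ℝ)) (i : Fin d) : (Set.Iio i → ℝ) → ℝ → ℝ :=
  kerCDF (condCoord μ i)

/-- Conditional quantile function of the `i`-th coordinate of `μ`. -/
def quantCoord (R : ℝ) (μ : ProbabilityMeasure (Fin d → ℝ)) (i : Fin d) :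
    (Set.Iio i → ℝ) → ℝ → ℝ :=
  kerQuantile R (condCoord μ i)

/-- Keep the first `k` coordinates of `x` and resample the others successively: coordinate `i` is
the conditional quantile under `μ`, at level `w i`, given the coordinates already constructed. -/
def resample (R : ℝ) (μ : ProbabilityMeasure (Fin d → ℝ)) (k : ℕ) (x w : Fin d → ℝ) (i : Fin d) :
    ℝ :=
  if (i : ℕ) < k then x i
  else quantCoord R μ i (fun j : Set.Iio i => resample R μ k x w j) (w i)
termination_by i
decreasing_by exact j.2

variable {R : ℝ} {μ : ProbabilityMeasure (Fin d → ℝ)} {k : ℕ}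

theorem resample_of_lt {x w : Fin d → ℝ} {i : Fin d} (h : (i : ℕ) < k) :
    resample R μ k x w i = x i := by
  rw [resample, if_pos h]

theorem resample_of_le {x w : Fin d → ℝ} {i : Fin d} (h : k ≤ (i : ℕ)) :
    resample R μ k x w i = quantCoord R μ i (prevCoords i (resample R μ k x w)) (w i) := by
  rw [resample, if_neg (not_lt.2 h)]
  rfl

theorem measurable_resample (hR : 0 ≤ R) :
    Measurable fun q : (Fin d → ℝ) × (Fin d → ℝ) => resample R μ k q.1 q.2 := by
  have key : ∀ n : ℕ, ∀ i : Fin d, (i : ℕ) < n →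
      Measurable fun q : (Fin d → ℝ) × (Fin d → ℝ) => resample R μ k q.1 q.2 i := by
    intro n
    induction n with
    | zero => intro i hi; omega
    | succ n ih =>
      intro i hi
      by_cases h : (i : ℕ) < k
      · simp_rw [resample_of_lt h]
        exact (measurable_pi_apply i).comp measurable_fst
      · simp_rw [resample_of_le (not_lt.1 h)]
        refine (measurable_kerQuantile hR (condCoord μ i)).comp (Measurable.prodMk
          (measurable_pi_lambda _ fun j => ih j ?_) ((measurable_pi_apply i).comp measurable_snd))
        have : (j : Fin d) < i := j.2
        have : ((j : Fin d) : ℕ) < (i : ℕ) := this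
        omega
  exact measurable_pi_lambda _ fun i => key d i i.2

theorem resample_congr {x w x' w' : Fin d → ℝ} {n : ℕ} (hx : ∀ j : Fin d, (j : ℕ) < n → x j = x' j)
    (hw : ∀ j : Fin d, (j : ℕ) < n → w j = w' j) (i : Fin d) (hi : (i : ℕ) < n) :
    resample R μ k x w i = resample R μ k x' w' i := by
  induction n generalizing i with
  | zero => omega
  | succ n ih =>
    by_cases h : (i : ℕ) < k
    · rw [resample_of_lt h, resample_of_lt h, hx i hi]
    · rw [resample_of_le (not_lt.1 h), resample_of_le (not_lt.1 h), hw i hi]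
      congr 1
      ext j
      have : (j : Fin d) < i := j.2
      have : ((j : Fin d) : ℕ) < (i : ℕ) := this
      exact ih (fun l hl => hx l (by omega)) (fun l hl => hw l (by omega)) j (by omega)

/-- Set the coordinates from the `n`-th on to zero. -/
def truncCoords (n : ℕ) (x : Fin d → ℝ) : Fin d → ℝ := fun j => if (j : ℕ) < n then x j else 0

theorem measurable_truncCoords (n : ℕ) : Measurable (truncCoords (d := d) n) := by
  refine measurable_pi_lambda _ fun j => ?_
  unfold truncCoords
  split_ifs
  · exact measurable_pi_apply j
  · exact measurable_const

/-- A random vector whose coordinates from the `k`-th on are obtained by sequential quantile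
sampling of `μ` with independent uniform levels, and whose first `k` coordinates are distributed
as under `μ`, has law `μ`. -/
theorem map_eq_of_quantCoord {Ω : Type*} [MeasurableSpace Ω] {P : Measure Ω}
    [IsProbabilityMeasure P] (hR : 0 ≤ R) (hμ : IsCubeAC R μ) {z w : Ω → Fin d → ℝ}
    (hz : Measurable z) (hw : Measurable w)
    (hzw : ∀ i : Fin d, k ≤ (i : ℕ) → ∀ ω, z ω i = quantCoord R μ i (prevCoords i (z ω)) (w ω i))
    (hind : ∀ i : Fin d, k ≤ (i : ℕ) → P.map (fun ω => (prevCoords i (z ω), w ω i)) =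
      (P.map fun ω => prevCoords i (z ω)).prod unif)
    (h0 : P.map (fun ω => truncCoords k (z ω)) =
      (μ : Measure (Fin d → ℝ)).map (truncCoords k)) :
    P.map z = μ := by
  have key : ∀ n : ℕ, k + n ≤ d ∨ n = 0 → P.map (fun ω => truncCoords (k + n) (z ω)) =
      (μ : Measure (Fin d → ℝ)).map (truncCoords (k + n)) := by
    intro n
    induction n with
    | zero => intro _; exact h0
    | succ n ih =>
      intro hn
      have hn' : k + n < d := by omega
      have ih' := ih (by omega)
      set i : Fin d := ⟨k + n, hn'⟩ with hi
      have hprev : ∀ x : Fin d → ℝ, prevCoords i x = prevCoords i (truncCoords (k + n) x) := by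
        intro x
        ext j
        have : (j : Fin d) < i := j.2
        have : ((j : Fin d) : ℕ) < k + n := this
        simp [prevCoords, truncCoords, this]
      -- the law of the preceding coordinates is the right one
      have hlaw : P.map (fun ω => prevCoords i (z ω)) =
          (μ : Measure (Fin d → ℝ)).map (prevCoords i) := by
        have e1 : (fun ω => prevCoords i (z ω)) =
            prevCoords i ∘ fun ω => truncCoords (k + n) (z ω) := funext fun ω => hprev _
        have e2 : prevCoords i = prevCoords i ∘ truncCoords (d := d) (k + n) :=
          funext fun x => hprev x
        have hmt : Measurable fun ω => truncCoords (k + n) (z ω) :=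
          (measurable_truncCoords _).comp hz
        rw [e1, ← Measure.map_map (measurable_prevCoords i) hmt, ih',
          Measure.map_map (measurable_prevCoords i) (measurable_truncCoords _), ← e2]
      have hpair : P.map (fun ω => (prevCoords i (z ω), z ω i)) =
          (μ : Measure (Fin d → ℝ)).map fun x => (prevCoords i x, x i) := by
        have hq : Measurable fun q : (Set.Iio i → ℝ) × ℝ => (q.1, quantCoord R μ i q.1 q.2) :=
          measurable_fst.prodMk (measurable_kerQuantile hR _)
        have e1 : (fun ω => (prevCoords i (z ω), z ω i)) =
            (fun q : (Set.Iio i → ℝ) × ℝ => (q.1, quantCoord R μ i q.1 q.2)) ∘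
              fun ω => (prevCoords i (z ω), w ω i) := by
          ext ω
          · rfl
          · exact hzw i (by simp [hi]) ω
        have hmP : Measurable fun ω => (prevCoords i (z ω), w ω i) :=
          ((measurable_prevCoords i).comp hz).prodMk ((measurable_pi_apply i).comp hw)
        have : IsProbabilityMeasure ((μ : Measure (Fin d → ℝ)).map (prevCoords i)) :=
          Measure.isProbabilityMeasure_map (measurable_prevCoords i).aemeasurable
        rw [e1, ← Measure.map_map hq hmP, hind i (by simp [hi]), hlaw, ← compProd_condCoord]
        exact map_prod_unif_kerQuantile hR (condCoord_mem_Icc hR hμ i)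
      -- the first `k + n + 1` coordinates are a function of this pair
      set J : (Set.Iio i → ℝ) × ℝ → Fin d → ℝ := fun q j =>
        if h : j < i then q.1 ⟨j, h⟩ else if j = i then q.2 else 0 with hJ
      have hJm : Measurable J := by
        refine measurable_pi_lambda _ fun j => ?_
        simp only [hJ]
        split_ifs with h1 h2
        · exact (measurable_pi_apply _).comp measurable_fst
        · exact measurable_snd
        · exact measurable_const
      have hJx : ∀ x : Fin d → ℝ, truncCoords (k + (n + 1)) x = J (prevCoords i x, x i) := by
        intro x
        ext j
        simp only [truncCoords, hJ, prevCoords]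
        by_cases h1 : j < i
        · have : (j : ℕ) < k + n := h1
          rw [dif_pos h1, if_pos (by omega)]
        · rw [dif_neg h1]
          by_cases h2 : j = i
          · rw [if_pos h2, h2, if_pos (by simp [hi])]
          · rw [if_neg h2, if_neg]
            intro h3
            have h4 : ¬ (j : ℕ) < k + n := h1
            exact h2 (Fin.ext (by simp [hi]; omega))
      have e1 : (fun ω => truncCoords (k + (n + 1)) (z ω)) =
          J ∘ fun ω => (prevCoords i (z ω), z ω i) := funext fun ω => hJx _
      have e2 : truncCoords (d := d) (k + (n + 1)) = J ∘ fun x => (prevCoords i x, x i) :=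
        funext fun x => hJx x
      have hm1 : Measurable fun ω => (prevCoords i (z ω), z ω i) :=
        ((measurable_prevCoords i).comp hz).prodMk ((measurable_coord i).comp hz)
      rw [e1, ← Measure.map_map hJm hm1, hpair, Measure.map_map hJm
        ((measurable_prevCoords i).prodMk (measurable_coord i)), ← e2]
  have hfull : ∀ n : ℕ, d ≤ n → truncCoords (d := d) n = id := by
    intro n hn
    ext x j
    simp [truncCoords, j.2.trans_le hn]
  have hlast : P.map (fun ω => truncCoords (k + (d - k)) (z ω)) =
      (μ : Measure (Fin d → ℝ)).map (truncCoords (k + (d - k))) := key (d - k) (by omega)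
  rw [hfull _ (by omega), Measure.map_id] at hlast
  exact hlast

/-- The uniform distribution on `[0, 1]^d`. -/
def unifCube (d : ℕ) : Measure (Fin d → ℝ) := Measure.pi fun _ => unif

instance (d : ℕ) : IsProbabilityMeasure (unifCube d) := by unfold unifCube; infer_instance

theorem measurable_update_coord (i : Fin d) :
    Measurable fun q : (Fin d → ℝ) × ℝ => Function.update q.1 i q.2 := by
  refine measurable_pi_lambda _ fun j => ?_
  by_cases h : j = i
  · subst h; simpa using measurable_snd
  · simp only [Function.update_of_ne h]
    exact (measurable_coord j).comp measurable_fst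

theorem unifCube_map_update (i : Fin d) :
    ((unifCube d).prod unif).map (fun q => Function.update q.1 i q.2) = unifCube d := by
  have hm : Measurable fun q : (Fin d → ℝ) × ℝ => Function.update q.1 i q.2 :=
    measurable_update_coord i
  refine (Measure.pi_eq fun s hs => ?_).symm
  rw [Measure.map_apply hm (MeasurableSet.univ_pi hs)]
  have : (fun q : (Fin d → ℝ) × ℝ => Function.update q.1 i q.2) ⁻¹' Set.pi Set.univ s =
      (Set.pi Set.univ (Function.update s i Set.univ)) ×ˢ s i := by
    ext q
    simp only [Set.mem_preimage, Set.mem_pi, Set.mem_univ, forall_const, Set.mem_prod]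
    constructor
    · intro h
      refine ⟨fun j => ?_, by simpa using h i⟩
      by_cases hj : j = i
      · subst hj; simp
      · simpa [Function.update_of_ne hj] using h j
    · rintro ⟨h1, h2⟩ j
      by_cases hj : j = i
      · subst hj; simpa using h2
      · simpa [Function.update_of_ne hj] using h1 j
  rw [this, Measure.prod_prod, unifCube, Measure.pi_pi]
  rw [← Finset.mul_prod_erase Finset.univ (fun j => unif (s j)) (Finset.mem_univ i),
    ← Finset.mul_prod_erase Finset.univ (fun j => unif (Function.update s i Set.univ j))
      (Finset.mem_univ i), Function.update_self, measure_univ, one_mul, mul_comm]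
  congr 1
  refine Finset.prod_congr rfl fun j hj => ?_
  rw [Function.update_of_ne (Finset.ne_of_mem_erase hj)]

/-- A function that does not depend on the level `w i` is independent of it. -/
theorem map_prod_unifCube_pair {Ω Z : Type*} [MeasurableSpace Ω] [MeasurableSpace Z]
    {ρ : Measure Ω} [IsProbabilityMeasure ρ] (i : Fin d) {f : Ω × (Fin d → ℝ) → Z}
    (hf : Measurable f) (hfi : ∀ ω w u, f (ω, Function.update w i u) = f (ω, w)) :
    (ρ.prod (unifCube d)).map (fun q => (f q, q.2 i)) =
      ((ρ.prod (unifCube d)).map f).prod unif := by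
  have hu : Measurable fun q : (Fin d → ℝ) × ℝ => Function.update q.1 i q.2 :=
    measurable_update_coord i
  have hm : Measurable fun q : Ω × (Fin d → ℝ) => (f q, q.2 i) :=
    hf.prodMk ((measurable_pi_apply i).comp measurable_snd)
  have e0 : ρ.prod (unifCube d) = (ρ.prod ((unifCube d).prod unif)).map
      (Prod.map id fun q => Function.update q.1 i q.2) := by
    rw [← Measure.map_prod_map _ _ measurable_id hu, Measure.map_id, unifCube_map_update]
  have e1 : ((fun q : Ω × (Fin d → ℝ) => (f q, q.2 i)) ∘
      (Prod.map id fun q : (Fin d → ℝ) × ℝ => Function.update q.1 i q.2)) =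
      (Prod.map f id) ∘ MeasurableEquiv.prodAssoc.symm := by
    ext ⟨ω, w, u⟩
    · simp [hfi, MeasurableEquiv.prodAssoc]
    · simp [MeasurableEquiv.prodAssoc]
  have e2 : (ρ.prod ((unifCube d).prod unif)).map MeasurableEquiv.prodAssoc.symm =
      (ρ.prod (unifCube d)).prod unif :=
    (measurePreserving_prodAssoc ρ (unifCube d) unif).symm.map_eq
  conv_lhs => rw [e0]
  rw [Measure.map_map hm (measurable_id.prodMap hu), e1,
    ← Measure.map_map (hf.prodMap measurable_id) MeasurableEquiv.prodAssoc.symm.measurable, e2,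
    ← Measure.map_prod_map _ _ hf measurable_id, Measure.map_id]

/-- Resampling with uniform levels: the law `μ` is invariant, whatever the law of the source, as
long as its first `k` coordinates are distributed as under `μ`. -/
theorem map_resample {Ω : Type*} [MeasurableSpace Ω] {ρ : Measure Ω}
    [IsProbabilityMeasure ρ] (hR : 0 ≤ R) (hμ : IsCubeAC R μ) {f : Ω → Fin d → ℝ}
    (hf : Measurable f) (h0 : ρ.map (fun ω => truncCoords k (f ω)) =
      (μ : Measure (Fin d → ℝ)).map (truncCoords k)) :
    (ρ.prod (unifCube d)).map (fun q => resample R μ k (f q.1) q.2) = μ := by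
  have hz : Measurable fun q : Ω × (Fin d → ℝ) => resample R μ k (f q.1) q.2 :=
    (measurable_resample hR).comp (hf.prodMap measurable_id)
  refine map_eq_of_quantCoord hR hμ (k := k) (w := Prod.snd) hz measurable_snd
    (fun i hi q => resample_of_le hi) (fun i hi => ?_) ?_
  · refine map_prod_unifCube_pair i ((measurable_prevCoords i).comp hz) fun ω w u => ?_
    ext j
    refine resample_congr (n := (i : ℕ)) (fun _ _ => rfl) (fun l hl => ?_) (j : Fin d) j.2
    exact Function.update_of_ne (fun h => by simp [h] at hl) _ _
  · have e : (fun q : Ω × (Fin d → ℝ) => truncCoords k (resample R μ k (f q.1) q.2)) =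
        (fun ω => truncCoords k (f ω)) ∘ Prod.fst := by
      ext q j
      simp only [truncCoords, Function.comp]
      split_ifs with h
      · rw [resample_of_lt h]
      · rfl
    have hmt : Measurable fun ω => truncCoords k (f ω) := (measurable_truncCoords k).comp hf
    rw [e, ← Measure.map_map hmt measurable_fst]
    have : (ρ.prod (unifCube d)).map Prod.fst = ρ := by simp
    rw [this, h0]

end

/-! ### The Knothe-Rosenblatt map -/

section

variable {d : ℕ} {R : ℝ} {μ N : ProbabilityMeasure (Fin d → ℝ)}

/-- The Rosenblatt transform: coordinate `i` is the conditional distribution function of the `i`-th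
coordinate, given the preceding ones, evaluated at `x i`. -/
def rosenblatt (μ : ProbabilityMeasure (Fin d → ℝ)) (x : Fin d → ℝ) (i : Fin d) : ℝ :=
  cdfCoord μ i (prevCoords i x) (x i)

theorem measurable_rosenblatt (μ : ProbabilityMeasure (Fin d → ℝ)) : Measurable (rosenblatt μ) :=
  measurable_pi_lambda _ fun i =>
    (measurable_kerCDF (condCoord μ i)).comp ((measurable_prevCoords i).prodMk (measurable_coord i))

/-- The Knothe-Rosenblatt map from `μ` to `N`: sequential quantile sampling of `N` at the levels
given by the Rosenblatt transform of `μ`. -/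
def krMap (R : ℝ) (μ N : ProbabilityMeasure (Fin d → ℝ)) (x : Fin d → ℝ) : Fin d → ℝ :=
  resample R N 0 0 (rosenblatt μ x)

theorem krMap_apply (x : Fin d → ℝ) (i : Fin d) :
    krMap R μ N x i = quantCoord R N i (prevCoords i (krMap R μ N x)) (rosenblatt μ x i) :=
  resample_of_le (Nat.zero_le _)

theorem krMap_mem (hR : 0 ≤ R) (x : Fin d → ℝ) (i : Fin d) :
    krMap R μ N x i ∈ Set.Icc (-R) R := by
  rw [krMap_apply]; exact kerQuantile_mem hR _ _ _

theorem abs_krMap_le (hR : 0 ≤ R) (x : Fin d → ℝ) (i : Fin d) : |krMap R μ N x i| ≤ R :=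
  abs_le.2 (krMap_mem hR x i)

theorem measurable_krMap (hR : 0 ≤ R) : Measurable (krMap R μ N) :=
  (measurable_resample hR).comp (measurable_const.prodMk (measurable_rosenblatt μ))

theorem krMap_congr {x x' : Fin d → ℝ} {n : ℕ} (h : ∀ j : Fin d, (j : ℕ) < n → x j = x' j)
    (i : Fin d) (hi : (i : ℕ) < n) : krMap R μ N x i = krMap R μ N x' i := by
  refine resample_congr (n := n) (fun _ _ => rfl) (fun j hj => ?_) i hi
  unfold rosenblatt
  rw [h j hj]
  congr 1
  ext l
  have : (l : Fin d) < j := l.2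
  have : ((l : Fin d) : ℕ) < (j : ℕ) := this
  exact h l (by omega)

/-- Extend a vector of the first coordinates by zero. -/
def extendCoords (i : Fin d) (p : Set.Iio i → ℝ) : Fin d → ℝ :=
  fun j => if h : j < i then p ⟨j, h⟩ else 0

theorem measurable_extendCoords (i : Fin d) : Measurable (extendCoords i) := by
  refine measurable_pi_lambda _ fun j => ?_
  unfold extendCoords
  split_ifs with h
  · exact measurable_pi_apply _
  · exact measurable_const

theorem extendCoords_prevCoords (i : Fin d) (x : Fin d → ℝ) {j : Fin d} (h : (j : ℕ) < i) :
    extendCoords i (prevCoords i x) j = x j := by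
  have : j < i := h
  simp [extendCoords, prevCoords, this]

/-- The first coordinates of the Knothe-Rosenblatt map, as a function of the first coordinates. -/
def prevKrMap (R : ℝ) (μ N : ProbabilityMeasure (Fin d → ℝ)) (i : Fin d) (p : Set.Iio i → ℝ) :
    Set.Iio i → ℝ := prevCoords i (krMap R μ N (extendCoords i p))

theorem measurable_prevKrMap (hR : 0 ≤ R) (i : Fin d) : Measurable (prevKrMap R μ N i) :=
  (measurable_prevCoords i).comp ((measurable_krMap hR).comp (measurable_extendCoords i))

theorem prevKrMap_prevCoords (i : Fin d) (x : Fin d → ℝ) :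
    prevKrMap R μ N i (prevCoords i x) = prevCoords i (krMap R μ N x) := by
  ext j
  exact krMap_congr (n := (i : ℕ)) (fun l hl => extendCoords_prevCoords i x hl) (j : Fin d) j.2

theorem ae_map_prevCoords {i : Fin d} {p : (Set.Iio i → ℝ) → Prop}
    (h : ∀ᵐ q ∂(μ : Measure (Fin d → ℝ)).map (prevCoords i), p q) :
    ∀ᵐ x ∂(μ : Measure (Fin d → ℝ)), p (prevCoords i x) :=
  ae_of_ae_map (measurable_prevCoords i).aemeasurable h

/-- Under `μ` the level of the `i`-th coordinate is uniform and independent of the preceding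
coordinates. -/
theorem map_prevCoords_rosenblatt (hR : 0 ≤ R) (hμ : IsCubeAC R μ) (i : Fin d) :
    (μ : Measure (Fin d → ℝ)).map (fun x => (prevCoords i x, rosenblatt μ x i)) =
      ((μ : Measure (Fin d → ℝ)).map (prevCoords i)).prod unif := by
  have : IsProbabilityMeasure ((μ : Measure (Fin d → ℝ)).map (prevCoords i)) :=
    Measure.isProbabilityMeasure_map (measurable_prevCoords i).aemeasurable
  rw [← map_compProd_kerCDF hR (condCoord_mem_Icc hR hμ i) (condCoord_singleton hμ i),
    compProd_condCoord, Measure.map_map (measurable_fst.prodMk (measurable_kerCDF _))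
      ((measurable_prevCoords i).prodMk (measurable_coord i))]
  rfl

theorem map_comp_prevCoords_rosenblatt (hR : 0 ≤ R) (hμ : IsCubeAC R μ) (i : Fin d) {Z : Type*}
    [MeasurableSpace Z] {f : (Set.Iio i → ℝ) → Z} (hf : Measurable f) :
    (μ : Measure (Fin d → ℝ)).map (fun x => (f (prevCoords i x), rosenblatt μ x i)) =
      ((μ : Measure (Fin d → ℝ)).map fun x => f (prevCoords i x)).prod unif := by
  have : IsProbabilityMeasure ((μ : Measure (Fin d → ℝ)).map (prevCoords i)) :=
    Measure.isProbabilityMeasure_map (measurable_prevCoords i).aemeasurable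
  have e : (fun x => (f (prevCoords i x), rosenblatt μ x i)) =
      Prod.map f id ∘ fun x => (prevCoords i x, rosenblatt μ x i) := rfl
  have e2 : (fun x => f (prevCoords i x)) = f ∘ prevCoords i := rfl
  have hm : Measurable fun x => (prevCoords i x, rosenblatt μ x i) :=
    (measurable_prevCoords i).prodMk ((measurable_coord i).comp (measurable_rosenblatt μ))
  rw [e, ← Measure.map_map (hf.prodMap measurable_id) hm, map_prevCoords_rosenblatt hR hμ,
    ← Measure.map_prod_map _ _ hf measurable_id, Measure.map_id,
    Measure.map_map hf (measurable_prevCoords i), e2]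

/-- The Rosenblatt transform provides independent uniform levels, so that sampling `N` at these
levels produces the law `N`. -/
theorem map_krMap (hR : 0 ≤ R) (hμ : IsCubeAC R μ) (hN : IsCubeAC R N) :
    (μ : Measure (Fin d → ℝ)).map (krMap R μ N) = N := by
  refine map_eq_of_quantCoord (k := 0) hR hN (measurable_krMap hR) (measurable_rosenblatt μ)
    (fun i _ x => krMap_apply x i) (fun i _ => ?_) ?_
  · have := map_comp_prevCoords_rosenblatt hR hμ i (measurable_prevKrMap (μ := μ) (N := N) hR i)
    simpa only [prevKrMap_prevCoords] using this
  · have h : truncCoords (d := d) 0 = fun _ => 0 := by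
      ext x j; simp [truncCoords]
    simp [h]

theorem map_prevCoords_krMap (hR : 0 ≤ R) (hμ : IsCubeAC R μ) (hN : IsCubeAC R N) (i : Fin d) :
    (μ : Measure (Fin d → ℝ)).map (fun x => prevCoords i (krMap R μ N x)) =
      (N : Measure (Fin d → ℝ)).map (prevCoords i) := by
  rw [← map_krMap hR hμ hN, Measure.map_map (measurable_prevCoords i) (measurable_krMap hR)]
  rfl

theorem ae_prevCoords_krMap (hR : 0 ≤ R) (hμ : IsCubeAC R μ) (hN : IsCubeAC R N) {i : Fin d}
    {p : (Set.Iio i → ℝ) → Prop} (h : ∀ᵐ q ∂(N : Measure (Fin d → ℝ)).map (prevCoords i), p q) :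
    ∀ᵐ x ∂(μ : Measure (Fin d → ℝ)), p (prevCoords i (krMap R μ N x)) := by
  rw [← map_prevCoords_krMap hR hμ hN] at h
  exact ae_of_ae_map ((measurable_prevCoords i).comp (measurable_krMap hR)).aemeasurable h

/-- The `i`-th component of the Knothe-Rosenblatt map as a function of the `i`-th variable, given
the preceding ones. -/
def krSlice (R : ℝ) (μ N : ProbabilityMeasure (Fin d → ℝ)) (i : Fin d) (p : Set.Iio i → ℝ)
    (t : ℝ) : ℝ :=
  quantCoord R N i (prevKrMap R μ N i p) (cdfCoord μ i p t)

theorem measurable_krSlice (hR : 0 ≤ R) (i : Fin d) :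
    Measurable fun q : (Set.Iio i → ℝ) × ℝ => krSlice R μ N i q.1 q.2 :=
  (measurable_kerQuantile hR (condCoord N i)).comp
    (((measurable_prevKrMap hR i).comp measurable_fst).prodMk (measurable_kerCDF (condCoord μ i)))

theorem krSlice_mono (hR : 0 ≤ R) (i : Fin d) (p : Set.Iio i → ℝ) :
    Monotone (krSlice R μ N i p) := fun _ _ h =>
  kerQuantile_mono hR _ _ (ProbabilityTheory.monotone_cdf _ h)

theorem krSlice_mem (hR : 0 ≤ R) (i : Fin d) (p : Set.Iio i → ℝ) (t : ℝ) :
    krSlice R μ N i p t ∈ Set.Icc (-R) R := kerQuantile_mem hR _ _ _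

theorem krSlice_prevCoords (i : Fin d) (x : Fin d → ℝ) :
    krSlice R μ N i (prevCoords i x) (x i) = krMap R μ N x i := by
  rw [krSlice, prevKrMap_prevCoords, krMap_apply]
  rfl

theorem prevCoords_update (i : Fin d) (x : Fin d → ℝ) (t : ℝ) :
    prevCoords i (Function.update x i t) = prevCoords i x := by
  ext j
  exact Function.update_of_ne (ne_of_lt j.2) _ _

theorem krMap_update (i : Fin d) (x : Fin d → ℝ) (t : ℝ) :
    krMap R μ N (Function.update x i t) i = krSlice R μ N i (prevCoords i x) t := by
  rw [← krSlice_prevCoords, prevCoords_update, Function.update_self]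

/-- Each slice is a quantile function composed with a distribution function: it is monotone and
turns the conditional law of `μ` first into the uniform law and then into the conditional law of
`N`. -/
theorem isKnotheRosenblattMap_krMap (hR : 0 ≤ R) (hμ : IsCubeAC R μ) (hN : IsCubeAC R N) :
    IsKnotheRosenblattMap μ N (krMap R μ N) where
  measurable := measurable_krMap hR
  map_eq := map_krMap hR hμ hN
  triangular := fun i x x' h =>
    krMap_congr (n := (i : ℕ) + 1) (fun j hj => h j (Fin.le_def.2 (by omega))) i (by omega)
  monotone_slice := fun i => Eventually.of_forall fun x => by
    simp_rw [krMap_update]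
    exact krSlice_mono hR i _
  map_slice := fun i => by
    filter_upwards [ae_map_prevCoords (condCoord_mem_Icc hR hμ i),
      ae_map_prevCoords (condCoord_singleton hμ i),
      ae_prevCoords_krMap hR hμ hN (condCoord_mem_Icc hR hN i)] with x h1 h2 h3
    simp_rw [krMap_update]
    have e : (fun t => krSlice R μ N i (prevCoords i x) t) =
        kerQuantile R (condCoord N i) (prevCoords i (krMap R μ N x)) ∘
          kerCDF (condCoord μ i) (prevCoords i x) := by
      ext t
      rw [krSlice, prevKrMap_prevCoords]
      rfl
    rw [e, ← Measure.map_map (measurable_kerQuantile_apply hR _ _) (measurable_kerCDF_apply _ _),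
      map_kerCDF hR h1 h2, unif_map_kerQuantile hR h3]

/-- The levels of `krMap x` under `N` are those of `x` under `μ`. -/
theorem rosenblatt_krMap (hR : 0 ≤ R) (hμ : IsCubeAC R μ) (hN : IsCubeAC R N) :
    ∀ᵐ x ∂(μ : Measure (Fin d → ℝ)), rosenblatt N (krMap R μ N x) = rosenblatt μ x := by
  have h : ∀ᵐ x ∂(μ : Measure (Fin d → ℝ)), ∀ i,
      rosenblatt N (krMap R μ N x) i = rosenblatt μ x i := by
    refine ae_all_iff.2 fun i => ?_
    filter_upwards [ae_prevCoords_krMap hR hμ hN (condCoord_mem_Icc hR hN i),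
      ae_prevCoords_krMap hR hμ hN (condCoord_singleton hN i)] with x h1 h2
    have hu : rosenblatt μ x i ∈ Set.Icc (0 : ℝ) 1 :=
      ⟨ProbabilityTheory.cdf_nonneg _ _, ProbabilityTheory.cdf_le_one _ _⟩
    have h3 := kerCDF_kerQuantile hR h1 h2 hu
    rw [rosenblatt, krMap_apply]
    exact h3
  filter_upwards [h] with x hx using funext hx

/-- Almost surely `x` is recovered from its levels by the conditional quantile functions. -/
theorem ae_quantCoord_rosenblatt (hR : 0 ≤ R) (hμ : IsCubeAC R μ) (i : Fin d) :
    ∀ᵐ x ∂(μ : Measure (Fin d → ℝ)),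
      quantCoord R μ i (prevCoords i x) (rosenblatt μ x i) = x i := by
  have h : ∀ᵐ q ∂((μ : Measure (Fin d → ℝ)).map (prevCoords i)).compProd (condCoord μ i),
      kerQuantile R (condCoord μ i) q.1 (kerCDF (condCoord μ i) q.1 q.2) = q.2 := by
    have hm : MeasurableSet {q : (Set.Iio i → ℝ) × ℝ |
        kerQuantile R (condCoord μ i) q.1 (kerCDF (condCoord μ i) q.1 q.2) = q.2} :=
      measurableSet_eq_fun ((measurable_kerQuantile hR (condCoord μ i)).comp
        (measurable_fst.prodMk (measurable_kerCDF (condCoord μ i)))) measurable_snd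
    rw [Measure.ae_compProd_iff hm]
    filter_upwards [condCoord_mem_Icc hR hμ i, condCoord_singleton hμ i] with p h1 h2
    exact ae_kerQuantile_kerCDF hR h1 h2
  rw [compProd_condCoord] at h
  exact ae_of_ae_map ((measurable_prevCoords i).prodMk (measurable_coord i)).aemeasurable h

/-- The Knothe-Rosenblatt map from `N` to `μ` inverts the one from `μ` to `N`. -/
theorem krMap_krMap (hR : 0 ≤ R) (hμ : IsCubeAC R μ) (hN : IsCubeAC R N) :
    ∀ᵐ x ∂(μ : Measure (Fin d → ℝ)), krMap R N μ (krMap R μ N x) = x := by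
  filter_upwards [rosenblatt_krMap hR hμ hN,
    ae_all_iff.2 fun i => ae_quantCoord_rosenblatt hR hμ i] with x h1 h2
  have key : ∀ n : ℕ, ∀ i : Fin d, (i : ℕ) < n → krMap R N μ (krMap R μ N x) i = x i := by
    intro n
    induction n with
    | zero => intro i hi; omega
    | succ n ih =>
      intro i hi
      rw [krMap_apply, h1, ← h2 i]
      have e : prevCoords i (krMap R N μ (krMap R μ N x)) = prevCoords i x := by
        ext j
        have : (j : Fin d) < i := j.2
        have : ((j : Fin d) : ℕ) < (i : ℕ) := this
        exact ih j (by omega)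
      rw [e, h2 i]
  exact funext fun i => key d i i.2

end

/-! ### The slack in the one-dimensional monotone transport problem -/

/-- Lebesgue measure on `[-R, R]`. -/
def segMeasure (R : ℝ) : Measure ℝ := volume.restrict (Set.Icc (-R) R)

instance (R : ℝ) : IsFiniteMeasure (segMeasure R) := by unfold segMeasure; infer_instance

/-- The integrand of `monoSlack`. It is the positive part of `y - θ s` for `s > t`, and its negative
part for `s ≤ t`. -/
def slackIntegrand (θ : ℝ → ℝ) (t y s : ℝ) : ℝ :=
  max (y - θ s) 0 - (Set.Iic t).indicator (fun s => y - θ s) s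

/-- The slack `φ(t) + φ*(y) - t y` in Young's inequality for a primitive `φ` of `θ` on `[-R, R]`. -/
def monoSlack (R : ℝ) (θ : ℝ → ℝ) (t y : ℝ) : ℝ := ∫ s, slackIntegrand θ t y s ∂segMeasure R

/-- The convex conjugate of the primitive of a monotone `θ` on `[-R, R]`, up to the linear term
`R * y`. -/
def monoConj (R : ℝ) (θ : ℝ → ℝ) (y : ℝ) : ℝ := ∫ s, max (y - θ s) 0 ∂segMeasure R

/-- The primitive of `θ` vanishing at `-R`. -/
def monoPrim (R : ℝ) (θ : ℝ → ℝ) (t : ℝ) : ℝ := ∫ s, (Set.Iic t).indicator θ s ∂segMeasure R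

section

variable {R t y : ℝ} {θ : ℝ → ℝ}

theorem slackIntegrand_of_le {s : ℝ} (h : s ≤ t) : slackIntegrand θ t y s = max (θ s - y) 0 := by
  rw [slackIntegrand, Set.indicator_of_mem (Set.mem_Iic.2 h)]
  rcases le_total (y - θ s) 0 with h1 | h1
  · rw [max_eq_right h1, max_eq_left (by linarith)]; ring
  · rw [max_eq_left h1, max_eq_right (by linarith)]; ring

theorem slackIntegrand_of_lt {s : ℝ} (h : t < s) : slackIntegrand θ t y s = max (y - θ s) 0 := by
  rw [slackIntegrand, Set.indicator_of_notMem (by simpa using h), sub_zero]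

theorem slackIntegrand_nonneg (s : ℝ) : 0 ≤ slackIntegrand θ t y s := by
  rcases le_or_gt s t with h | h
  · rw [slackIntegrand_of_le h]; exact le_max_right _ _
  · rw [slackIntegrand_of_lt h]; exact le_max_right _ _

theorem monoSlack_nonneg : 0 ≤ monoSlack R θ t y := integral_nonneg slackIntegrand_nonneg

theorem measurable_slackIntegrand (hθ : Measurable θ) : Measurable (slackIntegrand θ t y) :=
  ((measurable_const.sub hθ).max measurable_const).sub
    ((measurable_const.sub hθ).indicator measurableSet_Iic)

theorem abs_slackIntegrand_le (hb : ∀ s, |θ s| ≤ R) (s : ℝ) :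
    |slackIntegrand θ t y s| ≤ |y| + R := by
  have h1 := abs_le.1 (hb s)
  have h2 := neg_abs_le y
  have h3 := le_abs_self y
  have h4 := abs_nonneg y
  rw [abs_of_nonneg (slackIntegrand_nonneg s)]
  rcases le_or_gt s t with h | h
  · rw [slackIntegrand_of_le h]; exact max_le (by linarith) (by linarith)
  · rw [slackIntegrand_of_lt h]; exact max_le (by linarith) (by linarith)

theorem integrable_slackIntegrand (hθ : Measurable θ) (hb : ∀ s, |θ s| ≤ R) :
    Integrable (slackIntegrand θ t y) (segMeasure R) :=
  integrable_of_abs_le (measurable_slackIntegrand hθ) (abs_slackIntegrand_le hb)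

theorem segMeasure_real_univ (hR : 0 ≤ R) : (segMeasure R).real Set.univ = 2 * R := by
  rw [segMeasure, measureReal_def, Measure.restrict_apply_univ, Real.volume_Icc,
    ENNReal.toReal_ofReal (by linarith)]
  ring

theorem segMeasure_real_Iic (ht : t ∈ Set.Icc (-R) R) :
    (segMeasure R).real (Set.Iic t) = t + R := by
  have : Set.Iic t ∩ Set.Icc (-R) R = Set.Icc (-R) t := by
    ext s
    simp only [Set.mem_inter_iff, Set.mem_Iic, Set.mem_Icc]
    constructor
    · rintro ⟨h1, h2, h3⟩; exact ⟨h2, h1⟩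
    · rintro ⟨h1, h2⟩; exact ⟨h2, h1, h2.trans ht.2⟩
  rw [segMeasure, measureReal_def, Measure.restrict_apply measurableSet_Iic, this, Real.volume_Icc,
    ENNReal.toReal_ofReal (by linarith [ht.1])]
  ring

/-- The slack is a function of `y` plus a function of `t` minus `(t + R) * y`, so its mean under a
plan depends on the marginals and the correlation only. -/
theorem monoSlack_eq (hθ : Measurable θ) (hb : ∀ s, |θ s| ≤ R) (ht : t ∈ Set.Icc (-R) R) :
    monoSlack R θ t y = monoConj R θ y - (t + R) * y + monoPrim R θ t := by
  have i1 : Integrable (fun s => max (y - θ s) 0) (segMeasure R) :=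
    integrable_of_abs_le ((measurable_const.sub hθ).max measurable_const) (M := |y| + R) fun s => by
      have h1 := abs_le.1 (hb s)
      have h3 := le_abs_self y
      have h4 := abs_nonneg y
      rw [abs_of_nonneg (le_max_right _ _)]
      exact max_le (by linarith) (by linarith)
  have i2 : Integrable ((Set.Iic t).indicator fun _ => y) (segMeasure R) :=
    (integrable_const y).indicator measurableSet_Iic
  have i3 : Integrable ((Set.Iic t).indicator θ) (segMeasure R) :=
    (integrable_of_abs_le hθ hb).indicator measurableSet_Iic
  have e : ∀ s, slackIntegrand θ t y s =
      max (y - θ s) 0 - ((Set.Iic t).indicator (fun _ => y) s - (Set.Iic t).indicator θ s) := by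
    intro s
    rw [slackIntegrand]
    congr 1
    exact congrFun (Set.indicator_sub (Set.Iic t) (fun _ => y) θ) s
  have i4 : Integrable (fun s => (Set.Iic t).indicator (fun _ => y) s - (Set.Iic t).indicator θ s)
      (segMeasure R) := i2.sub i3
  rw [monoSlack, integral_congr_ae (Eventually.of_forall e), integral_sub i1 i4,
    integral_sub i2 i3, integral_indicator_const _ measurableSet_Iic, segMeasure_real_Iic ht,
    monoConj, monoPrim, smul_eq_mul]
  ring

theorem monoSlack_self (hm : Monotone θ) : monoSlack R θ t (θ t) = 0 := by
  have e : ∀ s, slackIntegrand θ t (θ t) s = 0 := by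
    intro s
    rcases le_or_gt s t with h | h
    · rw [slackIntegrand_of_le h]; exact max_eq_right (sub_nonpos.2 (hm h))
    · rw [slackIntegrand_of_lt h]; exact max_eq_right (sub_nonpos.2 (hm h.le))
  simp [monoSlack, e]

theorem monoSlack_mono_of_le (hm : Monotone θ) (hb : ∀ s, |θ s| ≤ R) {y' : ℝ} (h1 : θ t ≤ y)
    (h2 : y ≤ y') : monoSlack R θ t y ≤ monoSlack R θ t y' := by
  refine integral_mono (integrable_slackIntegrand hm.measurable hb)
    (integrable_slackIntegrand hm.measurable hb) fun s => ?_
  rcases le_or_gt s t with h | h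
  · have := hm h
    rw [slackIntegrand_of_le h, max_eq_right (by linarith)]
    exact slackIntegrand_nonneg s
  · rw [slackIntegrand_of_lt h, slackIntegrand_of_lt h]
    exact max_le_max_right _ (by linarith)

theorem monoSlack_anti_of_le (hm : Monotone θ) (hb : ∀ s, |θ s| ≤ R) {y' : ℝ} (h1 : y ≤ θ t)
    (h2 : y' ≤ y) : monoSlack R θ t y ≤ monoSlack R θ t y' := by
  refine integral_mono (integrable_slackIntegrand hm.measurable hb)
    (integrable_slackIntegrand hm.measurable hb) fun s => ?_
  rcases le_or_gt s t with h | h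
  · rw [slackIntegrand_of_le h, slackIntegrand_of_le h]
    exact max_le_max_right _ (by linarith)
  · have := hm h.le
    rw [slackIntegrand_of_lt h, max_eq_right (by linarith)]
    exact slackIntegrand_nonneg s

theorem monoSlack_pos_of_Ioo (hθ : Measurable θ) (hb : ∀ s, |θ s| ≤ R) {a b : ℝ} (ha : -R ≤ a)
    (hab : a < b) (hbR : b ≤ R) (h : ∀ s ∈ Set.Ioo a b, 0 < slackIntegrand θ t y s) :
    0 < monoSlack R θ t y := by
  rw [monoSlack, integral_pos_iff_support_of_nonneg slackIntegrand_nonneg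
    (integrable_slackIntegrand hθ hb)]
  have h1 : 0 < segMeasure R (Set.Ioo a b) := by
    rw [segMeasure, Measure.restrict_apply measurableSet_Ioo, Set.inter_eq_left.2]
    · simpa using hab
    · exact fun s hs => ⟨ha.trans hs.1.le, hs.2.le.trans hbR⟩
  exact h1.trans_le (measure_mono fun s hs => (h s hs).ne')

theorem monoSlack_pos_of_gt (hm : Monotone θ) (hb : ∀ s, |θ s| ≤ R) (ht : t ∈ Set.Ioo (-R) R)
    (hc : ContinuousAt θ t) (hy : θ t < y) : 0 < monoSlack R θ t y := by
  obtain ⟨a, b, hab, hsub⟩ := mem_nhds_iff_exists_Ioo_subset.1 (hc.eventually (gt_mem_nhds hy))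
  refine monoSlack_pos_of_Ioo hm.measurable hb ht.1.le (lt_min hab.2 ht.2) (min_le_right _ _)
    fun s hs => ?_
  rw [slackIntegrand_of_lt hs.1]
  have : θ s < y := hsub ⟨hab.1.trans hs.1, hs.2.trans_le (min_le_left _ _)⟩
  exact lt_max_of_lt_left (by linarith)

theorem monoSlack_pos_of_lt (hm : Monotone θ) (hb : ∀ s, |θ s| ≤ R) (ht : t ∈ Set.Ioo (-R) R)
    (hc : ContinuousAt θ t) (hy : y < θ t) : 0 < monoSlack R θ t y := by
  obtain ⟨a, b, hab, hsub⟩ := mem_nhds_iff_exists_Ioo_subset.1 (hc.eventually (lt_mem_nhds hy))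
  refine monoSlack_pos_of_Ioo hm.measurable hb (le_max_right a (-R)) (max_lt hab.1 ht.1) ht.2.le
    fun s hs => ?_
  rw [slackIntegrand_of_le hs.2.le]
  have : y < θ s := hsub ⟨(le_max_left _ _).trans_lt hs.1, hs.2.trans hab.2⟩
  exact lt_max_of_lt_left (by linarith)

/-- The least slack at distance at least `δ` from the graph of `θ`. -/
def slackGap (R : ℝ) (θ : ℝ → ℝ) (δ t : ℝ) : ℝ :=
  min (monoSlack R θ t (θ t + δ)) (monoSlack R θ t (θ t - δ))

theorem slackGap_le (hm : Monotone θ) (hb : ∀ s, |θ s| ≤ R) {δ : ℝ} (hδ : 0 < δ)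
    (hy : δ ≤ |y - θ t|) : slackGap R θ δ t ≤ monoSlack R θ t y := by
  rcases le_abs.1 hy with h | h
  · exact (min_le_left _ _).trans (monoSlack_mono_of_le hm hb (by linarith) (by linarith))
  · exact (min_le_right _ _).trans (monoSlack_anti_of_le hm hb (by linarith) (by linarith))

/-- At a continuity point of `θ` the slack is positive off the graph: near `t` the integrand is
positive on one side. -/
theorem slackGap_pos (hm : Monotone θ) (hb : ∀ s, |θ s| ≤ R) {δ : ℝ} (hδ : 0 < δ)
    (ht : t ∈ Set.Ioo (-R) R) (hc : ContinuousAt θ t) : 0 < slackGap R θ δ t :=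
  lt_min (monoSlack_pos_of_gt hm hb ht hc (by linarith))
    (monoSlack_pos_of_lt hm hb ht hc (by linarith))

theorem abs_monoConj_le (hR : 0 ≤ R) (hb : ∀ s, |θ s| ≤ R) (hy : |y| ≤ R) :
    |monoConj R θ y| ≤ 2 * R * (2 * R) := by
  have := norm_integral_le_of_norm_le_const (μ := segMeasure R) (f := fun s => max (y - θ s) 0)
    (C := 2 * R) (Eventually.of_forall fun s => by
      have h1 := abs_le.1 (hb s)
      have h2 := abs_le.1 hy
      rw [Real.norm_eq_abs, abs_of_nonneg (le_max_right _ _)]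
      exact max_le (by linarith) (by linarith))
  rwa [segMeasure_real_univ hR] at this

theorem abs_monoPrim_le (hR : 0 ≤ R) (hb : ∀ s, |θ s| ≤ R) : |monoPrim R θ t| ≤ R * (2 * R) := by
  have := norm_integral_le_of_norm_le_const (μ := segMeasure R) (f := (Set.Iic t).indicator θ)
    (C := R) (Eventually.of_forall fun s => by
      by_cases h : s ∈ Set.Iic t
      · rw [Set.indicator_of_mem h]; exact hb s
      · rw [Set.indicator_of_notMem h]; simpa using hR)
  rwa [segMeasure_real_univ hR] at this

theorem abs_monoSlack_le (hR : 0 ≤ R) (hb : ∀ s, |θ s| ≤ R) (hy : |y| ≤ R) :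
    |monoSlack R θ t y| ≤ 2 * R * (2 * R) := by
  have := norm_integral_le_of_norm_le_const (μ := segMeasure R) (f := slackIntegrand θ t y)
    (C := 2 * R) (Eventually.of_forall fun s => (abs_slackIntegrand_le hb s).trans (by linarith))
  rwa [segMeasure_real_univ hR] at this

/-- The conjugate depends on `θ` in a Lipschitz way, uniformly in `y`. -/
theorem abs_monoConj_sub_le {θ' : ℝ → ℝ} (hθ : Measurable θ) (hb : ∀ s, |θ s| ≤ R)
    (hθ' : Measurable θ') (hb' : ∀ s, |θ' s| ≤ R) :
    |monoConj R θ y - monoConj R θ' y| ≤ ∫ s, |θ s - θ' s| ∂segMeasure R := by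
  have i : ∀ {θ : ℝ → ℝ}, Measurable θ → (∀ s, |θ s| ≤ R) →
      Integrable (fun s => max (y - θ s) 0) (segMeasure R) := fun {θ} hθ hb =>
    integrable_of_abs_le ((measurable_const.sub hθ).max measurable_const) (M := |y| + R) fun s => by
      have h1 := abs_le.1 (hb s)
      have h3 := le_abs_self y
      have h4 := abs_nonneg y
      rw [abs_of_nonneg (le_max_right _ _)]
      exact max_le (by linarith) (by linarith)
  rw [monoConj, monoConj, ← integral_sub (i hθ hb) (i hθ' hb')]
  refine abs_integral_le_integral_abs.trans (integral_mono ((i hθ hb).sub (i hθ' hb')).abs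
    ((integrable_of_abs_le hθ hb).sub (integrable_of_abs_le hθ' hb')).abs fun s => ?_)
  refine (abs_max_sub_max_le_abs _ _ _).trans (le_of_eq ?_)
  rw [← abs_neg]
  congr 1
  ring

end

section

variable {P : Type*} [MeasurableSpace P] {R : ℝ} {θ : P → ℝ → ℝ}

theorem measurable_monoSlack (hθ : Measurable fun q : P × ℝ => θ q.1 q.2) :
    Measurable fun q : (P × ℝ) × ℝ => monoSlack R (θ q.1.1) q.1.2 q.2 := by
  have h : Measurable fun q : ((P × ℝ) × ℝ) × ℝ =>
      slackIntegrand (θ q.1.1.1) q.1.1.2 q.1.2 q.2 := by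
    have h1 : Measurable fun q : ((P × ℝ) × ℝ) × ℝ => q.1.2 - θ q.1.1.1 q.2 :=
      (measurable_snd.comp measurable_fst).sub (hθ.comp
        ((measurable_fst.comp (measurable_fst.comp measurable_fst)).prodMk measurable_snd))
    have h2 : MeasurableSet {q : ((P × ℝ) × ℝ) × ℝ | q.2 ≤ q.1.1.2} :=
      measurableSet_le measurable_snd (measurable_snd.comp (measurable_fst.comp measurable_fst))
    exact (h1.max measurable_const).sub (h1.indicator h2)
  exact (h.stronglyMeasurable.integral_prod_right' (ν := segMeasure R)).measurable

theorem measurable_monoConj (hθ : Measurable fun q : P × ℝ => θ q.1 q.2) :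
    Measurable fun q : P × ℝ => monoConj R (θ q.1) q.2 := by
  have h : Measurable fun q : (P × ℝ) × ℝ => max (q.1.2 - θ q.1.1 q.2) 0 :=
    ((measurable_snd.comp measurable_fst).sub (hθ.comp
      ((measurable_fst.comp measurable_fst).prodMk measurable_snd))).max measurable_const
  exact (h.stronglyMeasurable.integral_prod_right' (ν := segMeasure R)).measurable

theorem measurable_monoPrim (hθ : Measurable fun q : P × ℝ => θ q.1 q.2) :
    Measurable fun q : P × ℝ => monoPrim R (θ q.1) q.2 := by
  have h : Measurable fun q : (P × ℝ) × ℝ => (Set.Iic q.1.2).indicator (θ q.1.1) q.2 := by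
    have h1 : Measurable fun q : (P × ℝ) × ℝ => θ q.1.1 q.2 :=
      hθ.comp ((measurable_fst.comp measurable_fst).prodMk measurable_snd)
    have h2 : MeasurableSet {q : (P × ℝ) × ℝ | q.2 ≤ q.1.2} :=
      measurableSet_le measurable_snd (measurable_snd.comp measurable_fst)
    exact h1.indicator h2
  exact (h.stronglyMeasurable.integral_prod_right' (ν := segMeasure R)).measurable

theorem measurable_slackGap (hθ : Measurable fun q : P × ℝ => θ q.1 q.2) (δ : ℝ) :
    Measurable fun q : P × ℝ => slackGap R (θ q.1) δ q.2 :=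
  ((measurable_monoSlack hθ).comp (measurable_id.prodMk (hθ.add_const δ))).min
    ((measurable_monoSlack hθ).comp (measurable_id.prodMk (hθ.sub_const δ)))

end

/-- The gap of the Knothe-Rosenblatt slices is almost surely positive: the conditional laws of `μ`
have no atoms, and a monotone function has countably many discontinuities. -/
theorem ae_slackGap_pos {d : ℕ} {R : ℝ} {μ N : ProbabilityMeasure (Fin d → ℝ)} (hR : 0 ≤ R)
    (hμ : IsCubeAC R μ) (i : Fin d) {δ : ℝ} (hδ : 0 < δ) :
    ∀ᵐ q ∂(μ : Measure (Fin d → ℝ)).map (fun x => (prevCoords i x, x i)),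
      0 < slackGap R (krSlice R μ N i q.1) δ q.2 := by
  rw [← compProd_condCoord, Measure.ae_compProd_iff (measurableSet_lt measurable_const
    (measurable_slackGap (measurable_krSlice hR i) δ))]
  filter_upwards [condCoord_mem_Icc hR hμ i, condCoord_singleton hμ i] with p h1 h2
  have hnull : ∀ s : Set ℝ, s.Countable → ∀ᵐ t ∂condCoord μ i p, t ∉ s := fun s hs => by
    refine measure_mono_null (t := ⋃ t ∈ s, {t}) (fun t ht => ?_)
      ((measure_biUnion_null_iff hs).2 fun t _ => h2 t)
    simpa using ht
  filter_upwards [h1, hnull _ (krSlice_mono (μ := μ) (N := N) hR i p).countable_not_continuousAt,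
    hnull {-R, R} (by simp)] with t ht1 ht2 ht3
  simp only [Set.mem_insert_iff, Set.mem_singleton_iff, not_or] at ht3
  exact slackGap_pos (krSlice_mono hR i p) (fun s => abs_le.2 (krSlice_mem hR i p s)) hδ
    ⟨lt_of_le_of_ne ht1.1 (Ne.symm ht3.1), lt_of_le_of_ne ht1.2 ht3.2⟩ (by simpa using ht2)

/-! ### Competitors that agree with a plan in the first coordinates -/

/-- `γ` has first marginal `μ` and its second marginal has finite entropy relative to `N`. -/
structure IsFinitePlan {d : ℕ} (μ N : ProbabilityMeasure (Fin d → ℝ))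
    (γ : ProbabilityMeasure ((Fin d → ℝ) × (Fin d → ℝ))) : Prop where
  fst : HasFirstMarginal μ γ
  kl : InformationTheory.klDiv ((γ : Measure ((Fin d → ℝ) × (Fin d → ℝ))).map Prod.snd)
    (N : Measure (Fin d → ℝ)) ≠ ⊤

theorem integral_comp_fst_prod {X Y : Type*} [MeasurableSpace X] [MeasurableSpace Y]
    {α : Measure X} {β : Measure Y} [SFinite α] [IsProbabilityMeasure β] {f : X → ℝ}
    (hf : Measurable f) : ∫ q, f q.1 ∂(α.prod β) = ∫ x, f x ∂α := by
  have h : (α.prod β).map Prod.fst = α := by simp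
  conv_rhs => rw [← h]
  exact (integral_map measurable_fst.aemeasurable hf.aestronglyMeasurable).symm

section

variable {d : ℕ} {R : ℝ} {μ N : ProbabilityMeasure (Fin d → ℝ)}
  {γ : ProbabilityMeasure ((Fin d → ℝ) × (Fin d → ℝ))}

instance (γ : ProbabilityMeasure ((Fin d → ℝ) × (Fin d → ℝ))) : IsProbabilityMeasure
    ((γ : Measure ((Fin d → ℝ) × (Fin d → ℝ))).map Prod.snd) :=
  Measure.isProbabilityMeasure_map measurable_snd.aemeasurable

theorem IsFinitePlan.ac (h : IsFinitePlan μ N γ) :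
    (γ : Measure ((Fin d → ℝ) × (Fin d → ℝ))).map Prod.snd ≪ (N : Measure (Fin d → ℝ)) :=
  (InformationTheory.klDiv_ne_top_iff.1 h.kl).1

theorem IsFinitePlan.ae_fst (h : IsFinitePlan μ N γ) {p : (Fin d → ℝ) → Prop}
    (hp : ∀ᵐ x ∂(μ : Measure (Fin d → ℝ)), p x) :
    ∀ᵐ q ∂(γ : Measure ((Fin d → ℝ) × (Fin d → ℝ))), p q.1 := by
  have := h.fst
  unfold HasFirstMarginal at this
  rw [← this] at hp
  exact ae_of_ae_map measurable_fst.aemeasurable hp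

theorem IsFinitePlan.ae_snd (h : IsFinitePlan μ N γ) {p : (Fin d → ℝ) → Prop}
    (hp : ∀ᵐ x ∂(N : Measure (Fin d → ℝ)), p x) :
    ∀ᵐ q ∂(γ : Measure ((Fin d → ℝ) × (Fin d → ℝ))), p q.2 :=
  ae_of_ae_map measurable_snd.aemeasurable (h.ac.ae_le hp)

theorem IsFinitePlan.ae_mem (h : IsFinitePlan μ N γ) (hR : 0 ≤ R) (hμ : IsCubeAC R μ)
    (hN : IsCubeAC R N) : ∀ᵐ q ∂(γ : Measure ((Fin d → ℝ) × (Fin d → ℝ))),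
      (∀ i, |q.1 i| ≤ R) ∧ ∀ i, |q.2 i| ≤ R := by
  filter_upwards [h.ae_fst hμ.mem, h.ae_snd hN.mem] with q h1 h2
  exact ⟨(mem_cube_iff hR).1 h1, (mem_cube_iff hR).1 h2⟩

theorem IsFinitePlan.integral_fst (h : IsFinitePlan μ N γ) {f : (Fin d → ℝ) → ℝ}
    (hf : Measurable f) : ∫ q, f q.1 ∂(γ : Measure ((Fin d → ℝ) × (Fin d → ℝ))) =
      ∫ x, f x ∂(μ : Measure (Fin d → ℝ)) := by
  have := h.fst
  unfold HasFirstMarginal at this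
  rw [← this]
  exact (integral_map measurable_fst.aemeasurable hf.aestronglyMeasurable).symm

theorem measurable_fst_coord (i : Fin d) :
    Measurable fun q : (Fin d → ℝ) × (Fin d → ℝ) => q.1 i :=
  (measurable_coord i).comp measurable_fst

theorem measurable_snd_coord (i : Fin d) :
    Measurable fun q : (Fin d → ℝ) × (Fin d → ℝ) => q.2 i :=
  (measurable_coord i).comp measurable_snd

theorem measurable_sq_sub (i : Fin d) :
    Measurable fun q : (Fin d → ℝ) × (Fin d → ℝ) => (q.1 i - q.2 i) ^ 2 :=
  ((measurable_fst_coord i).sub (measurable_snd_coord i)).pow_const 2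

theorem sq_sub_le_of_abs_le {x y : ℝ} (hx : |x| ≤ R) (hy : |y| ≤ R) :
    (x - y) ^ 2 ≤ (2 * R) ^ 2 := by
  have h1 := abs_le.1 hx
  have h2 := abs_le.1 hy
  exact sq_le_sq' (by linarith) (by linarith)

theorem IsFinitePlan.integrable_sq_sub (h : IsFinitePlan μ N γ) (hR : 0 ≤ R) (hμ : IsCubeAC R μ)
    (hN : IsCubeAC R N) (i : Fin d) : Integrable (fun q => (q.1 i - q.2 i) ^ 2)
      (γ : Measure ((Fin d → ℝ) × (Fin d → ℝ))) := by
  refine integrable_of_ae_abs_le (measurable_sq_sub i) (M := (2 * R) ^ 2) ?_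
  filter_upwards [h.ae_mem hR hμ hN] with q hq
  rw [abs_of_nonneg (sq_nonneg _)]
  exact sq_sub_le_of_abs_le (hq.1 i) (hq.2 i)

theorem IsFinitePlan.integral_sq_sub_le (h : IsFinitePlan μ N γ) (hR : 0 ≤ R) (hμ : IsCubeAC R μ)
    (hN : IsCubeAC R N) (i : Fin d) :
    ∫ q, (q.1 i - q.2 i) ^ 2 ∂(γ : Measure ((Fin d → ℝ) × (Fin d → ℝ))) ≤ (2 * R) ^ 2 := by
  calc _ ≤ ∫ q, (2 * R) ^ 2 ∂(γ : Measure ((Fin d → ℝ) × (Fin d → ℝ))) := by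
        refine integral_mono_ae (h.integrable_sq_sub hR hμ hN i) (integrable_const _) ?_
        filter_upwards [h.ae_mem hR hμ hN] with q hq
        exact sq_sub_le_of_abs_le (hq.1 i) (hq.2 i)
    _ = _ := by simp

theorem IsFinitePlan.integrable_mul (h : IsFinitePlan μ N γ) (hR : 0 ≤ R) (hμ : IsCubeAC R μ)
    (hN : IsCubeAC R N) (i : Fin d) : Integrable (fun q => q.1 i * q.2 i)
      (γ : Measure ((Fin d → ℝ) × (Fin d → ℝ))) := by
  refine integrable_of_ae_abs_le ((measurable_fst_coord i).mul (measurable_snd_coord i))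
    (M := R * R) ?_
  filter_upwards [h.ae_mem hR hμ hN] with q hq
  rw [abs_mul]
  exact mul_le_mul (hq.1 i) (hq.2 i) (abs_nonneg _) hR

theorem IsFinitePlan.integral_sq_sub (h : IsFinitePlan μ N γ) (hR : 0 ≤ R) (hμ : IsCubeAC R μ)
    (hN : IsCubeAC R N) (i : Fin d) :
    ∫ q, (q.1 i - q.2 i) ^ 2 ∂(γ : Measure ((Fin d → ℝ) × (Fin d → ℝ))) =
      ∫ x, x i ^ 2 ∂(μ : Measure (Fin d → ℝ)) +
        ∫ q, q.2 i ^ 2 ∂(γ : Measure ((Fin d → ℝ) × (Fin d → ℝ))) -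
        2 * ∫ q, q.1 i * q.2 i ∂(γ : Measure ((Fin d → ℝ) × (Fin d → ℝ))) := by
  have hsq : ∀ t : ℝ, |t| ≤ R → |t ^ 2| ≤ R ^ 2 := fun t ht => by
    rw [abs_pow]; exact pow_le_pow_left₀ (abs_nonneg _) ht 2
  have i1 : Integrable (fun q => q.1 i ^ 2) (γ : Measure ((Fin d → ℝ) × (Fin d → ℝ))) := by
    refine integrable_of_ae_abs_le ((measurable_fst_coord i).pow_const 2) (M := R ^ 2) ?_
    filter_upwards [h.ae_mem hR hμ hN] with q hq using hsq _ (hq.1 i)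
  have i2 : Integrable (fun q => q.2 i ^ 2) (γ : Measure ((Fin d → ℝ) × (Fin d → ℝ))) := by
    refine integrable_of_ae_abs_le ((measurable_snd_coord i).pow_const 2) (M := R ^ 2) ?_
    filter_upwards [h.ae_mem hR hμ hN] with q hq using hsq _ (hq.2 i)
  have i3 := (h.integrable_mul hR hμ hN i).const_mul 2
  rw [← h.integral_fst ((measurable_coord i).pow_const 2), ← integral_const_mul,
    ← integral_add i1 i2, ← integral_sub (i1.fun_add i2) i3]
  refine integral_congr_ae (Eventually.of_forall fun q => ?_)
  simp only
  ring

theorem IsFinitePlan.integral_weightedCost_add (h : IsFinitePlan μ N γ) (hR : 0 ≤ R)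
    (hμ : IsCubeAC R μ) (hN : IsCubeAC R N) (ε : ℝ) {b : (Fin d → ℝ) → ℝ}
    (hb : Measurable b) {B : ℝ}
    (hbB : ∀ y, |b y| ≤ B) :
    ∫ q, (weightedCost ε q.1 q.2 + b q.2) ∂(γ : Measure ((Fin d → ℝ) × (Fin d → ℝ))) =
      ∑ i : Fin d, ε ^ (i : ℕ) *
        ∫ q, (q.1 i - q.2 i) ^ 2 ∂(γ : Measure ((Fin d → ℝ) × (Fin d → ℝ))) +
      ∫ q, b q.2 ∂(γ : Measure ((Fin d → ℝ) × (Fin d → ℝ))) := by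
  have hi : ∀ i ∈ (Finset.univ : Finset (Fin d)), Integrable
      (fun q => ε ^ (i : ℕ) * (q.1 i - q.2 i) ^ 2)
      (γ : Measure ((Fin d → ℝ) × (Fin d → ℝ))) := fun i _ =>
    (h.integrable_sq_sub hR hμ hN i).const_mul _
  have ib : Integrable (fun q => b q.2) (γ : Measure ((Fin d → ℝ) × (Fin d → ℝ))) :=
    integrable_of_abs_le (hb.comp measurable_snd) fun q => hbB _
  unfold weightedCost
  rw [integral_add (integrable_finsetSum _ hi) ib, integral_finsetSum _ hi]
  simp_rw [integral_const_mul]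

/-- The competitor that keeps the first `k` coordinates of the plan `γ` and samples the others by
the conditional monotone couplings of `μ` and `N`. -/
def compPlan (R : ℝ) (hR : 0 ≤ R) (μ N : ProbabilityMeasure (Fin d → ℝ)) (k : ℕ)
    (γ : ProbabilityMeasure ((Fin d → ℝ) × (Fin d → ℝ))) :
    ProbabilityMeasure ((Fin d → ℝ) × (Fin d → ℝ)) :=
  ⟨((γ : Measure ((Fin d → ℝ) × (Fin d → ℝ))).prod (unifCube d)).map fun q =>
      (resample R μ k q.1.1 q.2, resample R N k q.1.2 q.2),
    Measure.isProbabilityMeasure_map (((measurable_resample hR).comp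
      ((measurable_fst.comp measurable_fst).prodMk measurable_snd)).prodMk
      ((measurable_resample hR).comp
        ((measurable_snd.comp measurable_fst).prodMk measurable_snd))).aemeasurable⟩

theorem measurable_compPlan_map (hR : 0 ≤ R) (k : ℕ) :
    Measurable fun q : ((Fin d → ℝ) × (Fin d → ℝ)) × (Fin d → ℝ) =>
      (resample R μ k q.1.1 q.2, resample R N k q.1.2 q.2) :=
  ((measurable_resample hR).comp
      ((measurable_fst.comp measurable_fst).prodMk measurable_snd)).prodMk
      ((measurable_resample hR).comp
        ((measurable_snd.comp measurable_fst).prodMk measurable_snd))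

theorem integral_compPlan (hR : 0 ≤ R) (k : ℕ) {f : (Fin d → ℝ) × (Fin d → ℝ) → ℝ}
    (hf : Measurable f) :
    ∫ q, f q ∂(compPlan R hR μ N k γ : Measure ((Fin d → ℝ) × (Fin d → ℝ))) =
      ∫ q, f (resample R μ k q.1.1 q.2, resample R N k q.1.2 q.2)
        ∂((γ : Measure ((Fin d → ℝ) × (Fin d → ℝ))).prod (unifCube d)) :=
  integral_map (measurable_compPlan_map hR k).aemeasurable hf.aestronglyMeasurable

theorem map_snd_compPlan (hR : 0 ≤ R) (k : ℕ) :
    (compPlan R hR μ N k γ : Measure ((Fin d → ℝ) × (Fin d → ℝ))).map Prod.snd =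
      (((γ : Measure ((Fin d → ℝ) × (Fin d → ℝ))).map Prod.snd).prod (unifCube d)).map
        fun q => resample R N k q.1 q.2 := by
  have e : ((γ : Measure ((Fin d → ℝ) × (Fin d → ℝ))).map Prod.snd).prod (unifCube d) =
      ((γ : Measure ((Fin d → ℝ) × (Fin d → ℝ))).prod (unifCube d)).map (Prod.map Prod.snd id) := by
    rw [← Measure.map_prod_map _ _ measurable_snd measurable_id, Measure.map_id]
  rw [e, Measure.map_map (measurable_resample hR) (measurable_snd.prodMap measurable_id)]
  exact Measure.map_map measurable_snd (measurable_compPlan_map hR k)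

theorem map_resample_self (hR : 0 ≤ R) (hN : IsCubeAC R N) (k : ℕ) :
    ((N : Measure (Fin d → ℝ)).prod (unifCube d)).map (fun q => resample R N k q.1 q.2) = N :=
  map_resample hR hN measurable_id rfl

theorem hasFirstMarginal_compPlan (hR : 0 ≤ R) (hμ : IsCubeAC R μ) (k : ℕ)
    (h : HasFirstMarginal μ γ) : HasFirstMarginal μ (compPlan R hR μ N k γ) := by
  have e : (compPlan R hR μ N k γ : Measure ((Fin d → ℝ) × (Fin d → ℝ))).map Prod.fst =
      ((γ : Measure ((Fin d → ℝ) × (Fin d → ℝ))).prod (unifCube d)).map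
        fun q => resample R μ k q.1.1 q.2 :=
    Measure.map_map measurable_fst (measurable_compPlan_map hR k)
  unfold HasFirstMarginal at h ⊢
  rw [e]
  refine map_resample hR hμ measurable_fst ?_
  rw [← h, Measure.map_map (measurable_truncCoords k) measurable_fst]
  rfl

/-- Passing to the competitor does not increase the entropy of the second marginal. -/
theorem klDiv_compPlan_le (hR : 0 ≤ R) (hN : IsCubeAC R N) (k : ℕ) :
    InformationTheory.klDiv
      ((compPlan R hR μ N k γ : Measure ((Fin d → ℝ) × (Fin d → ℝ))).map Prod.snd)
        (N : Measure (Fin d → ℝ)) ≤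
      InformationTheory.klDiv ((γ : Measure ((Fin d → ℝ) × (Fin d → ℝ))).map Prod.snd)
        (N : Measure (Fin d → ℝ)) := by
  rw [map_snd_compPlan]
  conv_lhs => rw [← map_resample_self hR hN k]
  refine (InformationTheory.klDiv_map_le _ _ (measurable_resample hR)).trans ?_
  rw [← Measure.compProd_const, ← Measure.compProd_const, InformationTheory.klDiv_compProd_left]

theorem IsFinitePlan.compPlan (h : IsFinitePlan μ N γ) (hR : 0 ≤ R) (hμ : IsCubeAC R μ)
    (hN : IsCubeAC R N) (k : ℕ) : IsFinitePlan μ N (compPlan R hR μ N k γ) :=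
  ⟨hasFirstMarginal_compPlan hR hμ k h.fst, ne_top_of_le_ne_top h.kl (klDiv_compPlan_le hR hN k)⟩

/-! ### Asymptotics of minimizers -/

/-- The objective with relative entropy taken with respect to `N` and an additional potential `b`
on the target. -/
def tiltedEnergy (ε lam : ℝ) (N : ProbabilityMeasure (Fin d → ℝ)) (b : (Fin d → ℝ) → ℝ)
    (γ : ProbabilityMeasure ((Fin d → ℝ) × (Fin d → ℝ))) : ℝ :=
  lam * (InformationTheory.klDiv ((γ : Measure ((Fin d → ℝ) × (Fin d → ℝ))).map Prod.snd)
    (N : Measure (Fin d → ℝ))).toReal +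
  ∫ q, (weightedCost ε q.1 q.2 + b q.2) ∂(γ : Measure ((Fin d → ℝ) × (Fin d → ℝ)))

/-- Minimizers `γ ε` of the tilted objectives, in a situation where the Knothe-Rosenblatt plan
minimizes the objective for `ε = 0`. -/
structure IsMinimizingFamily [NeZero d] (R lam : ℝ) (μ N : ProbabilityMeasure (Fin d → ℝ))
    (b : ℝ → ℝ) (γ : ℝ → ProbabilityMeasure ((Fin d → ℝ) × (Fin d → ℝ))) : Prop where
  R_nonneg : 0 ≤ R
  lam_pos : 0 < lam
  source : IsCubeAC R μ
  target : IsCubeAC R N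
  measurable_b : Measurable b
  bdd_b : ∃ B, ∀ t, |b t| ≤ B
  plan : ∀ ε > 0, IsFinitePlan μ N (γ ε)
  optimal : ∀ ε > 0, ∀ γ', IsFinitePlan μ N γ' →
    tiltedEnergy ε lam N (fun y => b (y 0)) (γ ε) ≤ tiltedEnergy ε lam N (fun y => b (y 0)) γ'
  optimal_zero : ∀ γ', IsFinitePlan μ N γ' →
    ∫ x, ((x 0 - krMap R μ N x 0) ^ 2 + b (krMap R μ N x 0)) ∂(μ : Measure (Fin d → ℝ)) ≤
      ∫ q, ((q.1 0 - q.2 0) ^ 2 + b (q.2 0)) ∂(γ' : Measure ((Fin d → ℝ) × (Fin d → ℝ)))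

/-- The plan induced by the Knothe-Rosenblatt map. -/
def krPlan (R : ℝ) (hR : 0 ≤ R) (μ N : ProbabilityMeasure (Fin d → ℝ)) :
    ProbabilityMeasure ((Fin d → ℝ) × (Fin d → ℝ)) :=
  ⟨(μ : Measure (Fin d → ℝ)).map fun x => (x, krMap R μ N x),
    Measure.isProbabilityMeasure_map (measurable_id.prodMk (measurable_krMap hR)).aemeasurable⟩

theorem integral_krPlan (hR : 0 ≤ R) {f : (Fin d → ℝ) × (Fin d → ℝ) → ℝ} (hf : Measurable f) :
    ∫ q, f q ∂(krPlan R hR μ N : Measure ((Fin d → ℝ) × (Fin d → ℝ))) =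
      ∫ x, f (x, krMap R μ N x) ∂(μ : Measure (Fin d → ℝ)) :=
  integral_map (measurable_id.prodMk (measurable_krMap hR)).aemeasurable hf.aestronglyMeasurable

theorem map_snd_krPlan (hR : 0 ≤ R) (hμ : IsCubeAC R μ) (hN : IsCubeAC R N) :
    (krPlan R hR μ N : Measure ((Fin d → ℝ) × (Fin d → ℝ))).map Prod.snd = N := by
  have : (krPlan R hR μ N : Measure ((Fin d → ℝ) × (Fin d → ℝ))).map Prod.snd =
      (μ : Measure (Fin d → ℝ)).map (krMap R μ N) :=
    Measure.map_map measurable_snd (measurable_id.prodMk (measurable_krMap hR))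
  rw [this, map_krMap hR hμ hN]

theorem klDiv_krPlan (hR : 0 ≤ R) (hμ : IsCubeAC R μ) (hN : IsCubeAC R N) :
    InformationTheory.klDiv
      ((krPlan R hR μ N : Measure ((Fin d → ℝ) × (Fin d → ℝ))).map Prod.snd)
      (N : Measure (Fin d → ℝ)) = 0 := by
  rw [map_snd_krPlan hR hμ hN, InformationTheory.klDiv_self]

theorem isFinitePlan_krPlan (hR : 0 ≤ R) (hμ : IsCubeAC R μ) (hN : IsCubeAC R N) :
    IsFinitePlan μ N (krPlan R hR μ N) where
  fst := by
    have : (krPlan R hR μ N : Measure ((Fin d → ℝ) × (Fin d → ℝ))).map Prod.fst =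
        (μ : Measure (Fin d → ℝ)).map id :=
      Measure.map_map measurable_fst (measurable_id.prodMk (measurable_krMap hR))
    rw [HasFirstMarginal, this, Measure.map_id]
  kl := by rw [klDiv_krPlan hR hμ hN]; simp

theorem sum_split (k : Fin d) (f : Fin d → ℝ) :
    ∑ i, f i = ∑ i ∈ Finset.univ.filter (fun i : Fin d => (i : ℕ) < k), f i + f k +
      ∑ i ∈ Finset.univ.filter (fun i : Fin d => (k : ℕ) < i), f i := by
  rw [← Finset.sum_filter_add_sum_filter_not Finset.univ (fun i : Fin d => (i : ℕ) < k)]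
  rw [add_assoc]
  congr 1
  rw [← Finset.sum_filter_add_sum_filter_not (Finset.univ.filter fun i : Fin d => ¬ (i : ℕ) < k)
    (fun i : Fin d => i = k)]
  congr 1
  · rw [Finset.filter_filter, Finset.sum_eq_single k]
    · intro j hj hjk
      exact absurd (Finset.mem_filter.1 hj).2.2 hjk
    · intro hk
      exact absurd (Finset.mem_filter.2 ⟨Finset.mem_univ k, by simp, rfl⟩) hk
  · rw [Finset.filter_filter]
    refine Finset.sum_congr ?_ fun _ _ => rfl
    ext i
    simp only [Finset.mem_filter, Finset.mem_univ, true_and, Fin.ext_iff]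
    omega

namespace IsMinimizingFamily

variable [NeZero d] {lam : ℝ} {b : ℝ → ℝ}
  {γ : ℝ → ProbabilityMeasure ((Fin d → ℝ) × (Fin d → ℝ))}

theorem eventually_small : ∀ᶠ ε : ℝ in 𝓝[>] 0, 0 < ε ∧ ε ≤ 1 := by
  filter_upwards [Ioc_mem_nhdsGT (show (0 : ℝ) < 1 by norm_num)] with ε hε using hε

/-- The coordinates after the `k`-th contribute to the cost at an order higher than `ε^k`. -/
theorem sum_gt_le {ε : ℝ} (h0 : 0 < ε) (h1 : ε ≤ 1) {k : ℕ} {a : Fin d → ℝ} {M : ℝ}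
    (ha0 : ∀ i, 0 ≤ a i) (ha : ∀ i, a i ≤ M) :
    ∑ i ∈ Finset.univ.filter (fun i : Fin d => k < (i : ℕ)), ε ^ (i : ℕ) * a i ≤
      ε ^ k * (ε * (d * M)) := by
  have hM : 0 ≤ M := (ha0 0).trans (ha 0)
  calc ∑ i ∈ Finset.univ.filter (fun i : Fin d => k < (i : ℕ)), ε ^ (i : ℕ) * a i
      ≤ ∑ i ∈ Finset.univ.filter (fun i : Fin d => k < (i : ℕ)), ε ^ (k + 1) * M := by
        refine Finset.sum_le_sum fun i hi => ?_
        have hi' : k + 1 ≤ (i : ℕ) := (Finset.mem_filter.1 hi).2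
        exact mul_le_mul (pow_le_pow_of_le_one h0.le h1 hi') (ha i) (ha0 i) (by positivity)
    _ ≤ ∑ i : Fin d, ε ^ (k + 1) * M := Finset.sum_le_sum_of_subset_of_nonneg
        (Finset.filter_subset _ _) fun _ _ _ => by positivity
    _ = ε ^ k * (ε * (d * M)) := by
        rw [Finset.sum_const, Finset.card_univ, Fintype.card_fin, nsmul_eq_mul]
        ring

theorem measurable_b0 (h : IsMinimizingFamily R lam μ N b γ) :
    Measurable fun y : Fin d → ℝ => b (y 0) := h.measurable_b.comp (measurable_coord 0)

/-- Comparison with the Knothe-Rosenblatt plan: the second marginals converge to `N` in relative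
entropy. -/
theorem tendsto_klDiv (h : IsMinimizingFamily R lam μ N b γ) :
    Tendsto (fun ε => (InformationTheory.klDiv
      ((γ ε : Measure ((Fin d → ℝ) × (Fin d → ℝ))).map Prod.snd)
      (N : Measure (Fin d → ℝ))).toReal) (𝓝[>] 0) (𝓝 0) := by
  obtain ⟨B, hB⟩ := h.bdd_b
  have hK := isFinitePlan_krPlan h.R_nonneg h.source h.target
  have hlim : Tendsto (fun ε : ℝ => ε * (d * (2 * R) ^ 2) / lam) (𝓝[>] 0) (𝓝 0) := by
    have : Tendsto (fun ε : ℝ => ε * (d * (2 * R) ^ 2) / lam) (𝓝 0)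
        (𝓝 (0 * (d * (2 * R) ^ 2) / lam)) :=
      (tendsto_id.mul_const _).div_const _
    rw [zero_mul, zero_div] at this
    exact this.mono_left nhdsWithin_le_nhds
  refine squeeze_zero' (Eventually.of_forall fun ε => ENNReal.toReal_nonneg) ?_ hlim
  filter_upwards [eventually_small] with ε hε
  have hP := h.plan ε hε.1
  have h1 := h.optimal ε hε.1 _ hK
  unfold tiltedEnergy at h1
  rw [klDiv_krPlan h.R_nonneg h.source h.target, ENNReal.toReal_zero, mul_zero, zero_add,
    hP.integral_weightedCost_add h.R_nonneg h.source h.target ε h.measurable_b0 (fun y => hB _),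
    hK.integral_weightedCost_add h.R_nonneg h.source h.target ε h.measurable_b0 (fun y => hB _),
    sum_split 0, sum_split 0 (fun i : Fin d => ε ^ (i : ℕ) * ∫ q, (q.1 i - q.2 i) ^ 2
      ∂(krPlan R h.R_nonneg μ N : Measure ((Fin d → ℝ) × (Fin d → ℝ))))] at h1
  have hlow : ∀ f : Fin d → ℝ,
      ∑ i ∈ Finset.univ.filter (fun i : Fin d => (i : ℕ) < ((0 : Fin d) : ℕ)), f i = 0 := by
    intro f; simp
  have hpow : ε ^ ((0 : Fin d) : ℕ) = 1 := by simp
  rw [hlow, hlow, hpow, zero_add, zero_add, one_mul, one_mul] at h1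
  have h2 := h.optimal_zero _ hP
  have ib : ∀ γ' : ProbabilityMeasure ((Fin d → ℝ) × (Fin d → ℝ)),
      Integrable (fun q => b (q.2 0)) (γ' : Measure ((Fin d → ℝ) × (Fin d → ℝ))) := fun γ' =>
    integrable_of_abs_le (h.measurable_b0.comp measurable_snd) fun q => hB _
  have e2 := integral_krPlan (μ := μ) (N := N) h.R_nonneg
    (f := fun q => (q.1 0 - q.2 0) ^ 2 + b (q.2 0))
    ((measurable_sq_sub 0).add (h.measurable_b0.comp measurable_snd))
  simp only at e2
  rw [← e2, integral_add (hK.integrable_sq_sub h.R_nonneg h.source h.target 0) (ib _),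
    integral_add (hP.integrable_sq_sub h.R_nonneg h.source h.target 0) (ib _)] at h2
  have h3 := sum_gt_le (d := d) hε.1 hε.2 (k := ((0 : Fin d) : ℕ)) (M := (2 * R) ^ 2)
    (a := fun i => ∫ q, (q.1 i - q.2 i) ^ 2
      ∂(krPlan R h.R_nonneg μ N : Measure ((Fin d → ℝ) × (Fin d → ℝ))))
    (fun i => integral_nonneg fun q => sq_nonneg _)
    (fun i => hK.integral_sq_sub_le h.R_nonneg h.source h.target i)
  have h4 : 0 ≤ ∑ i ∈ Finset.univ.filter (fun i : Fin d => ((0 : Fin d) : ℕ) < (i : ℕ)),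
      ε ^ (i : ℕ) * ∫ q, (q.1 i - q.2 i) ^ 2 ∂(γ ε : Measure ((Fin d → ℝ) × (Fin d → ℝ))) :=
    Finset.sum_nonneg fun i _ => mul_nonneg (pow_nonneg hε.1.le _)
      (integral_nonneg fun q => sq_nonneg _)
  rw [hpow, one_mul] at h3
  rw [le_div_iff₀ h.lam_pos, mul_comm]
  linarith

theorem bddTendsto_snd (h : IsMinimizingFamily R lam μ N b γ) :
    BddTendsto (𝓝[>] 0) (fun ε => (γ ε : Measure ((Fin d → ℝ) × (Fin d → ℝ))).map Prod.snd)
      (N : Measure (Fin d → ℝ)) := by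
  refine bddTendsto_of_klDiv ?_ h.tendsto_klDiv
  filter_upwards [eventually_small] with ε hε using (h.plan ε hε.1).kl

theorem bddTendsto_snd_compPlan (h : IsMinimizingFamily R lam μ N b γ) (k : ℕ) :
    BddTendsto (𝓝[>] 0) (fun ε => (compPlan R h.R_nonneg μ N k (γ ε) :
      Measure ((Fin d → ℝ) × (Fin d → ℝ))).map Prod.snd) (N : Measure (Fin d → ℝ)) := by
  have := (h.bddTendsto_snd.prod (unifCube d)).map (measurable_resample (μ := N) (k := k)
    h.R_nonneg)
  rw [map_resample_self h.R_nonneg h.target] at this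
  simpa only [map_snd_compPlan] using this

theorem tendsto_integral_snd (h : IsMinimizingFamily R lam μ N b γ) {f : (Fin d → ℝ) → ℝ}
    (hf : Measurable f) {M : ℝ} (hM : ∀ y, (∀ i, |y i| ≤ R) → |f y| ≤ M) :
    Tendsto (fun ε => ∫ q, f q.2 ∂(γ ε : Measure ((Fin d → ℝ) × (Fin d → ℝ)))) (𝓝[>] 0)
      (𝓝 (∫ y, f y ∂(N : Measure (Fin d → ℝ)))) := by
  have h1 := h.bddTendsto_snd.tendsto_integral_of_ae
    (s := Metric.closedBall (0 : Fin d → ℝ) R) Metric.isClosed_closedBall.measurableSet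
    (by filter_upwards [eventually_small] with ε hε using (h.plan ε hε.1).ac.ae_le h.target.mem)
    h.target.mem hf (fun y hy => hM y ((mem_cube_iff h.R_nonneg).1 hy))
  refine h1.congr fun ε => ?_
  exact integral_map measurable_snd.aemeasurable hf.aestronglyMeasurable

theorem tendsto_integral_snd_compPlan (h : IsMinimizingFamily R lam μ N b γ) (k : ℕ)
    {f : (Fin d → ℝ) → ℝ} (hf : Measurable f) {M : ℝ} (hM : ∀ y, (∀ i, |y i| ≤ R) → |f y| ≤ M) :
    Tendsto (fun ε => ∫ q, f q.2 ∂(compPlan R h.R_nonneg μ N k (γ ε) :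
      Measure ((Fin d → ℝ) × (Fin d → ℝ)))) (𝓝[>] 0) (𝓝 (∫ y, f y ∂(N : Measure (Fin d → ℝ)))) := by
  have h1 := (h.bddTendsto_snd_compPlan k).tendsto_integral_of_ae
    (s := Metric.closedBall (0 : Fin d → ℝ) R) Metric.isClosed_closedBall.measurableSet
    (by
      filter_upwards [eventually_small] with ε hε
      exact ((h.plan ε hε.1).compPlan h.R_nonneg h.source h.target k).ac.ae_le h.target.mem)
    h.target.mem hf (fun y hy => hM y ((mem_cube_iff h.R_nonneg).1 hy))
  refine h1.congr fun ε => ?_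
  exact integral_map measurable_snd.aemeasurable hf.aestronglyMeasurable

/-- Comparison with the competitor that keeps the first `k` coordinates: these contribute equally to
both costs, the coordinates after the `k`-th contribute `O(ε^(k + 1))`, and the entropy of the
competitor is not larger. The potential matters for `k = 0` only. -/
theorem integral_sq_sub_le_compPlan (h : IsMinimizingFamily R lam μ N b γ) (k : Fin d) {ε : ℝ}
    (h0 : 0 < ε) (h1 : ε ≤ 1) :
    ∫ q, (q.1 k - q.2 k) ^ 2 ∂(γ ε : Measure ((Fin d → ℝ) × (Fin d → ℝ))) ≤
      ∫ q, (q.1 k - q.2 k) ^ 2 ∂(compPlan R h.R_nonneg μ N k (γ ε) :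
        Measure ((Fin d → ℝ) × (Fin d → ℝ))) + ε * (d * (2 * R) ^ 2) +
      (∫ q, b (q.2 0) ∂(compPlan R h.R_nonneg μ N k (γ ε) :
        Measure ((Fin d → ℝ) × (Fin d → ℝ))) -
        ∫ q, b (q.2 0) ∂(γ ε : Measure ((Fin d → ℝ) × (Fin d → ℝ)))) := by
  obtain ⟨B, hB⟩ := h.bdd_b
  have hR := h.R_nonneg
  have hP := h.plan ε h0
  have hC := hP.compPlan hR h.source h.target k
  set γ' := compPlan R hR μ N k (γ ε) with hγ'
  have hopt := h.optimal ε h0 _ hC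
  have hkl : lam * (InformationTheory.klDiv
      ((γ' : Measure ((Fin d → ℝ) × (Fin d → ℝ))).map Prod.snd)
      (N : Measure (Fin d → ℝ))).toReal ≤ lam * (InformationTheory.klDiv
      ((γ ε : Measure ((Fin d → ℝ) × (Fin d → ℝ))).map Prod.snd)
      (N : Measure (Fin d → ℝ))).toReal :=
    mul_le_mul_of_nonneg_left (ENNReal.toReal_mono hP.kl (klDiv_compPlan_le hR h.target k))
      h.lam_pos.le
  unfold tiltedEnergy at hopt
  rw [hP.integral_weightedCost_add hR h.source h.target ε h.measurable_b0 (fun y => hB _),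
    hC.integral_weightedCost_add hR h.source h.target ε h.measurable_b0 (fun y => hB _),
    sum_split k, sum_split k (fun i : Fin d => ε ^ (i : ℕ) * ∫ q, (q.1 i - q.2 i) ^ 2
      ∂(γ' : Measure ((Fin d → ℝ) × (Fin d → ℝ))))] at hopt
  have hsame : ∀ i : Fin d, (i : ℕ) < k →
      ∫ q, (q.1 i - q.2 i) ^ 2 ∂(γ' : Measure ((Fin d → ℝ) × (Fin d → ℝ))) =
      ∫ q, (q.1 i - q.2 i) ^ 2 ∂(γ ε : Measure ((Fin d → ℝ) × (Fin d → ℝ))) := by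
    intro i hi
    rw [hγ', integral_compPlan hR k (measurable_sq_sub i)]
    simp_rw [resample_of_lt hi]
    exact integral_comp_fst_prod (measurable_sq_sub i)
  have hlow : ∑ i ∈ Finset.univ.filter (fun i : Fin d => (i : ℕ) < k),
      ε ^ (i : ℕ) * ∫ q, (q.1 i - q.2 i) ^ 2 ∂(γ' : Measure ((Fin d → ℝ) × (Fin d → ℝ))) =
      ∑ i ∈ Finset.univ.filter (fun i : Fin d => (i : ℕ) < k),
      ε ^ (i : ℕ) * ∫ q, (q.1 i - q.2 i) ^ 2 ∂(γ ε : Measure ((Fin d → ℝ) × (Fin d → ℝ))) :=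
    Finset.sum_congr rfl fun i hi => by rw [hsame i (Finset.mem_filter.1 hi).2]
  have h3 := sum_gt_le (d := d) h0 h1 (k := k) (M := (2 * R) ^ 2)
    (a := fun i => ∫ q, (q.1 i - q.2 i) ^ 2 ∂(γ' : Measure ((Fin d → ℝ) × (Fin d → ℝ))))
    (fun i => integral_nonneg fun q => sq_nonneg _)
    (fun i => hC.integral_sq_sub_le hR h.source h.target i)
  have h4 : 0 ≤ ∑ i ∈ Finset.univ.filter (fun i : Fin d => (k : ℕ) < (i : ℕ)),
      ε ^ (i : ℕ) * ∫ q, (q.1 i - q.2 i) ^ 2 ∂(γ ε : Measure ((Fin d → ℝ) × (Fin d → ℝ))) :=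
    Finset.sum_nonneg fun i _ => mul_nonneg (pow_nonneg h0.le _)
      (integral_nonneg fun q => sq_nonneg _)
  -- the potential terms agree unless `k = 0`, in which case `ε ^ k = 1`
  have hb : ∫ q, b (q.2 0) ∂(γ' : Measure ((Fin d → ℝ) × (Fin d → ℝ))) -
      ∫ q, b (q.2 0) ∂(γ ε : Measure ((Fin d → ℝ) × (Fin d → ℝ))) =
      ε ^ (k : ℕ) * (∫ q, b (q.2 0) ∂(γ' : Measure ((Fin d → ℝ) × (Fin d → ℝ))) -
      ∫ q, b (q.2 0) ∂(γ ε : Measure ((Fin d → ℝ) × (Fin d → ℝ)))) := by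
    rcases Nat.eq_zero_or_pos (k : ℕ) with hk | hk
    · rw [hk, pow_zero, one_mul]
    · have hk0 : ((0 : Fin d) : ℕ) < k := by simpa using hk
      have : ∫ q, b (q.2 0) ∂(γ' : Measure ((Fin d → ℝ) × (Fin d → ℝ))) =
          ∫ q, b (q.2 0) ∂(γ ε : Measure ((Fin d → ℝ) × (Fin d → ℝ))) := by
        have hm : Measurable fun q : (Fin d → ℝ) × (Fin d → ℝ) => b (q.2 0) :=
          h.measurable_b0.comp measurable_snd
        rw [hγ', integral_compPlan hR k hm]
        simp_rw [resample_of_lt hk0]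
        exact integral_comp_fst_prod hm
      rw [this, sub_self, mul_zero]
  have hpow : 0 < ε ^ (k : ℕ) := pow_pos h0 _
  refine le_of_mul_le_mul_left ?_ hpow
  rw [mul_add, mul_add]
  linarith

end IsMinimizingFamily

end

/-! ### Convergence in measure along families of measures -/

section

variable {I Ω : Type*} [MeasurableSpace Ω] {l : Filter I} {P : I → Measure Ω}
  [∀ i, IsFiniteMeasure (P i)]

theorem tendsto_measureReal_le_dist_pi {ι : Type*} [Fintype ι] {f g : Ω → ι → ℝ}
    (h : ∀ j, ∀ r > 0, Tendsto (fun i => (P i).real {ω | r ≤ |f ω j - g ω j|}) l (𝓝 0))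
    {r : ℝ} (hr : 0 < r) :
    Tendsto (fun i => (P i).real {ω | r ≤ dist (f ω) (g ω)}) l (𝓝 0) := by
  have hsum : Tendsto (fun i => ∑ j, (P i).real {ω | r ≤ |f ω j - g ω j|}) l (𝓝 0) := by
    simpa using tendsto_finsetSum Finset.univ fun j _ => h j r hr
  refine squeeze_zero (fun i => measureReal_nonneg) (fun i => ?_) hsum
  refine (measureReal_mono ?_).trans (measureReal_iUnion_fintype_le _)
  intro ω hω
  by_contra hcon
  simp only [Set.mem_iUnion, Set.mem_ofPred_eq, not_exists, not_le] at hcon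
  exact absurd ((dist_pi_lt_iff hr).2 hcon) (not_lt.2 hω)

/-- A variant of `tendsto_integral_abs_sub_of_close` with an independent parameter. -/
theorem tendsto_integral_abs_sub_prod_of_close {Z : Type*} [MetricSpace Z]
    [ProperSpace Z] [SecondCountableTopology Z] [MeasurableSpace Z] [BorelSpace Z]
    {A B : Ω → Z} (hA : Measurable A) (hB : Measurable B) {β : Measure Z} [IsFiniteMeasure β]
    (h1 : BddTendsto l (fun i => (P i).map A) β) (h2 : ∀ᶠ i in l, (P i).map B = β)
    (h3 : ∀ r > 0, Tendsto (fun i => (P i).real {ω | r ≤ dist (A ω) (B ω)}) l (𝓝 0))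
    (σ : Measure ℝ) [IsFiniteMeasure σ] {V : Z × ℝ → ℝ} (hV : Measurable V) {M : ℝ}
    (hM : ∀ z, |V z| ≤ M) :
    Tendsto (fun i => ∫ q, |V (A q.1, q.2) - V (B q.1, q.2)| ∂(P i).prod σ) l (𝓝 0) := by
  have e : ∀ {C : Ω → Z}, Measurable C → ∀ i, ((P i).prod σ).map (Prod.map C id) =
      ((P i).map C).prod σ := fun {C} hC i => by
    rw [← Measure.map_prod_map _ _ hC measurable_id, Measure.map_id]
  refine tendsto_integral_abs_sub_of_close (P := fun i => (P i).prod σ)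
    (A := Prod.map A id) (B := Prod.map B id) (β := β.prod σ)
    (hA.prodMap measurable_id) (hB.prodMap measurable_id) ?_ ?_ (fun r hr => ?_) hV hM
  · simp_rw [e hA]
    exact h1.prod σ
  · filter_upwards [h2] with i hi
    rw [e hB, hi]
  · have hset : {q : Ω × ℝ | r ≤ dist (Prod.map A id q) (Prod.map B id q)} =
        {ω | r ≤ dist (A ω) (B ω)} ×ˢ Set.univ := by
      ext q
      simp [Prod.dist_eq]
    simp_rw [hset, measureReal_prod_prod]
    simpa using (h3 r hr).mul_const (σ.real Set.univ)

/-- If `f ≥ w ∘ X` on the event `E`, where `w` is positive almost everywhere for the fixed law of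
`X`, and the mean of `f` tends to zero, then so does the probability of `E`. -/
theorem tendsto_measureReal_of_gap {S : Type*} [MeasurableSpace S] {X : Ω → S} (hX : Measurable X)
    {β : Measure S} [IsFiniteMeasure β] (h : ∀ᶠ i in l, (P i).map X = β) {w : S → ℝ}
    (hw : Measurable w) (hpos : ∀ᵐ s ∂β, 0 < w s) {f : Ω → ℝ} (hf : Measurable f) {M : ℝ}
    (hM : ∀ᶠ i in l, ∀ᵐ ω ∂P i, |f ω| ≤ M) (h0 : ∀ ω, 0 ≤ f ω)
    (hlim : Tendsto (fun i => ∫ ω, f ω ∂P i) l (𝓝 0)) {E : Set Ω}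
    (hE : ∀ ω ∈ E, w (X ω) ≤ f ω) : Tendsto (fun i => (P i).real E) l (𝓝 0) := by
  have hs : Tendsto (fun n : ℕ => β.real {s | w s ≤ 1 / ((n : ℝ) + 1)}) atTop (𝓝 0) := by
    have hanti : Antitone fun n : ℕ => {s | w s ≤ 1 / ((n : ℝ) + 1)} := fun m n hmn s hs =>
      le_trans (show w s ≤ 1 / ((n : ℝ) + 1) from hs) (Nat.one_div_le_one_div hmn)
    have h1 := tendsto_measure_iInter_atTop (μ := β)
      (fun n => (measurableSet_le hw measurable_const).nullMeasurableSet) hanti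
      ⟨0, measure_ne_top _ _⟩
    have h2 : β (⋂ n : ℕ, {s | w s ≤ 1 / ((n : ℝ) + 1)}) = 0 := by
      refine measure_mono_null (fun s hs => ?_) (ae_iff.1 hpos)
      simp only [Set.mem_iInter, Set.mem_ofPred_eq] at hs
      exact not_lt.2 (ge_of_tendsto' tendsto_one_div_add_atTop_nhds_zero_nat hs)
    rw [h2] at h1
    have h3 := (ENNReal.tendsto_toReal ENNReal.zero_ne_top).comp h1
    rw [ENNReal.toReal_zero] at h3
    exact h3
  rw [Metric.tendsto_nhds]
  intro η hη
  obtain ⟨n, hn⟩ := (hs.eventually_lt_const (half_pos hη)).exists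
  have hc : (0 : ℝ) < 1 / ((n : ℝ) + 1) := Nat.one_div_pos_of_nat
  have hlim' : Tendsto (fun i => ∫ ω, |f ω| ∂P i) l (𝓝 0) := by
    simpa only [abs_of_nonneg (h0 _)] using hlim
  filter_upwards [h, (tendsto_measureReal_le_abs hf hM hlim' hc).eventually_lt_const
    (half_pos hη)] with i hi h1
  rw [Real.dist_eq, sub_zero, abs_of_nonneg measureReal_nonneg]
  have hsub : E ⊆ X ⁻¹' {s | w s ≤ 1 / ((n : ℝ) + 1)} ∪ {ω | 1 / ((n : ℝ) + 1) ≤ |f ω|} := by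
    intro ω hω
    rcases le_total (w (X ω)) (1 / ((n : ℝ) + 1)) with h | h
    · exact Or.inl h
    · exact Or.inr ((h.trans (hE ω hω)).trans (le_abs_self _))
  have hpre : (P i).real (X ⁻¹' {s | w s ≤ 1 / ((n : ℝ) + 1)}) =
      β.real {s | w s ≤ 1 / ((n : ℝ) + 1)} := by
    rw [← hi, map_measureReal_apply hX (measurableSet_le hw measurable_const)]
  calc (P i).real E ≤ _ := measureReal_mono hsub
    _ ≤ _ := measureReal_union_le _ _
    _ < η := by rw [hpre]; linarith

end

/-! ### Convergence of the coordinates, one after the other -/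

section

variable {d : ℕ} {R : ℝ} {μ N : ProbabilityMeasure (Fin d → ℝ)} {k : Fin d}

theorem measurable_prevCoords_fst (k : Fin d) :
    Measurable fun q : (Fin d → ℝ) × (Fin d → ℝ) => prevCoords k q.1 :=
  (measurable_prevCoords k).comp measurable_fst

theorem measurable_mul_coord (k : Fin d) :
    Measurable fun q : (Fin d → ℝ) × (Fin d → ℝ) => q.1 k * q.2 k :=
  (measurable_fst_coord k).mul (measurable_snd_coord k)

theorem measurable_quantCoord (hR : 0 ≤ R) (M : ProbabilityMeasure (Fin d → ℝ)) (k : Fin d) :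
    Measurable fun z : (Set.Iio k → ℝ) × ℝ => quantCoord R M k z.1 z.2 :=
  measurable_kerQuantile hR (condCoord M k)

theorem Measurable.apply_quantCoord {Ω : Type*} [MeasurableSpace Ω] (hR : 0 ≤ R)
    (M : ProbabilityMeasure (Fin d → ℝ)) {f : Ω → Set.Iio k → ℝ} {g : Ω → ℝ} (hf : Measurable f)
    (hg : Measurable g) : Measurable fun ω => quantCoord R M k (f ω) (g ω) :=
  (measurable_kerQuantile hR (condCoord M k)).comp (hf.prodMk hg)

theorem Measurable.apply_krSlice {Ω : Type*} [MeasurableSpace Ω] (hR : 0 ≤ R)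
    {f : Ω → Set.Iio k → ℝ} {g : Ω → ℝ} (hf : Measurable f)
    (hg : Measurable g) : Measurable fun ω => krSlice R μ N k (f ω) (g ω) :=
  Measurable.apply_quantCoord hR N ((measurable_prevKrMap hR k).comp hf)
    ((measurable_kerCDF (condCoord μ k)).comp (hf.prodMk hg))

theorem Measurable.monoConj_krSlice {Ω : Type*} [MeasurableSpace Ω] (hR : 0 ≤ R)
    {f : Ω → Set.Iio k → ℝ} {g : Ω → ℝ} (hf : Measurable f)
    (hg : Measurable g) : Measurable fun ω => monoConj R (krSlice R μ N k (f ω)) (g ω) :=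
  (measurable_monoConj (measurable_krSlice hR k)).comp (hf.prodMk hg)

theorem Measurable.monoSlack_krSlice {Ω : Type*} [MeasurableSpace Ω] (hR : 0 ≤ R)
    {f : Ω → Set.Iio k → ℝ} {g g' : Ω → ℝ} (hf : Measurable f) (hg : Measurable g)
    (hg' : Measurable g') :
    Measurable fun ω => monoSlack R (krSlice R μ N k (f ω)) (g ω) (g' ω) := by
  have h := measurable_monoSlack (R := R) (measurable_krSlice (μ := μ) (N := N) hR k)
  generalize krSlice R μ N k = θ at h ⊢
  exact h.comp ((hf.prodMk hg).prodMk hg')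

theorem abs_quantCoord_le (hR : 0 ≤ R) (M : ProbabilityMeasure (Fin d → ℝ)) (k : Fin d)
    (p : Set.Iio k → ℝ) (u : ℝ) : |quantCoord R M k p u| ≤ R := abs_kerQuantile_le hR _ _ _

theorem measurable_prevCoords_krMap (hR : 0 ≤ R) (k : Fin d) :
    Measurable fun x => prevCoords k (krMap R μ N x) :=
  (measurable_prevCoords k).comp (measurable_krMap hR)

/-- Under the competitor, the `k`-th coordinates are conditional quantiles at the same uniform
level. -/
theorem integral_mul_compPlan (hR : 0 ≤ R) (γ' : ProbabilityMeasure ((Fin d → ℝ) × (Fin d → ℝ))) :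
    ∫ q, q.1 k * q.2 k ∂(compPlan R hR μ N k γ' : Measure ((Fin d → ℝ) × (Fin d → ℝ))) =
      ∫ q, quantCoord R μ k (prevCoords k q.1.1) q.2 * quantCoord R N k (prevCoords k q.1.2) q.2
        ∂(γ' : Measure ((Fin d → ℝ) × (Fin d → ℝ))).prod unif := by
  have hlaw := map_prod_unifCube_pair (d := d)
    (ρ := (γ' : Measure ((Fin d → ℝ) × (Fin d → ℝ)))) k (f := Prod.fst) measurable_fst
    (fun _ _ _ => rfl)
  have hfst : ((γ' : Measure ((Fin d → ℝ) × (Fin d → ℝ))).prod (unifCube d)).map Prod.fst = γ' := by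
    simp
  rw [hfst] at hlaw
  have hprev : ∀ (M : ProbabilityMeasure (Fin d → ℝ)) (x w : Fin d → ℝ),
      prevCoords k (resample R M k x w) = prevCoords k x := fun M x w => by
    ext j
    exact resample_of_lt (i := (j : Fin d)) j.2
  have hm : Measurable fun q : ((Fin d → ℝ) × (Fin d → ℝ)) × (Fin d → ℝ) => (q.1, q.2 k) :=
    measurable_fst.prodMk ((measurable_coord k).comp measurable_snd)
  rw [integral_compPlan hR k (measurable_mul_coord k), ← hlaw, integral_map hm.aemeasurable]
  · refine integral_congr_ae (Eventually.of_forall fun q => ?_)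
    simp only [resample_of_le le_rfl, hprev]
  · exact (((measurable_kerQuantile hR (condCoord μ k)).comp (((measurable_prevCoords k).comp
      (measurable_fst.comp measurable_fst)).prodMk measurable_snd)).mul
      ((measurable_kerQuantile hR (condCoord N k)).comp (((measurable_prevCoords k).comp
      (measurable_snd.comp measurable_fst)).prodMk measurable_snd))).aestronglyMeasurable

/-- With the preceding coordinates on the graph of the Knothe-Rosenblatt map, quantiles at a common
uniform level have the correlation of the Knothe-Rosenblatt plan. -/
theorem integral_quantCoord_mul (hR : 0 ≤ R) (hμ : IsCubeAC R μ)
    {γ' : ProbabilityMeasure ((Fin d → ℝ) × (Fin d → ℝ))} (hγ : HasFirstMarginal μ γ') :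
    ∫ q, quantCoord R μ k (prevCoords k q.1.1) q.2 *
        quantCoord R N k (prevCoords k (krMap R μ N q.1.1)) q.2
        ∂(γ' : Measure ((Fin d → ℝ) × (Fin d → ℝ))).prod unif =
      ∫ x, x k * krMap R μ N x k ∂(μ : Measure (Fin d → ℝ)) := by
  have hF : Measurable fun q : (Set.Iio k → ℝ) × ℝ =>
      quantCoord R μ k q.1 q.2 * quantCoord R N k (prevKrMap R μ N k q.1) q.2 :=
    (measurable_kerQuantile hR (condCoord μ k)).mul
      ((measurable_kerQuantile hR (condCoord N k)).comp
        (((measurable_prevKrMap hR k).comp measurable_fst).prodMk measurable_snd))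
  have hm : Measurable fun q : (Fin d → ℝ) × (Fin d → ℝ) => prevCoords k q.1 :=
    (measurable_prevCoords k).comp measurable_fst
  have hlaw : ((γ' : Measure ((Fin d → ℝ) × (Fin d → ℝ))).prod unif).map
      (Prod.map (fun q : (Fin d → ℝ) × (Fin d → ℝ) => prevCoords k q.1) id) =
      (μ : Measure (Fin d → ℝ)).map fun x => (prevCoords k x, rosenblatt μ x k) := by
    rw [map_prevCoords_rosenblatt hR hμ, ← Measure.map_prod_map _ _ hm measurable_id,
      Measure.map_id]
    unfold HasFirstMarginal at hγ
    rw [← hγ, Measure.map_map (measurable_prevCoords k) measurable_fst]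
    rfl
  have hm2 : Measurable fun x => (prevCoords k x, rosenblatt μ x k) :=
    (measurable_prevCoords k).prodMk ((measurable_coord k).comp (measurable_rosenblatt μ))
  calc _ = ∫ q, quantCoord R μ k q.1 q.2 * quantCoord R N k (prevKrMap R μ N k q.1) q.2
        ∂((γ' : Measure ((Fin d → ℝ) × (Fin d → ℝ))).prod unif).map
          (Prod.map (fun q : (Fin d → ℝ) × (Fin d → ℝ) => prevCoords k q.1) id) := by
        rw [integral_map (hm.prodMap measurable_id).aemeasurable hF.aestronglyMeasurable]
        simp [prevKrMap_prevCoords]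
    _ = ∫ x, quantCoord R μ k (prevCoords k x) (rosenblatt μ x k) *
        quantCoord R N k (prevKrMap R μ N k (prevCoords k x)) (rosenblatt μ x k)
        ∂(μ : Measure (Fin d → ℝ)) := by
        rw [hlaw, integral_map hm2.aemeasurable hF.aestronglyMeasurable]
    _ = _ := by
        refine integral_congr_ae ?_
        filter_upwards [ae_quantCoord_rosenblatt hR hμ k] with x hx
        rw [hx, prevKrMap_prevCoords, ← krMap_apply]

end

namespace IsMinimizingFamily

variable {d : ℕ} [NeZero d] {R lam : ℝ} {μ N : ProbabilityMeasure (Fin d → ℝ)} {b : ℝ → ℝ}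
  {γ : ℝ → ProbabilityMeasure ((Fin d → ℝ) × (Fin d → ℝ))}

theorem map_comp_fst (h : IsMinimizingFamily R lam μ N b γ) {ε : ℝ} (hε : 0 < ε) {Z : Type*}
    [MeasurableSpace Z] {f : (Fin d → ℝ) → Z} (hf : Measurable f) :
    (γ ε : Measure ((Fin d → ℝ) × (Fin d → ℝ))).map (fun q => f q.1) =
      (μ : Measure (Fin d → ℝ)).map f := by
  have := (h.plan ε hε).fst
  unfold HasFirstMarginal at this
  rw [← this, Measure.map_map hf measurable_fst]
  rfl

theorem bddTendsto_comp_snd (h : IsMinimizingFamily R lam μ N b γ) {Z : Type*}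
    [MeasurableSpace Z] {f : (Fin d → ℝ) → Z} (hf : Measurable f) :
    BddTendsto (𝓝[>] 0) (fun ε => (γ ε : Measure ((Fin d → ℝ) × (Fin d → ℝ))).map
      fun q => f q.2) ((N : Measure (Fin d → ℝ)).map f) := by
  have := h.bddTendsto_snd.map hf
  simp_rw [Measure.map_map hf measurable_snd] at this
  exact this

/-- The second component of the plans is close to the Knothe-Rosenblatt map of the first one, as
far as the coordinates before the `k`-th are concerned. -/
def PrevClose (R : ℝ) (μ N : ProbabilityMeasure (Fin d → ℝ))
    (γ : ℝ → ProbabilityMeasure ((Fin d → ℝ) × (Fin d → ℝ))) (k : Fin d) : Prop :=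
  ∀ r > 0, Tendsto (fun ε => (γ ε : Measure ((Fin d → ℝ) × (Fin d → ℝ))).real
    {q | r ≤ dist (prevCoords k q.2) (prevCoords k (krMap R μ N q.1))}) (𝓝[>] 0) (𝓝 0)

variable {k : Fin d}

theorem eventually_map_prevCoords_krMap (h : IsMinimizingFamily R lam μ N b γ) (k : Fin d) :
    ∀ᶠ ε in 𝓝[>] (0 : ℝ), (γ ε : Measure ((Fin d → ℝ) × (Fin d → ℝ))).map
      (fun q => prevCoords k (krMap R μ N q.1)) = (N : Measure (Fin d → ℝ)).map (prevCoords k) := by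
  filter_upwards [eventually_small] with ε hε
  rw [h.map_comp_fst hε.1 (measurable_prevCoords_krMap h.R_nonneg k),
    map_prevCoords_krMap h.R_nonneg h.source h.target]

theorem tendsto_integral_quantCoord_sub (h : IsMinimizingFamily R lam μ N b γ)
    (hk : PrevClose R μ N γ k) :
    Tendsto (fun ε => ∫ q, |quantCoord R N k (prevCoords k q.1.2) q.2 -
      quantCoord R N k (prevCoords k (krMap R μ N q.1.1)) q.2|
      ∂(γ ε : Measure ((Fin d → ℝ) × (Fin d → ℝ))).prod unif) (𝓝[>] 0) (𝓝 0) :=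
  tendsto_integral_abs_sub_prod_of_close
    (P := fun ε => (γ ε : Measure ((Fin d → ℝ) × (Fin d → ℝ))))
    (A := fun q => prevCoords k q.2) (B := fun q => prevCoords k (krMap R μ N q.1))
    ((measurable_prevCoords k).comp measurable_snd)
    ((measurable_prevCoords_krMap h.R_nonneg k).comp measurable_fst)
    (h.bddTendsto_comp_snd (measurable_prevCoords k)) (h.eventually_map_prevCoords_krMap k) hk unif
    (V := fun z => quantCoord R N k z.1 z.2) (measurable_quantCoord h.R_nonneg N k)
    (fun z => abs_quantCoord_le h.R_nonneg N k z.1 z.2)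

/-- The correlation of the `k`-th coordinates under the competitor converges to that of the
Knothe-Rosenblatt plan. -/
theorem tendsto_integral_mul_compPlan (h : IsMinimizingFamily R lam μ N b γ)
    (hk : PrevClose R μ N γ k) :
    Tendsto (fun ε => ∫ q, q.1 k * q.2 k ∂(compPlan R h.R_nonneg μ N k (γ ε) :
      Measure ((Fin d → ℝ) × (Fin d → ℝ)))) (𝓝[>] 0)
      (𝓝 (∫ x, x k * krMap R μ N x k ∂(μ : Measure (Fin d → ℝ)))) := by
  have hR := h.R_nonneg
  rw [tendsto_iff_dist_tendsto_zero]
  have hlim := (h.tendsto_integral_quantCoord_sub hk).const_mul R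
  rw [mul_zero] at hlim
  refine squeeze_zero' (Eventually.of_forall fun ε => dist_nonneg) ?_ hlim
  filter_upwards [eventually_small] with ε hε
  have hf1 : Measurable fun q : ((Fin d → ℝ) × (Fin d → ℝ)) × ℝ => prevCoords k q.1.1 :=
    (measurable_prevCoords k).comp (measurable_fst.comp measurable_fst)
  have hf2 : Measurable fun q : ((Fin d → ℝ) × (Fin d → ℝ)) × ℝ => prevCoords k q.1.2 :=
    (measurable_prevCoords k).comp (measurable_snd.comp measurable_fst)
  have hf3 : Measurable fun q : ((Fin d → ℝ) × (Fin d → ℝ)) × ℝ =>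
      prevCoords k (krMap R μ N q.1.1) :=
    (measurable_prevCoords_krMap hR k).comp (measurable_fst.comp measurable_fst)
  have m1 := hf1.apply_quantCoord hR μ measurable_snd
  have m2 := hf2.apply_quantCoord hR N measurable_snd
  have m3 := hf3.apply_quantCoord hR N measurable_snd
  have hb := fun M p u => abs_quantCoord_le (d := d) hR M k p u
  have hbmul : ∀ a c : ℝ, |a| ≤ R → |c| ≤ R → |a * c| ≤ R * R := fun a c ha hc => by
    rw [abs_mul]; exact mul_le_mul ha hc (abs_nonneg _) hR
  have i12 := integrable_of_abs_le
    (μ := (γ ε : Measure ((Fin d → ℝ) × (Fin d → ℝ))).prod unif) (m1.mul m2)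
    (fun q => hbmul _ _ (hb _ _ _) (hb _ _ _))
  have i13 := integrable_of_abs_le
    (μ := (γ ε : Measure ((Fin d → ℝ) × (Fin d → ℝ))).prod unif) (m1.mul m3)
    (fun q => hbmul _ _ (hb _ _ _) (hb _ _ _))
  have i23 := integrable_of_abs_le
    (μ := (γ ε : Measure ((Fin d → ℝ) × (Fin d → ℝ))).prod unif) (m2.sub m3)
    (fun q => (abs_sub _ _).trans (add_le_add (hb _ _ _) (hb _ _ _)))
  rw [integral_mul_compPlan, ← integral_quantCoord_mul hR h.source (h.plan ε hε.1).fst,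
    Real.dist_eq, ← integral_const_mul]
  refine (congrArg abs (integral_sub i12 i13).symm).trans_le ?_
  refine abs_integral_le_integral_abs.trans (integral_mono_of_nonneg
    (Eventually.of_forall fun q => abs_nonneg _) (i23.abs.const_mul R)
    (Eventually.of_forall fun q => ?_))
  simp only [Pi.mul_apply]
  rw [← mul_sub, abs_mul]
  exact mul_le_mul_of_nonneg_right (hb _ _ _) (abs_nonneg _)

/-- The correlation of the `k`-th coordinates under the minimizers is asymptotically at least that
of the Knothe-Rosenblatt plan. -/
theorem exists_le_integral_mul (h : IsMinimizingFamily R lam μ N b γ)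
    (hk : PrevClose R μ N γ k) : ∃ m : ℝ → ℝ,
      Tendsto m (𝓝[>] 0) (𝓝 (∫ x, x k * krMap R μ N x k ∂(μ : Measure (Fin d → ℝ)))) ∧
      ∀ᶠ ε in 𝓝[>] (0 : ℝ),
        m ε ≤ ∫ q, q.1 k * q.2 k ∂(γ ε : Measure ((Fin d → ℝ) × (Fin d → ℝ))) := by
  obtain ⟨B, hB⟩ := h.bdd_b
  have hR := h.R_nonneg
  have hsq : ∀ y : Fin d → ℝ, (∀ i, |y i| ≤ R) → |y k ^ 2| ≤ R ^ 2 := fun y hy => by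
    rw [abs_pow]; exact pow_le_pow_left₀ (abs_nonneg _) (hy k) 2
  have t1 := h.tendsto_integral_mul_compPlan hk
  have t2 := h.tendsto_integral_snd ((measurable_coord k).pow_const 2) hsq
  have t3 := h.tendsto_integral_snd_compPlan k ((measurable_coord k).pow_const 2) hsq
  have t4 := h.tendsto_integral_snd h.measurable_b0 (fun y _ => hB (y 0))
  have t5 := h.tendsto_integral_snd_compPlan k h.measurable_b0 (fun y _ => hB (y 0))
  have t6 : Tendsto (fun ε : ℝ => ε * (d * (2 * R) ^ 2)) (𝓝[>] 0) (𝓝 0) := by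
    have : Tendsto (fun ε : ℝ => ε * (d * (2 * R) ^ 2)) (𝓝 0) (𝓝 (0 * (d * (2 * R) ^ 2))) :=
      tendsto_id.mul_const _
    rw [zero_mul] at this
    exact this.mono_left nhdsWithin_le_nhds
  have t := t1.add (((t2.sub t3).sub (t6.add (t5.sub t4))).div_const 2)
  refine ⟨_, by simpa using t, ?_⟩
  filter_upwards [eventually_small] with ε hε
  have hP := h.plan ε hε.1
  have hC := hP.compPlan hR h.source h.target k
  have hle := h.integral_sq_sub_le_compPlan k hε.1 hε.2
  rw [hP.integral_sq_sub hR h.source h.target, hC.integral_sq_sub hR h.source h.target] at hle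
  linarith

/-- The first coordinates of the source are close to the inverse Knothe-Rosenblatt map of the
target. -/
theorem tendsto_measureReal_prev_inverse (h : IsMinimizingFamily R lam μ N b γ)
    (hk : PrevClose R μ N γ k) {r : ℝ} (hr : 0 < r) :
    Tendsto (fun ε => (γ ε : Measure ((Fin d → ℝ) × (Fin d → ℝ))).real
      {q | r ≤ dist (prevCoords k (krMap R N μ q.2)) (prevCoords k q.1)}) (𝓝[>] 0) (𝓝 0) := by
  have hR := h.R_nonneg
  refine tendsto_measureReal_le_dist_pi (fun j r hr => ?_) hr
  have hV : Measurable fun p => prevKrMap R N μ k p j :=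
    (measurable_pi_apply j).comp (measurable_prevKrMap hR k)
  have hclose := tendsto_integral_abs_sub_of_close
    (P := fun ε => (γ ε : Measure ((Fin d → ℝ) × (Fin d → ℝ))))
    (A := fun q => prevCoords k q.2) (B := fun q => prevCoords k (krMap R μ N q.1))
    ((measurable_prevCoords k).comp measurable_snd)
    ((measurable_prevCoords_krMap hR k).comp measurable_fst)
    (h.bddTendsto_comp_snd (measurable_prevCoords k)) (h.eventually_map_prevCoords_krMap k) hk hV
    (fun p => abs_krMap_le hR _ _)
  have hm : Measurable fun q : (Fin d → ℝ) × (Fin d → ℝ) =>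
      prevCoords k (krMap R N μ q.2) j - prevCoords k q.1 j :=
    ((measurable_pi_apply j).comp ((measurable_prevCoords k).comp
      ((measurable_krMap hR).comp measurable_snd))).sub
      ((measurable_pi_apply j).comp ((measurable_prevCoords k).comp measurable_fst))
  refine tendsto_measureReal_le_abs (P := fun ε => (γ ε : Measure ((Fin d → ℝ) × (Fin d → ℝ))))
    hm (M := R + R) ?_ (hclose.congr' ?_) hr
  · filter_upwards [eventually_small] with ε hε
    filter_upwards [(h.plan ε hε.1).ae_mem hR h.source h.target] with q hq
    exact (abs_sub _ _).trans (add_le_add (abs_krMap_le hR _ _) (hq.1 _))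
  · filter_upwards [eventually_small] with ε hε
    refine integral_congr_ae ?_
    filter_upwards [(h.plan ε hε.1).ae_fst (krMap_krMap hR h.source h.target)] with q hq
    rw [prevKrMap_prevCoords, prevKrMap_prevCoords, hq]

/-- Under the minimizers, the mean of the `y`-part of the slack converges to its value for the
Knothe-Rosenblatt plan. This part depends on `y k` and on the preceding coordinates of `x`; the
latter can be replaced by functions of `y`, whose law converges setwise. -/
theorem tendsto_integral_monoConj (h : IsMinimizingFamily R lam μ N b γ)
    (hk : PrevClose R μ N γ k) :
    Tendsto (fun ε => ∫ q, monoConj R (krSlice R μ N k (prevCoords k q.1)) (q.2 k)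
      ∂(γ ε : Measure ((Fin d → ℝ) × (Fin d → ℝ)))) (𝓝[>] 0)
      (𝓝 (∫ x, monoConj R (krSlice R μ N k (prevCoords k x)) (krMap R μ N x k)
        ∂(μ : Measure (Fin d → ℝ)))) := by
  have hR := h.R_nonneg
  have hθ := measurable_krSlice (μ := μ) (N := N) hR k
  have hθp : ∀ p, Measurable (krSlice R μ N k p) := fun p => (krSlice_mono hR k p).measurable
  have hθb : ∀ p s, |krSlice R μ N k p s| ≤ R := fun p s => abs_le.2 (krSlice_mem hR k p s)
  have hmS : Measurable fun y => prevCoords k (krMap R N μ y) :=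
    (measurable_prevCoords k).comp (measurable_krMap hR)
  have hclose := tendsto_integral_abs_sub_prod_of_close
    (P := fun ε => (γ ε : Measure ((Fin d → ℝ) × (Fin d → ℝ))))
    (A := fun q => prevCoords k (krMap R N μ q.2)) (B := fun q => prevCoords k q.1)
    (β := (μ : Measure (Fin d → ℝ)).map (prevCoords k))
    (hmS.comp measurable_snd) ((measurable_prevCoords k).comp measurable_fst)
    (by
      rw [← map_prevCoords_krMap hR h.target h.source]
      exact h.bddTendsto_comp_snd hmS)
    (by
      filter_upwards [eventually_small] with ε hε
      exact h.map_comp_fst hε.1 (measurable_prevCoords k))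
    (fun r hr => h.tendsto_measureReal_prev_inverse hk hr) (segMeasure R) hθ
    (fun z => hθb _ _)
  have hmain := h.tendsto_integral_snd
    (f := fun y => monoConj R (krSlice R μ N k (prevCoords k (krMap R N μ y))) (y k))
    (hmS.monoConj_krSlice hR (measurable_coord k))
    (fun y hy => abs_monoConj_le hR (hθb _) (hy k))
  have hlim : ∫ y, monoConj R (krSlice R μ N k (prevCoords k (krMap R N μ y))) (y k)
      ∂(N : Measure (Fin d → ℝ)) =
      ∫ x, monoConj R (krSlice R μ N k (prevCoords k x)) (krMap R μ N x k)
        ∂(μ : Measure (Fin d → ℝ)) := by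
    conv_lhs => rw [← map_krMap hR h.source h.target]
    have hm : Measurable fun y =>
        monoConj R (krSlice R μ N k (prevCoords k (krMap R N μ y))) (y k) :=
      hmS.monoConj_krSlice hR (measurable_coord k)
    rw [integral_map (measurable_krMap hR).aemeasurable hm.aestronglyMeasurable]
    refine integral_congr_ae ?_
    filter_upwards [krMap_krMap hR h.source h.target] with x hx
    rw [hx]
  rw [hlim] at hmain
  have m1 : Measurable fun q : (Fin d → ℝ) × (Fin d → ℝ) =>
      monoConj R (krSlice R μ N k (prevCoords k q.1)) (q.2 k) :=
    (measurable_prevCoords_fst k).monoConj_krSlice hR (measurable_snd_coord k)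
  have m2 : Measurable fun q : (Fin d → ℝ) × (Fin d → ℝ) =>
      monoConj R (krSlice R μ N k (prevCoords k (krMap R N μ q.2))) (q.2 k) :=
    (hmS.comp measurable_snd).monoConj_krSlice hR (measurable_snd_coord k)
  -- replacing `x` by the inverse map of `y` in the potential is harmless
  have hdiff : Tendsto (fun ε => ∫ q, monoConj R (krSlice R μ N k (prevCoords k q.1)) (q.2 k)
      ∂(γ ε : Measure ((Fin d → ℝ) × (Fin d → ℝ))) -
      ∫ q, monoConj R (krSlice R μ N k (prevCoords k (krMap R N μ q.2))) (q.2 k)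
      ∂(γ ε : Measure ((Fin d → ℝ) × (Fin d → ℝ)))) (𝓝[>] 0) (𝓝 0) := by
    refine squeeze_zero_norm' ?_ hclose
    filter_upwards [eventually_small] with ε hε
    have hmem := (h.plan ε hε.1).ae_mem hR h.source h.target
    have i1 := integrable_of_ae_abs_le (μ := (γ ε : Measure ((Fin d → ℝ) × (Fin d → ℝ)))) m1
      (hmem.mono fun q hq => abs_monoConj_le hR (hθb _) (hq.2 k))
    have i2 := integrable_of_ae_abs_le (μ := (γ ε : Measure ((Fin d → ℝ) × (Fin d → ℝ)))) m2
      (hmem.mono fun q hq => abs_monoConj_le hR (hθb _) (hq.2 k))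
    have m3 : Measurable fun q : ((Fin d → ℝ) × (Fin d → ℝ)) × ℝ =>
        |krSlice R μ N k (prevCoords k (krMap R N μ q.1.2)) q.2 -
          krSlice R μ N k (prevCoords k q.1.1) q.2| :=
      (((hmS.comp (measurable_snd.comp measurable_fst)).apply_krSlice hR measurable_snd).sub
        (((measurable_prevCoords k).comp (measurable_fst.comp measurable_fst)).apply_krSlice hR
          measurable_snd)).abs
    have i3 := integrable_of_abs_le (μ := (γ ε : Measure ((Fin d → ℝ) × (Fin d → ℝ))).prod
      (segMeasure R)) m3 (M := R + R) fun q => by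
        rw [abs_abs]; exact (abs_sub _ _).trans (add_le_add (hθb _ _) (hθb _ _))
    rw [← integral_sub i1 i2, integral_prod _ i3, Real.norm_eq_abs]
    refine abs_integral_le_integral_abs.trans (integral_mono_of_nonneg
      (Eventually.of_forall fun q => abs_nonneg _) i3.integral_prod_left
      (Eventually.of_forall fun q => ?_))
    refine (abs_monoConj_sub_le (hθp _) (hθb _) (hθp _) (hθb _)).trans (le_of_eq ?_)
    exact integral_congr_ae (Eventually.of_forall fun s => abs_sub_comm _ _)
  simpa using hdiff.add hmain

/-- The mean slack of the minimizers tends to zero: its `y`-part converges and its `x`-part is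
fixed, whereas the correlation is asymptotically at least the Knothe-Rosenblatt one, for which the
slack vanishes. -/
theorem tendsto_integral_monoSlack (h : IsMinimizingFamily R lam μ N b γ)
    (hk : PrevClose R μ N γ k) :
    Tendsto (fun ε => ∫ q, monoSlack R (krSlice R μ N k (prevCoords k q.1)) (q.1 k) (q.2 k)
      ∂(γ ε : Measure ((Fin d → ℝ) × (Fin d → ℝ)))) (𝓝[>] 0) (𝓝 0) := by
  have hR := h.R_nonneg
  have hθ := measurable_krSlice (μ := μ) (N := N) hR k
  have hθp : ∀ p, Measurable (krSlice R μ N k p) := fun p => (krSlice_mono hR k p).measurable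
  have hθb : ∀ p s, |krSlice R μ N k p s| ≤ R := fun p s => abs_le.2 (krSlice_mem hR k p s)
  have hPr : Measurable fun x : Fin d → ℝ => monoPrim R (krSlice R μ N k (prevCoords k x)) (x k) :=
    (measurable_monoPrim hθ).comp ((measurable_prevCoords k).prodMk (measurable_coord k))
  -- the mean slack of a plan, in terms of the potentials
  have hexp : ∀ γ' : ProbabilityMeasure ((Fin d → ℝ) × (Fin d → ℝ)), IsFinitePlan μ N γ' →
      ∫ q, monoSlack R (krSlice R μ N k (prevCoords k q.1)) (q.1 k) (q.2 k)
        ∂(γ' : Measure ((Fin d → ℝ) × (Fin d → ℝ))) =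
      ∫ q, monoConj R (krSlice R μ N k (prevCoords k q.1)) (q.2 k)
        ∂(γ' : Measure ((Fin d → ℝ) × (Fin d → ℝ))) -
      ∫ q, q.1 k * q.2 k ∂(γ' : Measure ((Fin d → ℝ) × (Fin d → ℝ))) -
      R * ∫ q, q.2 k ∂(γ' : Measure ((Fin d → ℝ) × (Fin d → ℝ))) +
      ∫ x, monoPrim R (krSlice R μ N k (prevCoords k x)) (x k) ∂(μ : Measure (Fin d → ℝ)) := by
    intro γ' hP
    have hmem := hP.ae_mem hR h.source h.target
    have m1 : Measurable fun q : (Fin d → ℝ) × (Fin d → ℝ) =>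
        monoConj R (krSlice R μ N k (prevCoords k q.1)) (q.2 k) :=
      (measurable_prevCoords_fst k).monoConj_krSlice hR (measurable_snd_coord k)
    have i1 := integrable_of_ae_abs_le (μ := (γ' : Measure ((Fin d → ℝ) × (Fin d → ℝ)))) m1
      (hmem.mono fun q hq => abs_monoConj_le hR (hθb _) (hq.2 k))
    have i2 := hP.integrable_mul hR h.source h.target k
    have i3 := (integrable_of_ae_abs_le (μ := (γ' : Measure ((Fin d → ℝ) × (Fin d → ℝ))))
      (measurable_snd_coord k) (hmem.mono fun q hq => hq.2 k)).const_mul R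
    have i4 := integrable_of_abs_le (μ := (γ' : Measure ((Fin d → ℝ) × (Fin d → ℝ))))
      (hPr.comp measurable_fst) (fun q => abs_monoPrim_le hR (hθb _))
    rw [← hP.integral_fst hPr, ← integral_const_mul, ← integral_sub i1 i2]
    have i12 : Integrable (fun q : (Fin d → ℝ) × (Fin d → ℝ) =>
        monoConj R (krSlice R μ N k (prevCoords k q.1)) (q.2 k) - q.1 k * q.2 k)
        (γ' : Measure ((Fin d → ℝ) × (Fin d → ℝ))) := i1.sub i2
    rw [← integral_sub i12 i3]
    have i123 : Integrable (fun q : (Fin d → ℝ) × (Fin d → ℝ) =>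
        monoConj R (krSlice R μ N k (prevCoords k q.1)) (q.2 k) - q.1 k * q.2 k - R * q.2 k)
        (γ' : Measure ((Fin d → ℝ) × (Fin d → ℝ))) := i12.sub i3
    have i4' : Integrable (fun q : (Fin d → ℝ) × (Fin d → ℝ) =>
        monoPrim R (krSlice R μ N k (prevCoords k q.1)) (q.1 k))
        (γ' : Measure ((Fin d → ℝ) × (Fin d → ℝ))) := i4
    rw [← integral_add i123 i4']
    refine integral_congr_ae ?_
    filter_upwards [hmem] with q hq
    rw [monoSlack_eq (hθp _) (hθb _) (abs_le.1 (hq.1 k))]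
    ring
  have hKR := hexp _ (isFinitePlan_krPlan hR h.source h.target)
  have m1 : Measurable fun q : (Fin d → ℝ) × (Fin d → ℝ) =>
      monoSlack R (krSlice R μ N k (prevCoords k q.1)) (q.1 k) (q.2 k) :=
    (measurable_prevCoords_fst k).monoSlack_krSlice hR (measurable_fst_coord k)
      (measurable_snd_coord k)
  have m2 : Measurable fun q : (Fin d → ℝ) × (Fin d → ℝ) =>
      monoConj R (krSlice R μ N k (prevCoords k q.1)) (q.2 k) :=
    (measurable_prevCoords_fst k).monoConj_krSlice hR (measurable_snd_coord k)
  rw [integral_krPlan hR m1, integral_krPlan hR m2, integral_krPlan hR (measurable_mul_coord k),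
    integral_krPlan hR (measurable_snd_coord k)] at hKR
  have hzero : ∀ x, monoSlack R (krSlice R μ N k (prevCoords k x)) (x k) (krMap R μ N x k) = 0 :=
    fun x => by rw [← krSlice_prevCoords]; exact monoSlack_self (krSlice_mono hR k _)
  simp only [hzero, integral_zero] at hKR
  obtain ⟨m, hm, hle⟩ := h.exists_le_integral_mul hk
  have t1 := h.tendsto_integral_monoConj hk
  have t2 := (h.tendsto_integral_snd (measurable_coord k) (fun y hy => hy k)).const_mul R
  have e2 : ∫ y, y k ∂(N : Measure (Fin d → ℝ)) =
      ∫ x, krMap R μ N x k ∂(μ : Measure (Fin d → ℝ)) := by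
    conv_lhs => rw [← map_krMap hR h.source h.target]
    exact integral_map (measurable_krMap hR).aemeasurable (measurable_coord k).aestronglyMeasurable
  rw [e2] at t2
  have t := ((t1.sub hm).sub t2).add_const
    (∫ x, monoPrim R (krSlice R μ N k (prevCoords k x)) (x k) ∂(μ : Measure (Fin d → ℝ)))
  rw [← hKR] at t
  refine tendsto_of_tendsto_of_tendsto_of_le_of_le' tendsto_const_nhds t
    (Eventually.of_forall fun ε => integral_nonneg fun q => monoSlack_nonneg) ?_
  filter_upwards [hle, eventually_small] with ε h1 hε
  rw [hexp _ (h.plan ε hε.1)]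
  linarith

/-- Each coordinate of the second component converges in measure to that of the Knothe-Rosenblatt
map of the first component. -/
theorem tendsto_measureReal_coord (h : IsMinimizingFamily R lam μ N b γ) (k : Fin d) {r : ℝ}
    (hr : 0 < r) : Tendsto (fun ε => (γ ε : Measure ((Fin d → ℝ) × (Fin d → ℝ))).real
      {q | r ≤ |q.2 k - krMap R μ N q.1 k|}) (𝓝[>] 0) (𝓝 0) := by
  have hR := h.R_nonneg
  induction k using WellFoundedLT.induction generalizing r with
  | ind k ih =>
    have hk : PrevClose R μ N γ k := fun r hr =>
      tendsto_measureReal_le_dist_pi (fun (j : Set.Iio k) r hr => ih (j : Fin d) j.2 hr) hr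
    have hθ := measurable_krSlice (μ := μ) (N := N) hR k
    have hθb : ∀ p s, |krSlice R μ N k p s| ≤ R := fun p s => abs_le.2 (krSlice_mem hR k p s)
    have hX : Measurable fun x : Fin d → ℝ => (prevCoords k x, x k) :=
      (measurable_prevCoords k).prodMk (measurable_coord k)
    refine tendsto_measureReal_of_gap
      (P := fun ε => (γ ε : Measure ((Fin d → ℝ) × (Fin d → ℝ))))
      (X := fun q => (prevCoords k q.1, q.1 k))
      (β := (μ : Measure (Fin d → ℝ)).map fun x => (prevCoords k x, x k))
      (w := fun z => slackGap R (krSlice R μ N k z.1) r z.2)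
      (f := fun q => monoSlack R (krSlice R μ N k (prevCoords k q.1)) (q.1 k) (q.2 k))
      (hX.comp measurable_fst) ?_ (measurable_slackGap hθ r) (ae_slackGap_pos hR h.source k hr)
      ((measurable_prevCoords_fst k).monoSlack_krSlice hR (measurable_fst_coord k)
        (measurable_snd_coord k))
      (M := 2 * R * (2 * R)) ?_ (fun q => monoSlack_nonneg) (h.tendsto_integral_monoSlack hk) ?_
    · filter_upwards [eventually_small] with ε hε
      exact h.map_comp_fst hε.1 hX
    · filter_upwards [eventually_small] with ε hε
      filter_upwards [(h.plan ε hε.1).ae_mem hR h.source h.target] with q hq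
      exact abs_monoSlack_le hR (hθb _) (hq.2 k)
    · intro q hq
      refine slackGap_le (krSlice_mono hR k _) (hθb _) hr ?_
      rw [krSlice_prevCoords]
      exact hq

end IsMinimizingFamily

/-! ### Narrow convergence and the first coordinate -/

/-- Plans that concentrate near the graph of a map converge narrowly to the plan it induces. -/
theorem tendsto_of_tendsto_measureReal_dist {d : ℕ} {I : Type*} {l : Filter I}
    [l.IsCountablyGenerated] {μ : ProbabilityMeasure (Fin d → ℝ)}
    {γ : I → ProbabilityMeasure ((Fin d → ℝ) × (Fin d → ℝ))}
    (hγ : ∀ᶠ i in l, HasFirstMarginal μ (γ i)) {T : (Fin d → ℝ) → Fin d → ℝ} (hT : Measurable T)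
    {γT : ProbabilityMeasure ((Fin d → ℝ) × (Fin d → ℝ))} (hγT : IsInducedPlan μ T γT)
    (h : ∀ r > 0, Tendsto (fun i => (γ i : Measure ((Fin d → ℝ) × (Fin d → ℝ))).real
      {q | r ≤ dist q.2 (T q.1)}) l (𝓝 0)) : Tendsto γ l (𝓝 γT) := by
  rw [tendsto_iff_forall_lipschitz_integral_tendsto]
  rintro f ⟨C, hC⟩ ⟨L, hL⟩
  have hfm : Measurable f := hL.continuous.measurable
  have hfb : ∀ q, |f q| ≤ |f 0| + C := fun q => by
    have h1 := hC q 0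
    rw [Real.dist_eq] at h1
    have h2 := abs_add_le (f q - f 0) (f 0)
    rw [sub_add_cancel] at h2
    linarith
  have hg : Measurable fun x => f (x, T x) := hfm.comp (measurable_id.prodMk hT)
  have hg' : Measurable fun q : (Fin d → ℝ) × (Fin d → ℝ) => f (q.1, T q.1) :=
    hg.comp measurable_fst
  have hdm : Measurable fun q : (Fin d → ℝ) × (Fin d → ℝ) => dist q.2 (T q.1) :=
    measurable_snd.dist (hT.comp measurable_fst)
  have hlim : ∫ q, f q ∂(γT : Measure ((Fin d → ℝ) × (Fin d → ℝ))) =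
      ∫ x, f (x, T x) ∂(μ : Measure (Fin d → ℝ)) := by
    have e : (γT : Measure ((Fin d → ℝ) × (Fin d → ℝ))) = _ := hγT
    rw [e]
    exact integral_map (measurable_id.prodMk hT).aemeasurable hfm.aestronglyMeasurable
  rw [hlim, Metric.tendsto_nhds]
  intro η hη
  have hr : 0 < η / 2 / (L + 1) := by positivity
  have ht := (h _ hr).const_mul C
  rw [mul_zero] at ht
  filter_upwards [hγ, ht.eventually_lt_const (half_pos hη)] with i hi hlt
  have e : ∫ x, f (x, T x) ∂(μ : Measure (Fin d → ℝ)) =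
      ∫ q, f (q.1, T q.1) ∂(γ i : Measure ((Fin d → ℝ) × (Fin d → ℝ))) := by
    unfold HasFirstMarginal at hi
    rw [← hi]
    exact integral_map measurable_fst.aemeasurable hg.aestronglyMeasurable
  have i1 : Integrable f (γ i : Measure ((Fin d → ℝ) × (Fin d → ℝ))) :=
    integrable_of_abs_le hfm hfb
  have i2 : Integrable (fun q => f (q.1, T q.1))
      (γ i : Measure ((Fin d → ℝ) × (Fin d → ℝ))) := integrable_of_abs_le hg' fun q => hfb _
  set s : Set ((Fin d → ℝ) × (Fin d → ℝ)) := {q | η / 2 / (L + 1) ≤ dist q.2 (T q.1)} with hs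
  have hsm : MeasurableSet s := measurableSet_le measurable_const hdm
  have i3 : Integrable (s.indicator fun _ => C)
      (γ i : Measure ((Fin d → ℝ) × (Fin d → ℝ))) := (integrable_const C).indicator hsm
  rw [e, Real.dist_eq, ← integral_sub i1 i2]
  calc |∫ q, (f q - f (q.1, T q.1)) ∂(γ i : Measure ((Fin d → ℝ) × (Fin d → ℝ)))|
      ≤ ∫ q, |f q - f (q.1, T q.1)| ∂(γ i : Measure ((Fin d → ℝ) × (Fin d → ℝ))) :=
        abs_integral_le_integral_abs
    _ ≤ ∫ q, (η / 2 + s.indicator (fun _ => C) q)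
          ∂(γ i : Measure ((Fin d → ℝ) × (Fin d → ℝ))) := by
        refine integral_mono (i1.sub i2).abs ((integrable_const _).add i3) fun q => ?_
        by_cases hq : q ∈ s
        · simp only [Set.indicator_of_mem hq]
          have := hC q (q.1, T q.1)
          rw [Real.dist_eq] at this
          change |f q - f (q.1, T q.1)| ≤ _
          linarith
        · simp only [Set.indicator_of_notMem hq, add_zero]
          have h1 := hL.dist_le_mul q (q.1, T q.1)
          have h2 : dist q (q.1, T q.1) = dist q.2 (T q.1) := by simp [Prod.dist_eq]
          have h3 : dist q.2 (T q.1) < η / 2 / (L + 1) := not_le.1 hq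
          rw [Real.dist_eq, h2] at h1
          refine h1.trans ?_
          rw [lt_div_iff₀ (by positivity)] at h3
          nlinarith [dist_nonneg (x := q.2) (y := T q.1)]
    _ = η / 2 + C * (γ i : Measure ((Fin d → ℝ) × (Fin d → ℝ))).real s := by
        rw [integral_add (integrable_const _) i3, integral_indicator_const _ hsm]
        simp [mul_comm]
    _ < η := by linarith

/-- Among the maps with the same law, the first component of the Knothe-Rosenblatt map has the
largest correlation with the first coordinate. -/
theorem integral_mul_le_integral_mul_krMap {d : ℕ} [NeZero d] {R : ℝ}
    {μ N : ProbabilityMeasure (Fin d → ℝ)} (hR : 0 ≤ R) (hμ : IsCubeAC R μ) (hN : IsCubeAC R N)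
    {S : (Fin d → ℝ) → ℝ} (hS : Measurable S) (hSR : ∀ x, |S x| ≤ R)
    (hlaw : (μ : Measure (Fin d → ℝ)).map S = (N : Measure (Fin d → ℝ)).map fun y => y 0) :
    ∫ x, x 0 * S x ∂(μ : Measure (Fin d → ℝ)) ≤
      ∫ x, x 0 * krMap R μ N x 0 ∂(μ : Measure (Fin d → ℝ)) := by
  set p : Set.Iio (0 : Fin d) → ℝ := prevCoords 0 0 with hp
  have hprev : ∀ x : Fin d → ℝ, prevCoords 0 x = p := fun x => by
    ext j
    exact absurd j.2 (Fin.not_lt_zero (j : Fin d))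
  set θ := krSlice R μ N 0 p with hθ
  have hθm : Monotone θ := krSlice_mono hR 0 p
  have hθb : ∀ s, |θ s| ≤ R := fun s => abs_le.2 (krSlice_mem hR 0 p s)
  have hT : ∀ x, krMap R μ N x 0 = θ (x 0) := fun x => by
    rw [← krSlice_prevCoords, hprev]
  set V : ℝ → ℝ := fun t => monoConj R θ t - R * t with hV
  have hVm : Measurable V :=
    (Measurable.monoConj_krSlice hR measurable_const measurable_id).sub
      (measurable_const.mul measurable_id)
  have hVb : ∀ t, |t| ≤ R → |V t| ≤ 2 * R * (2 * R) + R * R := fun t ht => by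
    refine (abs_sub _ _).trans (add_le_add (abs_monoConj_le hR hθb ht) ?_)
    rw [abs_mul, abs_of_nonneg hR]
    exact mul_le_mul_of_nonneg_left ht hR
  have hPm : Measurable fun x : Fin d → ℝ => monoPrim R θ (x 0) := by
    have h : Measurable fun q : Unit × ℝ => θ q.2 := hθm.measurable.comp measurable_snd
    exact (measurable_monoPrim (P := Unit) (θ := fun _ => θ) h).comp
      (measurable_const (a := ()).prodMk (measurable_coord 0))
  have iP : Integrable (fun x : Fin d → ℝ => monoPrim R θ (x 0)) (μ : Measure (Fin d → ℝ)) :=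
    integrable_of_abs_le hPm fun x => abs_monoPrim_le hR hθb
  -- the dual bound depends on the map only through its law
  have hmain : ∀ {F : (Fin d → ℝ) → ℝ}, Measurable F → (∀ x, |F x| ≤ R) →
      Integrable (fun x => V (F x)) (μ : Measure (Fin d → ℝ)) ∧
      Integrable (fun x => x 0 * F x) (μ : Measure (Fin d → ℝ)) ∧
      ∫ x, (V (F x) + monoPrim R θ (x 0)) ∂(μ : Measure (Fin d → ℝ)) =
      ∫ t, V t ∂((μ : Measure (Fin d → ℝ)).map F) +
        ∫ x, monoPrim R θ (x 0) ∂(μ : Measure (Fin d → ℝ)) := by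
    intro F hF hFR
    have i1 : Integrable (fun x => V (F x)) (μ : Measure (Fin d → ℝ)) :=
      integrable_of_abs_le (hVm.comp hF) fun x => hVb _ (hFR x)
    refine ⟨i1, integrable_of_ae_abs_le ((measurable_coord 0).mul hF) (M := R * R) ?_, ?_⟩
    · filter_upwards [hμ.mem] with x hx
      rw [abs_mul]
      exact mul_le_mul ((mem_cube_iff hR).1 hx 0) (hFR x) (abs_nonneg _) hR
    · rw [integral_add i1 iP, integral_map hF.aemeasurable hVm.aestronglyMeasurable]
  have hTm : Measurable fun x => krMap R μ N x 0 := (measurable_coord 0).comp (measurable_krMap hR)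
  have hTR : ∀ x, |krMap R μ N x 0| ≤ R := fun x => abs_krMap_le hR x 0
  have hTlaw : (μ : Measure (Fin d → ℝ)).map (fun x => krMap R μ N x 0) =
      (N : Measure (Fin d → ℝ)).map fun y => y 0 := by
    conv_rhs => rw [← map_krMap hR hμ hN]
    rw [Measure.map_map (measurable_coord 0) (measurable_krMap hR)]
    rfl
  obtain ⟨iS, iS', eS⟩ := hmain hS hSR
  obtain ⟨iT, iT', eT⟩ := hmain hTm hTR
  have h1 : ∫ x, x 0 * S x ∂(μ : Measure (Fin d → ℝ)) ≤
      ∫ x, (V (S x) + monoPrim R θ (x 0)) ∂(μ : Measure (Fin d → ℝ)) := by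
    refine integral_mono_ae iS' (iS.add iP) ?_
    filter_upwards [hμ.mem] with x hx
    have h2 := monoSlack_eq (y := S x) hθm.measurable hθb
      (abs_le.1 ((mem_cube_iff hR).1 hx 0))
    have h3 := monoSlack_nonneg (R := R) (θ := θ) (t := x 0) (y := S x)
    simp only [hV]
    linarith
  have h2 : ∫ x, x 0 * krMap R μ N x 0 ∂(μ : Measure (Fin d → ℝ)) =
      ∫ x, (V (krMap R μ N x 0) + monoPrim R θ (x 0)) ∂(μ : Measure (Fin d → ℝ)) := by
    refine integral_congr_ae ?_
    filter_upwards [hμ.mem] with x hx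
    have h2 := monoSlack_eq (y := θ (x 0)) hθm.measurable hθb
      (abs_le.1 ((mem_cube_iff hR).1 hx 0))
    rw [monoSlack_self hθm] at h2
    simp only [hV, hT]
    linarith
  rw [h2, eT, hTlaw, ← hlaw, ← eS]
  exact h1

/-! ### The objective relative to a tilted target -/

section

variable {d : ℕ} {R : ℝ} {μ ν N : ProbabilityMeasure (Fin d → ℝ)}
  {γ : ProbabilityMeasure ((Fin d → ℝ) × (Fin d → ℝ))} {ε lam : ℝ}

theorem weightedCost_nonneg (hε : 0 ≤ ε) (x y : Fin d → ℝ) : 0 ≤ weightedCost ε x y :=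
  Finset.sum_nonneg fun _ _ => mul_nonneg (pow_nonneg hε _) (sq_nonneg _)

theorem IsFinitePlan.integrable_weightedCost (h : IsFinitePlan μ N γ) (hR : 0 ≤ R)
    (hμ : IsCubeAC R μ) (hN : IsCubeAC R N) (ε : ℝ) :
    Integrable (fun q => weightedCost ε q.1 q.2)
      (γ : Measure ((Fin d → ℝ) × (Fin d → ℝ))) :=
  integrable_finsetSum _ fun i _ => (h.integrable_sq_sub hR hμ hN i).const_mul _

theorem tiltedEnergy_zero_nonneg (hε : 0 ≤ ε) (hlam : 0 < lam) :
    0 ≤ tiltedEnergy ε lam ν (fun _ => 0) γ :=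
  add_nonneg (mul_nonneg hlam.le ENNReal.toReal_nonneg)
    (integral_nonneg fun q => by simpa using weightedCost_nonneg hε q.1 q.2)

theorem IsFinitePlan.softObjective_eq (h : IsFinitePlan μ ν γ) (hR : 0 ≤ R) (hμ : IsCubeAC R μ)
    (hν : IsCubeAC R ν) (hε : 0 ≤ ε) (hlam : 0 < lam) :
    softObjective ε lam ν γ = ENNReal.ofReal (tiltedEnergy ε lam ν (fun _ => 0) γ) := by
  unfold softObjective tiltedEnergy
  simp only [add_zero]
  rw [ENNReal.ofReal_add (mul_nonneg hlam.le ENNReal.toReal_nonneg)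
    (integral_nonneg fun q : (Fin d → ℝ) × (Fin d → ℝ) => weightedCost_nonneg hε q.1 q.2),
    ENNReal.ofReal_mul hlam.le,
    ENNReal.ofReal_toReal h.kl, ofReal_integral_eq_lintegral_ofReal
      (h.integrable_weightedCost hR hμ hν ε)
      (Eventually.of_forall fun q => weightedCost_nonneg hε q.1 q.2)]

theorem kl_ne_top_of_softObjective_ne_top (hlam : 0 < lam) (h : softObjective ε lam ν γ ≠ ⊤) :
    InformationTheory.klDiv ((γ : Measure ((Fin d → ℝ) × (Fin d → ℝ))).map Prod.snd)
      (ν : Measure (Fin d → ℝ)) ≠ ⊤ := by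
  intro hcon
  refine h ?_
  rw [softObjective, hcon, ENNReal.mul_top (by simpa using hlam), top_add]

/-- The independent coupling. -/
def indepPlan (μ ν : ProbabilityMeasure (Fin d → ℝ)) :
    ProbabilityMeasure ((Fin d → ℝ) × (Fin d → ℝ)) :=
  ⟨(μ : Measure (Fin d → ℝ)).prod ν, inferInstance⟩

theorem isFinitePlan_indepPlan : IsFinitePlan μ ν (indepPlan μ ν) where
  fst := by simp [HasFirstMarginal, indepPlan]
  kl := by simp [indepPlan, InformationTheory.klDiv_self]

/-- In the minimization only plans of finite entropy matter, and for these the objective is real. -/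
theorem isSoftMinimizer_iff (hR : 0 ≤ R) (hμ : IsCubeAC R μ) (hν : IsCubeAC R ν) (hε : 0 ≤ ε)
    (hlam : 0 < lam) : IsSoftMinimizer ε lam μ ν γ ↔ IsFinitePlan μ ν γ ∧
      ∀ γ', IsFinitePlan μ ν γ' →
        tiltedEnergy ε lam ν (fun _ => 0) γ ≤ tiltedEnergy ε lam ν (fun _ => 0) γ' := by
  constructor
  · intro h
    have hP : IsFinitePlan μ ν γ := by
      refine ⟨h.1, kl_ne_top_of_softObjective_ne_top hlam
        (ne_top_of_le_ne_top ?_ (h.2 (indepPlan μ ν) isFinitePlan_indepPlan.fst))⟩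
      rw [isFinitePlan_indepPlan.softObjective_eq hR hμ hν hε hlam]
      exact ENNReal.ofReal_ne_top
    refine ⟨hP, fun γ' h' => ?_⟩
    have := h.2 γ' h'.fst
    rw [hP.softObjective_eq hR hμ hν hε hlam, h'.softObjective_eq hR hμ hν hε hlam] at this
    exact (ENNReal.ofReal_le_ofReal_iff (tiltedEnergy_zero_nonneg hε hlam)).1 this
  · rintro ⟨hP, h⟩
    refine ⟨hP.fst, fun γ' h' => ?_⟩
    by_cases htop : softObjective ε lam ν γ' = ⊤
    · rw [htop]; exact le_top
    · have hP' : IsFinitePlan μ ν γ' := ⟨h', kl_ne_top_of_softObjective_ne_top hlam htop⟩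
      rw [hP.softObjective_eq hR hμ hν hε hlam, hP'.softObjective_eq hR hμ hν hε hlam]
      exact ENNReal.ofReal_le_ofReal (h γ' hP')

/-- `N` is the tilting of `ν` by the bounded potential `b / lam`. -/
structure IsTilting (lam : ℝ) (ν N : ProbabilityMeasure (Fin d → ℝ)) (b : (Fin d → ℝ) → ℝ) :
    Prop where
  meas : Measurable b
  bdd : ∃ M, ∀ y, |b y| ≤ M
  eq : (N : Measure (Fin d → ℝ)) = (ν : Measure (Fin d → ℝ)).tilted fun y => b y / lam

variable {b : (Fin d → ℝ) → ℝ}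

theorem IsTilting.bdd_div (h : IsTilting lam ν N b) : ∃ M, ∀ y, |b y / lam| ≤ M := by
  obtain ⟨M, hM⟩ := h.bdd
  refine ⟨M / |lam|, fun y => ?_⟩
  rw [abs_div]
  exact div_le_div_of_nonneg_right (hM y) (abs_nonneg _)

theorem IsTilting.isFinitePlan_iff (h : IsTilting lam ν N b) :
    IsFinitePlan μ N γ ↔ IsFinitePlan μ ν γ := by
  obtain ⟨M, hM⟩ := h.bdd_div
  have hm : Measurable fun y => b y / lam := h.meas.div_const lam
  constructor
  · intro hP
    have e : (N : Measure (Fin d → ℝ)).tilted (-fun y => b y / lam) = ν := by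
      rw [h.eq]; exact tilted_neg_same (integrable_exp_of_abs_le hm hM)
    refine ⟨hP.fst, ?_⟩
    rw [← e]
    exact klDiv_tilted_ne_top hm.neg (M := M) (fun y => by
      rw [Pi.neg_apply, abs_neg]; exact hM y) hP.kl
  · intro hP
    refine ⟨hP.fst, ?_⟩
    rw [h.eq]
    exact klDiv_tilted_ne_top hm hM hP.kl

theorem IsTilting.isCubeAC (h : IsTilting lam ν N b) (hν : IsCubeAC R ν) : IsCubeAC R N where
  ac := by rw [h.eq]; exact (tilted_absolutelyContinuous _ _).trans hν.ac
  mem := by rw [h.eq]; exact (tilted_absolutelyContinuous _ _).ae_le hν.mem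

/-- On plans of finite entropy, tilting the target and adding the potential to the cost changes
the objective by a constant. -/
theorem IsTilting.tiltedEnergy_zero (h : IsTilting lam ν N b) (hR : 0 ≤ R) (hμ : IsCubeAC R μ)
    (hν : IsCubeAC R ν) (hlam : 0 < lam) (hP : IsFinitePlan μ ν γ) (ε : ℝ) :
    tiltedEnergy ε lam ν (fun _ => 0) γ = tiltedEnergy ε lam N b γ -
      lam * Real.log (∫ y, Real.exp (b y / lam) ∂(ν : Measure (Fin d → ℝ))) := by
  obtain ⟨M, hM⟩ := h.bdd_div
  obtain ⟨B, hB⟩ := h.bdd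
  have hm : Measurable fun y => b y / lam := h.meas.div_const lam
  have ib : Integrable (fun q => b q.2) (γ : Measure ((Fin d → ℝ) × (Fin d → ℝ))) :=
    integrable_of_abs_le (h.meas.comp measurable_snd) fun q => hB _
  unfold tiltedEnergy
  rw [toReal_klDiv_tilted hm hM hP.kl, ← h.eq,
    integral_map measurable_snd.aemeasurable hm.aestronglyMeasurable, integral_div,
    integral_add (hP.integrable_weightedCost hR hμ hν ε) ib]
  simp only [add_zero]
  field_simp
  ring

theorem IsTilting.isSoftMinimizer_iff (h : IsTilting lam ν N b) (hR : 0 ≤ R) (hμ : IsCubeAC R μ)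
    (hν : IsCubeAC R ν) (hε : 0 ≤ ε) (hlam : 0 < lam) :
    IsSoftMinimizer ε lam μ ν γ ↔ IsFinitePlan μ N γ ∧
      ∀ γ', IsFinitePlan μ N γ' → tiltedEnergy ε lam N b γ ≤ tiltedEnergy ε lam N b γ' := by
  rw [_root_.isSoftMinimizer_iff hR hμ hν hε hlam]
  simp only [h.isFinitePlan_iff]
  refine and_congr_right fun hP => forall₂_congr fun γ' hP' => ?_
  rw [h.tiltedEnergy_zero hR hμ hν hlam hP, h.tiltedEnergy_zero hR hμ hν hlam hP',
    sub_le_sub_iff_right]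

theorem integrable_of_continuous {ι : Type*} [Fintype ι] {ρ : Measure (ι → ℝ)}
    [IsProbabilityMeasure ρ] (hρ : ∀ᵐ x ∂ρ, x ∈ Metric.closedBall (0 : ι → ℝ) R)
    {m : (ι → ℝ) → ℝ} (hm : Continuous m) : Integrable m ρ := by
  obtain ⟨C, hC⟩ := (isCompact_closedBall (0 : ι → ℝ) R).exists_bound_of_continuousOn
    hm.continuousOn
  exact integrable_of_ae_abs_le hm.measurable (hρ.mono fun x hx => hC x hx)

/-- Existence and uniqueness of the minimizer: with respect to the target tilted by an optimal
potential, the objective is bounded below by a constant, with equality only on the graph of the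
optimal map. -/
theorem existsUnique_isSoftMinimizer (hR : 0 ≤ R) (hμ : IsCubeAC R μ) (hν : IsCubeAC R ν)
    (hε : 0 < ε) (hlam : 0 < lam) : ∃! γ, IsSoftMinimizer ε lam μ ν γ := by
  obtain ⟨g, m, S, hg, ⟨B, hB⟩, hm, hS, hSR, hle, heq, huniq, hlaw⟩ :=
    exists_quadCost_potential (a := fun i : Fin d => ε ^ (i : ℕ)) (fun i => pow_pos hε _) hR hμ.ac
      hμ.mem hν.mem hlam
  have hgm : Measurable fun y => g y / lam := hg.measurable.div_const lam
  have hgB : ∀ y, |g y / lam| ≤ B / |lam| := fun y => by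
    rw [abs_div]; exact div_le_div_of_nonneg_right (hB y) (abs_nonneg _)
  set N : ProbabilityMeasure (Fin d → ℝ) := ⟨_, isProbabilityMeasure_tilted_of_abs_le
    (ν := (ν : Measure (Fin d → ℝ))) hgm hgB⟩ with hN
  have ht : IsTilting lam ν N g := ⟨hg.measurable, ⟨B, hB⟩, rfl⟩
  have hNc := ht.isCubeAC hν
  have hpair : Measurable fun x => (x, S x) := measurable_id.prodMk hS
  set γ₀ : ProbabilityMeasure ((Fin d → ℝ) × (Fin d → ℝ)) :=
    ⟨(μ : Measure (Fin d → ℝ)).map fun x => (x, S x),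
      Measure.isProbabilityMeasure_map hpair.aemeasurable⟩ with hγ₀
  have hfst : HasFirstMarginal μ γ₀ := by
    have : (γ₀ : Measure ((Fin d → ℝ) × (Fin d → ℝ))).map Prod.fst =
        (μ : Measure (Fin d → ℝ)).map id := Measure.map_map measurable_fst hpair
    rw [HasFirstMarginal, this, Measure.map_id]
  have hsnd : (γ₀ : Measure ((Fin d → ℝ) × (Fin d → ℝ))).map Prod.snd = N := by
    have : (γ₀ : Measure ((Fin d → ℝ) × (Fin d → ℝ))).map Prod.snd =
        (μ : Measure (Fin d → ℝ)).map S := Measure.map_map measurable_snd hpair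
    rw [this, hlaw]
    rfl
  have hP₀ : IsFinitePlan μ N γ₀ := ⟨hfst, by rw [hsnd, InformationTheory.klDiv_self]; simp⟩
  have ic : ∀ {γ}, IsFinitePlan μ N γ → Integrable (fun q => weightedCost ε q.1 q.2 + g q.2)
      (γ : Measure ((Fin d → ℝ) × (Fin d → ℝ))) := fun {γ} hP =>
    (hP.integrable_weightedCost hR hμ hNc ε).add
      (integrable_of_abs_le (hg.measurable.comp measurable_snd) fun q => hB _)
  have im : ∀ {γ}, IsFinitePlan μ N γ → Integrable (fun q => m q.1)
      (γ : Measure ((Fin d → ℝ) × (Fin d → ℝ))) := fun {γ} hP => by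
    have h1 := integrable_of_continuous hμ.mem hm
    have h2 := hP.fst
    unfold HasFirstMarginal at h2
    rw [← h2] at h1
    exact h1.comp_measurable measurable_fst
  have hae : ∀ {γ}, IsFinitePlan μ N γ → ∀ᵐ q ∂(γ : Measure ((Fin d → ℝ) × (Fin d → ℝ))),
      m q.1 ≤ weightedCost ε q.1 q.2 + g q.2 := fun {γ} hP => by
    filter_upwards [hP.ae_snd hNc.mem] with q hq using hle _ _ hq
  have hE₀ : tiltedEnergy ε lam N g γ₀ = ∫ x, m x ∂(μ : Measure (Fin d → ℝ)) := by
    have hmeas : Measurable fun q : (Fin d → ℝ) × (Fin d → ℝ) => weightedCost ε q.1 q.2 + g q.2 :=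
      (Finset.measurable_fun_sum _ fun i _ => (measurable_sq_sub i).const_mul _).add
        (hg.measurable.comp measurable_snd)
    unfold tiltedEnergy
    rw [hsnd, InformationTheory.klDiv_self, ENNReal.toReal_zero, mul_zero, zero_add]
    refine (integral_map hpair.aemeasurable hmeas.aestronglyMeasurable).trans ?_
    exact integral_congr_ae heq
  have hmin : ∀ γ, IsFinitePlan μ N γ →
      tiltedEnergy ε lam N g γ₀ ≤ tiltedEnergy ε lam N g γ := fun γ hP => by
    rw [hE₀, ← hP.integral_fst hm.measurable]
    refine (integral_mono_ae (im hP) (ic hP) (hae hP)).trans ?_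
    exact le_add_of_nonneg_left (mul_nonneg hlam.le ENNReal.toReal_nonneg)
  refine ⟨γ₀, (ht.isSoftMinimizer_iff hR hμ hν hε.le hlam).2 ⟨hP₀, hmin⟩, fun γ hγ => ?_⟩
  obtain ⟨hP, hopt⟩ := (ht.isSoftMinimizer_iff hR hμ hν hε.le hlam).1 hγ
  have h1 : ∫ q, (weightedCost ε q.1 q.2 + g q.2) ∂(γ : Measure ((Fin d → ℝ) × (Fin d → ℝ))) ≤
      ∫ q, m q.1 ∂(γ : Measure ((Fin d → ℝ) × (Fin d → ℝ))) := by
    refine le_trans ?_ ((hopt γ₀ hP₀).trans ?_)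
    · exact le_add_of_nonneg_left (mul_nonneg hlam.le ENNReal.toReal_nonneg)
    · rw [hE₀, ← hP.integral_fst hm.measurable]
  have h2 : ∀ᵐ q ∂(γ : Measure ((Fin d → ℝ) × (Fin d → ℝ))),
      weightedCost ε q.1 q.2 + g q.2 - m q.1 = 0 := by
    refine (integral_eq_zero_iff_of_nonneg_ae ?_ ((ic hP).sub (im hP))).1 ?_
    · filter_upwards [hae hP] with q hq using sub_nonneg.2 hq
    · refine le_antisymm ?_ (integral_nonneg_of_ae ?_)
      · rw [integral_sub' (ic hP) (im hP)]
        exact sub_nonpos.2 h1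
      · filter_upwards [hae hP] with q hq using sub_nonneg.2 hq
  have h3 : (fun q : (Fin d → ℝ) × (Fin d → ℝ) => q)
      =ᵐ[(γ : Measure ((Fin d → ℝ) × (Fin d → ℝ)))] fun q => (q.1, S q.1) := by
    filter_upwards [h2, hP.ae_snd hNc.mem, hP.ae_fst huniq] with q hq hq2 hq1
    exact Prod.ext rfl (hq1 _ hq2 (by
      have : quadCost (fun i : Fin d => ε ^ (i : ℕ)) q.1 q.2 = weightedCost ε q.1 q.2 := rfl
      rw [this]; linarith))
  refine Subtype.ext ?_
  have h4 : (γ : Measure ((Fin d → ℝ) × (Fin d → ℝ))).map (fun q => q) =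
      (γ : Measure ((Fin d → ℝ) × (Fin d → ℝ))).map fun q => (q.1, S q.1) := Measure.map_congr h3
  rw [Measure.map_id'] at h4
  have h5 : (γ : Measure ((Fin d → ℝ) × (Fin d → ℝ))).map (fun q => (q.1, S q.1)) =
      (μ : Measure (Fin d → ℝ)).map fun x => (x, S x) := by
    have h6 := hP.fst
    unfold HasFirstMarginal at h6
    rw [← h6, Measure.map_map hpair measurable_fst]
    rfl
  exact h4.trans h5

end

/-! ### Lebesgue densities -/

section

variable {d : ℕ} {R lam : ℝ} {ν N : ProbabilityMeasure (Fin d → ℝ)}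

theorem IsTilting.lebDensity_eq {b : (Fin d → ℝ) → ℝ} (h : IsTilting lam ν N b) :
    ∀ᵐ y ∂(volume : Measure (Fin d → ℝ)), lebDensity N y =
      Real.exp (b y / lam) / (∫ z, Real.exp (b z / lam) ∂(ν : Measure (Fin d → ℝ))) *
        lebDensity ν y := by
  have := toReal_rnDeriv_tilted_left (ν : Measure (Fin d → ℝ))
    (ν := (volume : Measure (Fin d → ℝ))) (h.meas.div_const lam).aemeasurable
  unfold lebDensity
  rw [h.eq]
  exact this

theorem lebDensity_nonneg (y : Fin d → ℝ) : 0 ≤ lebDensity ν y := ENNReal.toReal_nonneg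

theorem IsCubeAC.lebDensity_eq_zero (hν : IsCubeAC R ν) :
    ∀ᵐ y ∂(volume : Measure (Fin d → ℝ)), y ∉ Metric.closedBall (0 : Fin d → ℝ) R →
      lebDensity ν y = 0 := by
  filter_upwards [Measure.ae_rnDeriv_ne_zero_imp_of_ae (volume : Measure (Fin d → ℝ)) hν.mem]
    with y hy hyR
  by_contra hne
  refine hyR (hy fun h0 => hne ?_)
  rw [lebDensity, h0, ENNReal.toReal_zero]

end

/-! ### The limit problem for the first coordinate -/

section

variable {d : ℕ} [NeZero d] {R lam : ℝ} {μ ν N : ProbabilityMeasure (Fin d → ℝ)}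

/-- An optimal potential `b` and its transform `m` for the one-dimensional soft problem between the
first marginals, together with an optimal map `S`. -/
structure IsFirstPotential (R lam : ℝ) (μ ν : ProbabilityMeasure (Fin d → ℝ)) (b m : ℝ → ℝ)
    (S : (Fin d → ℝ) → ℝ) : Prop where
  continuous_b : Continuous b
  bdd_b : ∃ B, ∀ t, |b t| ≤ B
  continuous_m : Continuous m
  measurable_S : Measurable S
  abs_S_le : ∀ x, |S x| ≤ R
  le : ∀ s t, |t| ≤ R → m s ≤ (s - t) ^ 2 + b t
  ae_eq : ∀ᵐ x ∂(μ : Measure (Fin d → ℝ)), (x 0 - S x) ^ 2 + b (S x) = m (x 0)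
  map_eq : (μ : Measure (Fin d → ℝ)).map S =
    ((ν : Measure (Fin d → ℝ)).tilted fun y => b (y 0) / lam).map fun y => y 0

/-- Duality for the first marginals, which are regarded as measures on `Fin 1 → ℝ`. -/
theorem exists_isFirstPotential (hR : 0 ≤ R) (hμ : IsCubeAC R μ) (hν : IsCubeAC R ν)
    (hlam : 0 < lam) : ∃ b m S, IsFirstPotential R lam μ ν b m S := by
  set e : (Fin d → ℝ) → Fin 1 → ℝ := fun x _ => x 0 with he
  have hem : Measurable e := measurable_pi_lambda _ fun _ => measurable_coord 0
  set c : ℝ → Fin 1 → ℝ := fun t _ => t with hc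
  have hcc : Continuous c := continuous_pi fun _ => continuous_id
  have hc0 : ∀ y : Fin 1 → ℝ, c (y 0) = y := fun y => by
    ext j; rw [Subsingleton.elim j 0]
  have hball : ∀ y : Fin 1 → ℝ, y ∈ Metric.closedBall (0 : Fin 1 → ℝ) R ↔ |y 0| ≤ R := fun y => by
    rw [mem_cube_iff hR]
    exact ⟨fun h => h 0, fun h j => by rwa [Subsingleton.elim j 0]⟩
  have hmem : ∀ {ρ : ProbabilityMeasure (Fin d → ℝ)}, IsCubeAC R ρ →
      ∀ᵐ y ∂(ρ : Measure (Fin d → ℝ)).map e, y ∈ Metric.closedBall (0 : Fin 1 → ℝ) R := by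
    intro ρ hρ
    refine (ae_map_iff hem.aemeasurable Metric.isClosed_closedBall.measurableSet).2 ?_
    filter_upwards [hρ.mem] with x hx
    exact (hball _).2 ((mem_cube_iff hR).1 hx 0)
  have hqmp : Measure.QuasiMeasurePreserving e volume volume := by
    have h1 : Measure.QuasiMeasurePreserving (Function.eval (0 : Fin d))
        (volume : Measure (Fin d → ℝ)) (volume : Measure ℝ) :=
      Measure.quasiMeasurePreserving_eval (fun _ => volume) 0
    have h2 := ((volume_preserving_funUnique (Fin 1) ℝ).symm).quasiMeasurePreserving
    have h3 := h2.comp h1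
    have h4 : (⇑(MeasurableEquiv.funUnique (Fin 1) ℝ).symm ∘ Function.eval (0 : Fin d)) = e := by
      ext x j
      rfl
    rwa [h4] at h3
  have hac : (μ : Measure (Fin d → ℝ)).map e ≪ volume :=
    (hμ.ac.map hem).trans hqmp.absolutelyContinuous
  have : IsProbabilityMeasure ((μ : Measure (Fin d → ℝ)).map e) :=
    Measure.isProbabilityMeasure_map hem.aemeasurable
  have : IsProbabilityMeasure ((ν : Measure (Fin d → ℝ)).map e) :=
    Measure.isProbabilityMeasure_map hem.aemeasurable
  obtain ⟨g, m, S, hg, ⟨B, hB⟩, hm, hS, hSR, hle, heq, -, hlaw⟩ :=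
    exists_quadCost_potential (a := fun _ : Fin 1 => 1) (fun _ => one_pos) hR hac
      (hmem hμ) (hmem hν) hlam
  have hq : ∀ x y : Fin 1 → ℝ, quadCost (fun _ => 1) x y = (x 0 - y 0) ^ 2 := fun x y => by
    simp [quadCost]
  have h0 : Measurable fun y : Fin 1 → ℝ => y 0 := measurable_pi_apply 0
  refine ⟨g ∘ c, m ∘ c, fun x => S (e x) 0, hg.comp hcc, ⟨B, fun t => hB _⟩, hm.comp hcc,
    h0.comp (hS.comp hem), fun x => (hball _).1 (hSR _), fun s t ht => ?_, ?_, ?_⟩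
  · have := hle (c s) (c t) ((hball _).2 ht)
    rwa [hq] at this
  · filter_upwards [ae_of_ae_map hem.aemeasurable heq] with x hx
    rw [hq] at hx
    simpa [Function.comp, hc0] using hx
  · have e1 : (fun x => S (e x) 0) = (fun y : Fin 1 → ℝ => y 0) ∘ S ∘ e := rfl
    have e2 : (fun y : Fin d → ℝ => y 0) = (fun y : Fin 1 → ℝ => y 0) ∘ e := rfl
    have e3 : (fun y : Fin d → ℝ => (g ∘ c) (y 0) / lam) = (fun y => g y / lam) ∘ e := rfl
    rw [e1, e2, e3, ← Measure.map_map h0 (hS.comp hem), ← Measure.map_map hS hem, hlaw,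
      ← tilted_map_comp _ hem (hg.measurable.div_const lam), Measure.map_map h0 hem]

variable {b m : ℝ → ℝ} {S : (Fin d → ℝ) → ℝ}

theorem IsFirstPotential.bdd_div (h : IsFirstPotential R lam μ ν b m S) :
    ∃ M, ∀ y : Fin d → ℝ, |b (y 0) / lam| ≤ M := by
  obtain ⟨M, hM⟩ := h.bdd_b
  refine ⟨M / |lam|, fun y => ?_⟩
  rw [abs_div]
  exact div_le_div_of_nonneg_right (hM _) (abs_nonneg _)

theorem IsFirstPotential.integrable_m (h : IsFirstPotential R lam μ ν b m S)
    (hμ : IsCubeAC R μ) : Integrable (fun x => m (x 0)) (μ : Measure (Fin d → ℝ)) :=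
  integrable_of_continuous hμ.mem (h.continuous_m.comp (continuous_apply 0))

/-- The first component of the Knothe-Rosenblatt map is optimal for the limit problem, since it is
the most correlated one among the maps with the law of `S`. -/
theorem IsFirstPotential.ae_krMap_eq (h : IsFirstPotential R lam μ ν b m S) (hR : 0 ≤ R)
    (hμ : IsCubeAC R μ) (hN : IsCubeAC R N)
    (hNt : IsTilting lam ν N fun y => b (y 0)) :
    ∀ᵐ x ∂(μ : Measure (Fin d → ℝ)),
      (x 0 - krMap R μ N x 0) ^ 2 + b (krMap R μ N x 0) = m (x 0) := by
  obtain ⟨B, hB⟩ := h.bdd_b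
  have hTm : Measurable fun x => krMap R μ N x 0 := (measurable_coord 0).comp (measurable_krMap hR)
  have hTR : ∀ x, |krMap R μ N x 0| ≤ R := fun x => abs_krMap_le hR x 0
  have hlaw : (μ : Measure (Fin d → ℝ)).map S = (N : Measure (Fin d → ℝ)).map fun y => y 0 := by
    rw [h.map_eq, hNt.eq]
  have hTlaw : (μ : Measure (Fin d → ℝ)).map (fun x => krMap R μ N x 0) =
      (N : Measure (Fin d → ℝ)).map fun y => y 0 := by
    conv_rhs => rw [← map_krMap hR hμ hN]
    rw [Measure.map_map (measurable_coord 0) (measurable_krMap hR)]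
    rfl
  have hsq : Measurable fun t : ℝ => t ^ 2 + b t :=
    (measurable_id.pow_const 2).add h.continuous_b.measurable
  have hx2 : Integrable (fun x => x 0 ^ 2) (μ : Measure (Fin d → ℝ)) :=
    integrable_of_continuous hμ.mem (by fun_prop)
  have hcost : ∀ {F : (Fin d → ℝ) → ℝ}, Measurable F → (∀ x, |F x| ≤ R) →
      Integrable (fun x => (x 0 - F x) ^ 2 + b (F x)) (μ : Measure (Fin d → ℝ)) ∧
      ∫ x, ((x 0 - F x) ^ 2 + b (F x)) ∂(μ : Measure (Fin d → ℝ)) =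
        ∫ x, x 0 ^ 2 ∂(μ : Measure (Fin d → ℝ)) +
        ∫ t, (t ^ 2 + b t) ∂((μ : Measure (Fin d → ℝ)).map F) -
        2 * ∫ x, x 0 * F x ∂(μ : Measure (Fin d → ℝ)) := by
    intro F hF hFR
    have i1 : Integrable (fun x => F x ^ 2 + b (F x)) (μ : Measure (Fin d → ℝ)) := by
      refine integrable_of_abs_le (hsq.comp hF) (M := R ^ 2 + B) fun x => ?_
      refine (abs_add_le _ _).trans (add_le_add ?_ (hB _))
      rw [abs_pow]
      exact pow_le_pow_left₀ (abs_nonneg _) (hFR x) 2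
    have i2 : Integrable (fun x => x 0 * F x) (μ : Measure (Fin d → ℝ)) := by
      refine integrable_of_ae_abs_le ((measurable_coord 0).mul hF) (M := R * R) ?_
      filter_upwards [hμ.mem] with x hx
      rw [abs_mul]
      exact mul_le_mul ((mem_cube_iff hR).1 hx 0) (hFR x) (abs_nonneg _) hR
    have e : (fun x : Fin d → ℝ => (x 0 - F x) ^ 2 + b (F x)) =
        fun x => x 0 ^ 2 + (F x ^ 2 + b (F x)) - 2 * (x 0 * F x) := by
      ext x; ring
    rw [e]
    refine ⟨(hx2.add i1).sub (i2.const_mul 2), ?_⟩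
    rw [integral_sub (hx2.fun_add i1) (i2.const_mul 2), integral_add hx2 i1, integral_const_mul,
      integral_map hF.aemeasurable hsq.aestronglyMeasurable]
  obtain ⟨iS, eS⟩ := hcost h.measurable_S h.abs_S_le
  obtain ⟨iT, eT⟩ := hcost hTm hTR
  have hmul := integral_mul_le_integral_mul_krMap hR hμ hN h.measurable_S h.abs_S_le hlaw
  have hle : ∫ x, ((x 0 - krMap R μ N x 0) ^ 2 + b (krMap R μ N x 0))
      ∂(μ : Measure (Fin d → ℝ)) ≤ ∫ x, m (x 0) ∂(μ : Measure (Fin d → ℝ)) := by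
    rw [← integral_congr_ae h.ae_eq, eS, eT, hTlaw, hlaw]
    linarith
  have hnn : ∀ x, 0 ≤ (x 0 - krMap R μ N x 0) ^ 2 + b (krMap R μ N x 0) - m (x 0) := fun x =>
    sub_nonneg.2 (h.le _ _ (hTR x))
  have hz := (integral_eq_zero_iff_of_nonneg_ae (Eventually.of_forall hnn)
    (iT.sub (h.integrable_m hμ))).1 (le_antisymm (by
      rw [integral_sub iT (h.integrable_m hμ)]
      exact sub_nonpos.2 hle) (integral_nonneg hnn))
  filter_upwards [hz] with x hx using sub_eq_zero.1 hx

/-- Minimality for `ε = 0` of the Knothe-Rosenblatt plan: its cost is `∫ m dμ`, a lower bound for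
the cost of every plan. -/
theorem IsFirstPotential.isMinimizingFamily (h : IsFirstPotential R lam μ ν b m S) (hR : 0 ≤ R)
    (hμ : IsCubeAC R μ) (hν : IsCubeAC R ν) (hNt : IsTilting lam ν N fun y => b (y 0))
    (hlam : 0 < lam) {γ : ℝ → ProbabilityMeasure ((Fin d → ℝ) × (Fin d → ℝ))}
    (hγ : ∀ ε : ℝ, 0 < ε → IsSoftMinimizer ε lam μ ν (γ ε)) :
    IsMinimizingFamily R lam μ N b γ where
  R_nonneg := hR
  lam_pos := hlam
  source := hμ
  target := hNt.isCubeAC hν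
  measurable_b := h.continuous_b.measurable
  bdd_b := h.bdd_b
  plan := fun ε hε => ((hNt.isSoftMinimizer_iff hR hμ hν hε.le hlam).1 (hγ ε hε)).1
  optimal := fun ε hε => ((hNt.isSoftMinimizer_iff hR hμ hν hε.le hlam).1 (hγ ε hε)).2
  optimal_zero := fun γ' hP => by
    obtain ⟨B, hB⟩ := h.bdd_b
    have hN := hNt.isCubeAC hν
    have hm : Measurable fun x : Fin d → ℝ => m (x 0) :=
      h.continuous_m.measurable.comp (measurable_coord 0)
    rw [integral_congr_ae (h.ae_krMap_eq hR hμ hN hNt), ← hP.integral_fst hm]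
    have im := h.integrable_m hμ
    have h2 := hP.fst
    unfold HasFirstMarginal at h2
    rw [← h2] at im
    refine integral_mono_ae (im.comp_measurable measurable_fst)
      ((hP.integrable_sq_sub hR hμ hN 0).add (integrable_of_abs_le
        (h.continuous_b.measurable.comp (measurable_snd_coord 0)) fun q => hB _)) ?_
    filter_upwards [hP.ae_mem hR hμ hN] with q hq
    exact h.le _ _ (hq.2 0)

/-! ### The density of the limit target -/

/-- The normalizing function `s ↦ Z * e^(-m(s) / lam)` in the density formula of the limit target,
where `Z` normalizes the tilting by `b / lam`. -/
def partitionFn (lam : ℝ) (ν : ProbabilityMeasure (Fin d → ℝ)) (b m : ℝ → ℝ) (s : ℝ) : ℝ :=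
  (∫ y, Real.exp (b (y 0) / lam) ∂(ν : Measure (Fin d → ℝ))) * Real.exp (-m s / lam)

theorem IsFirstPotential.normalization_pos (h : IsFirstPotential R lam μ ν b m S) :
    0 < ∫ y, Real.exp (b (y 0) / lam) ∂(ν : Measure (Fin d → ℝ)) := by
  obtain ⟨M, hM⟩ := h.bdd_div
  exact integral_exp_pos (integrable_exp_of_abs_le
    ((h.continuous_b.measurable.comp (measurable_coord 0)).div_const lam) hM)

theorem IsFirstPotential.partitionFn_pos (h : IsFirstPotential R lam μ ν b m S) (s : ℝ) :
    0 < partitionFn lam ν b m s := mul_pos h.normalization_pos (Real.exp_pos _)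

theorem IsFirstPotential.continuous_partitionFn (h : IsFirstPotential R lam μ ν b m S) :
    Continuous (partitionFn lam ν b m) :=
  continuous_const.mul (Real.continuous_exp.comp (h.continuous_m.neg.div_const lam))

theorem inv_partitionFn_mul_exp (s t : ℝ) :
    (partitionFn lam ν b m s)⁻¹ * Real.exp (-(s - t) ^ 2 / lam) =
      Real.exp ((m s - (s - t) ^ 2) / lam) /
        ∫ y, Real.exp (b (y 0) / lam) ∂(ν : Measure (Fin d → ℝ)) := by
  have e : (m s - (s - t) ^ 2) / lam = -(-m s / lam) + -(s - t) ^ 2 / lam := by ring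
  rw [partitionFn, mul_inv, e, Real.exp_add, Real.exp_neg (-m s / lam)]
  ring

end

theorem exists_isCubeAC {d : ℕ} {μ ν : ProbabilityMeasure (Fin d → ℝ)}
    (hμ : (μ : Measure (Fin d → ℝ)) ≪ volume) (hν : (ν : Measure (Fin d → ℝ)) ≪ volume)
    (hμc : IsCompact (μ : Measure (Fin d → ℝ)).support)
    (hνc : IsCompact (ν : Measure (Fin d → ℝ)).support) :
    ∃ R, 0 ≤ R ∧ IsCubeAC R μ ∧ IsCubeAC R ν := by
  obtain ⟨r, hr⟩ := (hμc.union hνc).isBounded.subset_closedBall (0 : Fin d → ℝ)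
  have hsub := hr.trans (Metric.closedBall_subset_closedBall (le_max_left r 0))
  refine ⟨max r 0, le_max_right _ _, ⟨hμ, ?_⟩, ⟨hν, ?_⟩⟩
  · filter_upwards [Measure.support_mem_ae (μ := (μ : Measure (Fin d → ℝ)))] with x hx
    exact hsub (Or.inl hx)
  · filter_upwards [Measure.support_mem_ae (μ := (ν : Measure (Fin d → ℝ)))] with x hx
    exact hsub (Or.inr hx)

end

theorem mainTheorem1 {d : ℕ} [NeZero d] (μ ν : ProbabilityMeasure (Fin d → ℝ))
    (hμ : (μ : Measure (Fin d → ℝ)) ≪ volume) (hν : (ν : Measure (Fin d → ℝ)) ≪ volume)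
    (hμc : IsCompact (μ : Measure (Fin d → ℝ)).support)
    (hνc : IsCompact (ν : Measure (Fin d → ℝ)).support)
    (lam : ℝ) (hlam : 0 < lam) :
    (∀ ε : ℝ, 0 < ε →
      ∃! γ : ProbabilityMeasure ((Fin d → ℝ) × (Fin d → ℝ)), IsSoftMinimizer ε lam μ ν γ) ∧
    ∃ (νlam : ProbabilityMeasure (Fin d → ℝ)) (T : (Fin d → ℝ) → (Fin d → ℝ))
      (γKR : ProbabilityMeasure ((Fin d → ℝ) × (Fin d → ℝ))) (D : ℝ → ℝ),
      IsKnotheRosenblattMap μ νlam T ∧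
      IsInducedPlan μ T γKR ∧
      (∀ γ : ℝ → ProbabilityMeasure ((Fin d → ℝ) × (Fin d → ℝ)),
        (∀ ε : ℝ, 0 < ε → IsSoftMinimizer ε lam μ ν (γ ε)) →
          Tendsto γ (𝓝[>] (0 : ℝ)) (𝓝 γKR)) ∧
      (νlam : Measure (Fin d → ℝ)) ≪ volume ∧
      Continuous D ∧ (∀ s : ℝ, 0 < D s) ∧
      (∀ᵐ p ∂(γKR : Measure ((Fin d → ℝ) × (Fin d → ℝ))),
        lebDensity νlam p.2 =
          (D (p.1 0))⁻¹ * Real.exp (-(p.1 0 - p.2 0) ^ 2 / lam) * lebDensity ν p.2) ∧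
      (∀ s : ℝ, ∀ᵐ y ∂(volume : Measure (Fin d → ℝ)),
        (D s)⁻¹ * Real.exp (-(s - y 0) ^ 2 / lam) * lebDensity ν y ≤ lebDensity νlam y) := by
  obtain ⟨R, hR, hμR, hνR⟩ := exists_isCubeAC hμ hν hμc hνc
  refine ⟨fun ε hε => existsUnique_isSoftMinimizer hR hμR hνR hε hlam, ?_⟩
  obtain ⟨b, m, S, hb⟩ := exists_isFirstPotential hR hμR hνR hlam
  obtain ⟨M, hM⟩ := hb.bdd_div
  obtain ⟨B, hB⟩ := hb.bdd_b
  have hbm : Measurable fun y : Fin d → ℝ => b (y 0) :=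
    hb.continuous_b.measurable.comp (measurable_coord 0)
  set N : ProbabilityMeasure (Fin d → ℝ) := ⟨_, isProbabilityMeasure_tilted_of_abs_le
    (ν := (ν : Measure (Fin d → ℝ))) (hbm.div_const lam) hM⟩ with hN
  have hNt : IsTilting lam ν N fun y => b (y 0) := ⟨hbm, ⟨B, fun y => hB _⟩, rfl⟩
  have hNR := hNt.isCubeAC hνR
  refine ⟨N, krMap R μ N, krPlan R hR μ N, partitionFn lam ν b m,
    isKnotheRosenblattMap_krMap hR hμR hNR, rfl, fun γ hγ => ?_, hNR.ac,
    hb.continuous_partitionFn, hb.partitionFn_pos, ?_, fun s => ?_⟩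
  · have hfam := hb.isMinimizingFamily hR hμR hνR hNt hlam hγ
    refine tendsto_of_tendsto_measureReal_dist (T := krMap R μ N) ?_ (measurable_krMap hR) rfl
      fun r hr => tendsto_measureReal_le_dist_pi
        (fun k r hr => hfam.tendsto_measureReal_coord k hr) hr
    filter_upwards [self_mem_nhdsWithin] with ε hε using (hγ ε hε).1
  · have hKR := isFinitePlan_krPlan hR hμR hNR
    have h1 : ∀ᵐ p ∂(krPlan R hR μ N : Measure ((Fin d → ℝ) × (Fin d → ℝ))),
        (p.1 0 - p.2 0) ^ 2 + b (p.2 0) = m (p.1 0) := by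
      have hmeas : MeasurableSet {p : (Fin d → ℝ) × (Fin d → ℝ) |
          (p.1 0 - p.2 0) ^ 2 + b (p.2 0) = m (p.1 0)} :=
        measurableSet_eq_fun ((measurable_sq_sub 0).add (hbm.comp measurable_snd))
          (hb.continuous_m.measurable.comp (measurable_fst_coord 0))
      exact (ae_map_iff (measurable_id.prodMk (measurable_krMap hR)).aemeasurable hmeas).2
        (hb.ae_krMap_eq hR hμR hNR hNt)
    filter_upwards [h1, hKR.ae_snd (hNR.ac.ae_le hNt.lebDensity_eq)] with p hp1 hp2
    rw [hp2, inv_partitionFn_mul_exp, ← hp1, add_sub_cancel_left]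
  · filter_upwards [hNt.lebDensity_eq, hνR.lebDensity_eq_zero] with y hy1 hy2
    rw [hy1, inv_partitionFn_mul_exp]
    by_cases hyR : y ∈ Metric.closedBall (0 : Fin d → ℝ) R
    · refine mul_le_mul_of_nonneg_right (div_le_div_of_nonneg_right (Real.exp_le_exp.2 ?_)
        hb.normalization_pos.le) (lebDensity_nonneg y)
      refine div_le_div_of_nonneg_right ?_ hlam.le
      linarith [hb.le s (y 0) ((mem_cube_iff hR).1 hyR 0)]
    · rw [hy2 hyR, mul_zero, mul_zero]
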